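/- **Setup.** Let $\Delta\subset\mathbb R^2$ be a two-dimensional convex polygon with vertices in $\mathbb Z^2$ that is *h-transverse*: every edge has an outward normal vector of the form $(0,\pm1)$ or $(\pm1,n)$ with $n\in\mathbb Z$. Let $a(\Delta)$ be its height (maximal minus minimal ordinate), $e^{+\infty}(\Delta)$ and $e^{-\infty}(\Delta)$ the lengths of its top and bottom horizontal edges ($0$ if there is none), $y(\Delta)=|\partial\Delta\cap\mathbb Z^2|$, $g_{\max}(\Delta)=|\mathring\Delta\cap\mathbb Z^2|$, and $s_{\max}(\Delta,g)=\lfloor (y(\Delta)-1+g)/2\rfloor$. Let $b_{\rm left}(\Delta)$ (resp. $b_{\rm right}(\Delta)$) be the multiset in which $k\in\mathbb Z$ has multiplicity the integral length of the side with outward normal vector $(-1,k)$ (resp. $(1,k)$). A *floor diagram* with Newton polygon $\Delta$ and genus $g\in\mathbb N$ is a finite connected acyclic oriented graph of first Betti number $g$ (multiple edges allowed), with $a(\Delta)$ vertices, with bounded edges joining two vertices and with infinite edges adjacent to one vertex, of which $e^{-\infty}(\Delta)$ are oriented toward their vertex and $e^{+\infty}(\Delta)$ from it, together with weights $w(e)\in\mathbb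 N^*$ on the edges, equal to $1$ on infinite edges, and bijections $L$, $R$ from the vertices to $b_{\rm left}(\Delta)$, $b_{\rm right}(\Delta)$, such that at each vertex $v$ the sum of the entering weights minus the sum of the leaving weights is $L(v)+R(v)$. A *marking* $m$ is a bijection from the set of vertices and edges to $\{1,\dots,n\}$, $n$ being their number, that is increasing along oriented paths. Isomorphisms of marked floor diagrams are the isomorphisms of oriented graphs that preserve $w$, $L$, $R$ and $m$. A *pairing of order $s$* of $\{1,\dots,N\}$ is a set $S$ of $s$ pairwise disjoint pairs $\{j,j+1\}\subset\{1,\dots,N\}$. It is *compatible* with $m$ if for each $\alpha\in S$ the set $m^{-1}(\alpha)$ consists of an edge and an adjacent vertex, or of two edges that both enter or both leave the same vertex. Put $[n](q)=\frac{q^{n/2}-q^{-n/2}}{q^{1/2}-q^{-1/2}}$, and $$\mu_S(\mathcal D,m)=\prod_{e\in E_0}[w(e)](q)^2\prod_{e\in E_1}[w(e)](q^2)\prod_{\{e,e'\}\in E_2}\frac{[w(e)](q)\,[w(e')](q)\,[w(e)+w(e')](q)}{[2](q)}$$ if $S$ and $m$ are compatible and $\mu_S(\mathcal D,m)=0$ otherwise,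 where $E_0$ is the set of edges in no $m^{-1}(\alpha)$, $\alpha\in S$, $E_1$ the set of edges paired with a vertex, and $E_2$ the set of pairs of edges paired together. Let $$G_g(\Delta,S)=\sum_{(\mathcal D,m)}\mu_S(\mathcal D,m)\in\mathbb Z[q^{\pm1}],$$ the sum over the isomorphism classes of marked floor diagrams with Newton polygon $\Delta$ and genus $g$. One writes $G_g(\Delta,s)$ for $G_g(\Delta,S)$, where $S$ is any pairing of order $s\le s_{\max}(\Delta,g)$ of $\{1,\dots,2s_{\max}(\Delta,g)\}$. The codegree $i$ coefficient $\langle G_g(\Delta,s)\rangle_i$ is the coefficient of $q^{g_{\max}(\Delta)-g-i}$. **Corollary 3.6.** Let $\Delta$ be an h-transverse polygon and $g\in\mathbb N$. For any $i\in\mathbb N$, $$\langle G_g(\Delta,0)\rangle_i\ \ge\ \langle G_g(\Delta,1)\rangle_i\ \ge\ \cdots\ \ge\ \langle G_g(\Delta,s_{\max}(\Delta,g))\rangle_i ,$$ whatever pairings of the respective orders are used: for $0\le s\le s'\le s_{\max}(\Delta,g)$ and any pairings $S$, $S'$ of $\{1,\dots,2s_{\max}(\Delta,g)\}$ of orders $s$,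 $s'$, the codegree $i$ coefficient of $G_g(\Delta,S')$ is at most that of $G_g(\Delta,S)$. -/

import Mathlib

open scoped LaurentPolynomial

/-! ### Lattice polygons -/

/-- The inclusion of the lattice `ℤ²` into the plane. -/
def latticeToPlane (p : ℤ × ℤ) : ℝ × ℝ := ((p.1 : ℝ), (p.2 : ℝ))

/-- A (two-dimensional) convex polygon with vertices in `ℤ²`. -/
structure LatticePolygon where
  carrier : Set (ℝ × ℝ)
  exists_vertices : ∃ s : Finset (ℤ × ℤ), carrier = convexHull ℝ (latticeToPlane '' (s : Set (ℤ × ℤ)))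
  interior_nonempty : (interior carrier).Nonempty

namespace LatticePolygon

variable (Δ : LatticePolygon)

/-- The face of `Δ` on which the linear form `⟨u, ·⟩` is maximal; for `u ≠ 0` it is an edge
or a vertex, and it has `u` as an outward normal vector. -/
def face (u : ℝ × ℝ) : Set (ℝ × ℝ) :=
  {p | p ∈ Δ.carrier ∧ ∀ q ∈ Δ.carrier, u.1 * q.1 + u.2 * q.2 ≤ u.1 * p.1 + u.2 * p.2}

/-- Edges are the faces with more than one point. -/
def IsEdge (F : Set (ℝ × ℝ)) : Prop :=
  F.Nontrivial ∧ ∃ u : ℝ × ℝ, u ≠ 0 ∧ F = Δ.face u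

/-- Every edge has an outward normal vector of the form `(0, ±1)` or `(±1, n)`, `n ∈ ℤ`. -/
def HTransverse : Prop :=
  ∀ F, Δ.IsEdge F →
    F = Δ.face (0, 1) ∨ F = Δ.face (0, -1) ∨
      ∃ n : ℤ, F = Δ.face (1, (n : ℝ)) ∨ F = Δ.face (-1, (n : ℝ))

/-- The integral length of the face with outward normal vector `u`: the number of its lattice
points minus one (`0` if the face is a vertex). -/
noncomputable def sideLength (u : ℝ × ℝ) : ℕ :=
  {p : ℤ × ℤ | latticeToPlane p ∈ Δ.face u}.ncard - 1

/-- The height `a(Δ)`. -/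
noncomputable def height : ℝ :=
  sSup (Prod.snd '' Δ.carrier) - sInf (Prod.snd '' Δ.carrier)

/-- `e^{+∞}(Δ)`, the length of the top horizontal edge. -/
noncomputable def ePlus : ℕ := Δ.sideLength (0, 1)

/-- `e^{-∞}(Δ)`, the length of the bottom horizontal edge. -/
noncomputable def eMinus : ℕ := Δ.sideLength (0, -1)

/-- The multiplicity of `k` in the multiset `b_left(Δ)`. -/
noncomputable def bLeft (k : ℤ) : ℕ := Δ.sideLength (-1, (k : ℝ))

/-- The multiplicity of `k` in the multiset `b_right(Δ)`. -/
noncomputable def bRight (k : ℤ) : ℕ := Δ.sideLength (1, (k : ℝ))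

/-- `y(Δ)`, the number of lattice points on the boundary. -/
noncomputable def y : ℕ := {p : ℤ × ℤ | latticeToPlane p ∈ frontier Δ.carrier}.ncard

/-- `g_max(Δ)`, the number of lattice points in the interior. -/
noncomputable def gMax : ℕ := {p : ℤ × ℤ | latticeToPlane p ∈ interior Δ.carrier}.ncard

/-- `s_max(Δ, g) = ⌊(y(Δ) - 1 + g) / 2⌋` (note that `y(Δ) ≥ 3`). -/
noncomputable def sMax (g : ℕ) : ℕ := (Δ.y - 1 + g) / 2

end LatticePolygon

/-! ### Weighted oriented graphs with infinite edges -/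

/-- A finite oriented graph with positive integer weights. Multiple edges are allowed. An edge
with `src e = none` is a source (an infinite edge oriented toward its only vertex), an edge with
`tgt e = none` is a sink. -/
structure WeightedGraph where
  V : Type
  E : Type
  [fintypeV : Fintype V]
  [fintypeE : Fintype E]
  src : E → Option V
  tgt : E → Option V
  adjacent : ∀ e, src e ≠ none ∨ tgt e ≠ none
  w : E → ℕ
  w_pos : ∀ e, 0 < w e

attribute [instance] WeightedGraph.fintypeV WeightedGraph.fintypeE

namespace WeightedGraph

variable (Γ : WeightedGraph)

/-- There is a bounded edge from `u` to `v`. -/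
def Step (u v : Γ.V) : Prop := ∃ e, Γ.src e = some u ∧ Γ.tgt e = some v

/-- The set of connected components (every edge is adjacent to a vertex). -/
def Components : Type := Quot Γ.Step

def Connected : Prop := Nat.card Γ.Components = 1

/-- There is no oriented cycle. -/
def Acyclic : Prop := ∀ v, ¬ Relation.TransGen Γ.Step v v

/-- The number of bounded edges. -/
noncomputable def numBounded : ℕ := Nat.card {e : Γ.E // Γ.src e ≠ none ∧ Γ.tgt e ≠ none}

noncomputable def numSources : ℕ := Nat.card {e : Γ.E // Γ.src e = none}

noncomputable def numSinks : ℕ := Nat.card {e : Γ.E // Γ.tgt e = none}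

/-- The first Betti number (infinite edges do not contribute to it). -/
noncomputable def genus : ℤ :=
  (Γ.numBounded : ℤ) - Fintype.card Γ.V + Nat.card Γ.Components

open Classical in
/-- The weights entering `v` minus the weights leaving `v`. -/
noncomputable def div (v : Γ.V) : ℤ :=
  (∑ e with Γ.tgt e = some v, (Γ.w e : ℤ)) - ∑ e with Γ.src e = some v, (Γ.w e : ℤ)

/-- The elements of the graph: its vertices and its edges. -/
abbrev Elt : Type := Γ.V ⊕ Γ.E

/-- The number of elements. -/
def numElt : ℕ := Fintype.card Γ.V + Fintype.card Γ.E

/-- Incidence oriented from the first to the second element. -/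
inductive Cover : Γ.Elt → Γ.Elt → Prop
  | leave {v : Γ.V} {e : Γ.E} (h : Γ.src e = some v) : Cover (Sum.inl v) (Sum.inr e)
  | enter {v : Γ.V} {e : Γ.E} (h : Γ.tgt e = some v) : Cover (Sum.inr e) (Sum.inl v)

/-- `α ≺ β`: there is an oriented path from `α` to `β`. -/
def Prec : Γ.Elt → Γ.Elt → Prop := Relation.TransGen Γ.Cover

/-- The edge `e` is adjacent to the vertex `v`. -/
def Adj (e : Γ.E) (v : Γ.V) : Prop := Γ.src e = some v ∨ Γ.tgt e = some v

/-- The edges `e`, `e'` both enter or both leave the same vertex. -/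
def Parallel (e e' : Γ.E) : Prop :=
  ∃ v, (Γ.tgt e = some v ∧ Γ.tgt e' = some v) ∨ (Γ.src e = some v ∧ Γ.src e' = some v)

end WeightedGraph

/-! ### Floor diagrams and markings -/

/-- A floor diagram with Newton polygon `Δ` and genus `g`. A bijection from the vertices to the
multiset `b_left(Δ)` is a function `L` taking each value `k` exactly `Δ.bLeft k` times;
similarly for `R`. -/
structure FloorDiagram (Δ : LatticePolygon) (g : ℕ) extends WeightedGraph where
  L : V → ℤ
  R : V → ℤ
  connected : toWeightedGraph.Connected
  acyclic : toWeightedGraph.Acyclic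
  genus_eq : toWeightedGraph.genus = g
  card_vertices : (Fintype.card V : ℝ) = Δ.height
  card_sinks : toWeightedGraph.numSinks = Δ.ePlus
  card_sources : toWeightedGraph.numSources = Δ.eMinus
  weight_infinite : ∀ e, src e = none ∨ tgt e = none → w e = 1
  card_left : ∀ k : ℤ, Nat.card {v // L v = k} = Δ.bLeft k
  card_right : ∀ k : ℤ, Nat.card {v // R v = k} = Δ.bRight k
  div_eq : ∀ v, toWeightedGraph.div v = L v + R v

/-- A floor diagram with a marking, i.e. an increasing bijection `m` from the set of its
elements to `{1, …, n}`, where `n` is the number of elements. -/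
structure MarkedFloorDiagram (Δ : LatticePolygon) (g : ℕ) extends FloorDiagram Δ g where
  m : V ⊕ E → ℕ
  m_bijOn : Set.BijOn m Set.univ (Set.Icc 1 toWeightedGraph.numElt)
  m_increasing : ∀ α β, toWeightedGraph.Prec α β → m α < m β

/-- `S` is a pairing of order `s` of `{1, …, n}`: a set of `s` disjoint pairs
`{i, i + 1} ⊆ {1, …, n}`. -/
def IsPairing (n s : ℕ) (S : Finset (Finset ℕ)) : Prop :=
  (∀ α ∈ S, ∃ i : ℕ, 1 ≤ i ∧ i + 1 ≤ n ∧ α = {i, i + 1}) ∧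
    (S : Set (Finset ℕ)).Pairwise Disjoint ∧ S.card = s

/-! ### Quantum integers

Laurent polynomials in `q^{1/2}`: the variable `T` of `ℤ[T;T⁻¹]` stands for `q^{1/2}`. -/

/-- `quantum j n = [n](q^j) = q^{j(n-1)/2} + q^{j(n-3)/2} + ⋯ + q^{-j(n-1)/2}`. -/
noncomputable def quantum (j n : ℕ) : ℤ[T;T⁻¹] :=
  ∑ k ∈ Finset.range n, LaurentPolynomial.T ((j : ℤ) * ((n : ℤ) - 1 - 2 * k))

open Classical in
/-- The exact quotient of `a` by `b`, whenever `b` divides `a`. -/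
noncomputable def exactQuot (a b : ℤ[T;T⁻¹]) : ℤ[T;T⁻¹] :=
  if h : b ∣ a then h.choose else 0

/-- `[a] [b] [a + b] / [2]`. -/
noncomputable def pairFactor (a b : ℕ) : ℤ[T;T⁻¹] :=
  exactQuot (quantum 1 a * quantum 1 b * quantum 1 (a + b)) (quantum 1 2)

theorem pairFactor_comm (a b : ℕ) : pairFactor a b = pairFactor b a := by
  unfold pairFactor
  rw [mul_comm (quantum 1 a), add_comm a b]

theorem quantum_mul (j n : ℕ) :
    quantum j n * (LaurentPolynomial.T (j : ℤ) - LaurentPolynomial.T (-(j : ℤ))) =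
      LaurentPolynomial.T ((j : ℤ) * n) - LaurentPolynomial.T (-((j : ℤ) * n)) := by
  have h := Finset.sum_range_sub'
    (fun k : ℕ => (LaurentPolynomial.T ((j : ℤ) * ((n : ℤ) - 2 * k)) : ℤ[T;T⁻¹])) n
  unfold quantum
  rw [Finset.sum_mul]
  have e : ∀ k ∈ Finset.range n,
      (LaurentPolynomial.T ((j : ℤ) * ((n : ℤ) - 1 - 2 * k)) : ℤ[T;T⁻¹]) *
        (LaurentPolynomial.T (j : ℤ) - LaurentPolynomial.T (-(j : ℤ))) =
      LaurentPolynomial.T ((j : ℤ) * ((n : ℤ) - 2 * k)) -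
        LaurentPolynomial.T ((j : ℤ) * ((n : ℤ) - 2 * ((k + 1 : ℕ) : ℤ))) := by
    intro k _
    rw [mul_sub, ← LaurentPolynomial.T_add, ← LaurentPolynomial.T_add]
    congr 2 <;> push_cast <;> ring
  rw [Finset.sum_congr rfl e, h]
  congr 2
  ring

theorem quantum_two_mul (n : ℕ) : quantum 1 (2 * n) = quantum 1 2 * quantum 2 n := by
  have h2 : quantum 1 2 = LaurentPolynomial.T 1 + LaurentPolynomial.T (-1) := by
    simp [quantum, Finset.sum_range_succ]
  have hs : quantum 1 (2 * n) = ∑ k ∈ Finset.range n,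
      (LaurentPolynomial.T (2 * (n : ℤ) - 1 - 2 * (2 * k)) +
        LaurentPolynomial.T (2 * (n : ℤ) - 1 - 2 * (2 * k + 1)) : ℤ[T;T⁻¹]) := by
    unfold quantum
    induction n using Nat.rec with
    | zero => simp
    | succ n _ =>
      have : ∀ (f : ℕ → ℤ[T;T⁻¹]) (N : ℕ), ∑ k ∈ Finset.range (2 * N), f k =
          ∑ k ∈ Finset.range N, (f (2 * k) + f (2 * k + 1)) := by
        intro f N
        induction N with
        | zero => simp
        | succ N ih =>
          rw [show 2 * (N + 1) = 2 * N + 1 + 1 by ring, Finset.sum_range_succ,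
            Finset.sum_range_succ, ih, Finset.sum_range_succ, add_assoc]
      rw [this]
      refine Finset.sum_congr rfl fun k _ => ?_
      congr 2 <;> push_cast <;> ring
  rw [hs, h2]
  unfold quantum
  rw [Finset.mul_sum]
  refine Finset.sum_congr rfl fun k _ => ?_
  rw [add_mul, ← LaurentPolynomial.T_add, ← LaurentPolynomial.T_add]
  congr 2 <;> push_cast <;> ring

/-- The division by `[2]` in `pairFactor` is exact. -/
theorem two_mul_pairFactor (a b : ℕ) :
    quantum 1 2 * pairFactor a b = quantum 1 a * quantum 1 b * quantum 1 (a + b) := by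
  have key : quantum 1 2 ∣ quantum 1 a * quantum 1 b * quantum 1 (a + b) := by
    have ev : ∀ n, Even n → quantum 1 2 ∣ quantum 1 n := by
      rintro n ⟨k, rfl⟩
      rw [← two_mul, quantum_two_mul]
      exact dvd_mul_right _ _
    by_cases ha : Even a
    · exact ((ev a ha).mul_right _).mul_right _
    · by_cases hb : Even b
      · exact ((ev b hb).mul_left _).mul_right _
      · exact (ev _ (by simp [Nat.even_add, ha, hb])).mul_left _
  unfold pairFactor exactQuot
  rw [dif_pos key]
  exact key.choose_spec.symm

/-! ### Refined multiplicities and refined invariants -/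

namespace MarkedFloorDiagram

variable {Δ : LatticePolygon} {g : ℕ}

/-- The preimage of `α` under the marking. -/
def pre (D : MarkedFloorDiagram Δ g) (α : Finset ℕ) : Set (D.V ⊕ D.E) := D.m ⁻¹' (α : Set ℕ)

/-- The marking is compatible with the pairing `S`. -/
def Compatible (D : MarkedFloorDiagram Δ g) (S : Finset (Finset ℕ)) : Prop :=
  ∀ α ∈ S,
    (∃ e v, D.Adj e v ∧ D.pre α = {Sum.inr e, Sum.inl v}) ∨
    (∃ e e', e ≠ e' ∧ D.Parallel e e' ∧ D.pre α = {Sum.inr e, Sum.inr e'})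

open Classical in
/-- The edges that belong to no pair. -/
noncomputable def E₀ (D : MarkedFloorDiagram Δ g) (S : Finset (Finset ℕ)) : Finset D.E :=
  {e | ∀ α ∈ S, Sum.inr e ∉ D.pre α}

open Classical in
/-- The edges that are paired with a vertex. -/
noncomputable def E₁ (D : MarkedFloorDiagram Δ g) (S : Finset (Finset ℕ)) : Finset D.E :=
  {e | ∃ v, ∃ α ∈ S, D.pre α = {Sum.inr e, Sum.inl v}}

open Classical in
/-- The pairs of edges that are paired together. -/
noncomputable def E₂ (D : MarkedFloorDiagram Δ g) (S : Finset (Finset ℕ)) : Finset (Sym2 D.E) :=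
  {z | ∃ e e', e ≠ e' ∧ z = s(e, e') ∧ ∃ α ∈ S, D.pre α = {Sum.inr e, Sum.inr e'}}

/-- The function `{e, e'} ↦ [w(e)] [w(e')] [w(e) + w(e')] / [2]`. -/
noncomputable def pairWeight (D : MarkedFloorDiagram Δ g) : Sym2 D.E → ℤ[T;T⁻¹] :=
  Sym2.lift ⟨fun e e' => pairFactor (D.w e) (D.w e'), fun _ _ => pairFactor_comm _ _⟩

open Classical in
/-- The refined `S`-multiplicity of a marked floor diagram. -/
noncomputable def mult (S : Finset (Finset ℕ)) (D : MarkedFloorDiagram Δ g) : ℤ[T;T⁻¹] :=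
  if D.Compatible S then
    (∏ e ∈ D.E₀ S, quantum 1 (D.w e) ^ 2) * (∏ e ∈ D.E₁ S, quantum 2 (D.w e)) *
      ∏ z ∈ D.E₂ S, D.pairWeight z
  else 0

/-- Isomorphisms of marked floor diagrams. -/
structure Iso (D D' : MarkedFloorDiagram Δ g) where
  onV : D.V ≃ D'.V
  onE : D.E ≃ D'.E
  src_eq : ∀ e, D'.src (onE e) = (D.src e).map onV
  tgt_eq : ∀ e, D'.tgt (onE e) = (D.tgt e).map onV
  w_eq : ∀ e, D'.w (onE e) = D.w e
  L_eq : ∀ v, D'.L (onV v) = D.L v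
  R_eq : ∀ v, D'.R (onV v) = D.R v
  m_inl : ∀ v, D'.m (Sum.inl (onV v)) = D.m (Sum.inl v)
  m_inr : ∀ e, D'.m (Sum.inr (onE e)) = D.m (Sum.inr e)

namespace Iso

def refl (D : MarkedFloorDiagram Δ g) : Iso D D where
  onV := Equiv.refl _
  onE := Equiv.refl _
  src_eq := by simp
  tgt_eq := by simp
  w_eq := by simp
  L_eq := by simp
  R_eq := by simp
  m_inl := by simp
  m_inr := by simp

def symm {D D' : MarkedFloorDiagram Δ g} (φ : Iso D D') : Iso D' D where
  onV := φ.onV.symm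
  onE := φ.onE.symm
  src_eq e := by
    obtain ⟨e, rfl⟩ := φ.onE.surjective e
    simp [φ.src_eq, Option.map_map]
  tgt_eq e := by
    obtain ⟨e, rfl⟩ := φ.onE.surjective e
    simp [φ.tgt_eq, Option.map_map]
  w_eq e := by rw [← φ.w_eq, Equiv.apply_symm_apply]
  L_eq v := by rw [← φ.L_eq, Equiv.apply_symm_apply]
  R_eq v := by rw [← φ.R_eq, Equiv.apply_symm_apply]
  m_inl v := by rw [← φ.m_inl, Equiv.apply_symm_apply]
  m_inr e := by rw [← φ.m_inr, Equiv.apply_symm_apply]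

def trans {D D' D'' : MarkedFloorDiagram Δ g} (φ : Iso D D') (ψ : Iso D' D'') : Iso D D'' where
  onV := φ.onV.trans ψ.onV
  onE := φ.onE.trans ψ.onE
  src_eq e := by simp [φ.src_eq, ψ.src_eq, Option.map_map]
  tgt_eq e := by simp [φ.tgt_eq, ψ.tgt_eq, Option.map_map]
  w_eq e := by simp [φ.w_eq, ψ.w_eq]
  L_eq v := by simp [φ.L_eq, ψ.L_eq]
  R_eq v := by simp [φ.R_eq, ψ.R_eq]
  m_inl v := by simp [φ.m_inl, ψ.m_inl]
  m_inr e := by simp [φ.m_inr, ψ.m_inr]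

variable {D D' : MarkedFloorDiagram Δ g}

theorem pre_eq (φ : Iso D D') (α : Finset ℕ) : D.pre α = Sum.map φ.onV φ.onE ⁻¹' D'.pre α := by
  ext x
  rcases x with v | e
  · simp [pre, φ.m_inl]
  · simp [pre, φ.m_inr]

theorem pre_eq_pair (φ : Iso D D') (α : Finset ℕ) (x y : D.V ⊕ D.E) :
    D.pre α = {x, y} ↔ D'.pre α = {Sum.map φ.onV φ.onE x, Sum.map φ.onV φ.onE y} := by
  have hb : Function.Bijective (Sum.map φ.onV φ.onE) :=
    (Equiv.sumCongr φ.onV φ.onE).bijective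
  rw [φ.pre_eq, ← Set.image_pair]
  constructor
  · intro h
    rw [← h, Set.image_preimage_eq _ hb.surjective]
  · intro h
    rw [h, Set.preimage_image_eq _ hb.injective]

theorem adj_iff (φ : Iso D D') (e : D.E) (v : D.V) : D'.Adj (φ.onE e) (φ.onV v) ↔ D.Adj e v := by
  simp [WeightedGraph.Adj, φ.src_eq, φ.tgt_eq]

theorem parallel_iff (φ : Iso D D') (e e' : D.E) : D'.Parallel (φ.onE e) (φ.onE e') ↔ D.Parallel e e' := by
  simp only [WeightedGraph.Parallel, φ.onV.surjective.exists]
  simp [φ.src_eq, φ.tgt_eq]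

theorem compatible_iff (φ : Iso D D') (S : Finset (Finset ℕ)) : D'.Compatible S ↔ D.Compatible S := by
  simp only [Compatible, φ.onV.surjective.exists, φ.onE.surjective.exists, φ.adj_iff,
    φ.parallel_iff, φ.pre_eq_pair, Sum.map_inl, Sum.map_inr, ne_eq,
    EmbeddingLike.apply_eq_iff_eq]

theorem mult_eq (φ : Iso D D') (S : Finset (Finset ℕ)) : D.mult S = D'.mult S := by
  unfold mult
  by_cases h : D.Compatible S
  · rw [if_pos h, if_pos ((φ.compatible_iff S).2 h)]
    congr 1
    · congr 1
      · refine Finset.prod_equiv φ.onE ?_ ?_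
        · intro e
          simp [E₀, φ.pre_eq]
        · intro e _
          rw [φ.w_eq]
      · refine Finset.prod_equiv φ.onE ?_ ?_
        · intro e
          simp [E₁, φ.pre_eq_pair, φ.onV.surjective.exists]
        · intro e _
          rw [φ.w_eq]
    · refine Finset.prod_equiv
        (⟨Sym2.map φ.onE, Sym2.map φ.onE.symm, fun z => by simp [Sym2.map_map],
          fun z => by simp [Sym2.map_map]⟩ : Sym2 D.E ≃ Sym2 D'.E) ?_ ?_
      · intro z
        induction z using Sym2.ind with
        | _ a b =>
        simp only [E₂, Finset.mem_filter, Finset.mem_univ, true_and, φ.onE.surjective.exists,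
          φ.pre_eq_pair, Sum.map_inr, ne_eq, EmbeddingLike.apply_eq_iff_eq]
        simp
      · intro z _
        induction z using Sym2.ind with
        | _ a b =>
        simp [pairWeight, φ.w_eq]
  · rw [if_neg h, if_neg (fun h' => h ((φ.compatible_iff S).1 h'))]

end Iso

/-- Two marked floor diagrams are equivalent if they are isomorphic. -/
instance isoSetoid (Δ : LatticePolygon) (g : ℕ) : Setoid (MarkedFloorDiagram Δ g) where
  r D D' := Nonempty (Iso D D')
  iseqv :=
    { refl := fun D => ⟨Iso.refl D⟩
      symm := fun ⟨φ⟩ => ⟨φ.symm⟩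
      trans := fun ⟨φ⟩ ⟨ψ⟩ => ⟨φ.trans ψ⟩ }

/-- Isomorphism classes of marked floor diagrams with Newton polygon `Δ` and genus `g`. -/
def IsoClass (Δ : LatticePolygon) (g : ℕ) : Type 1 := Quotient (isoSetoid Δ g)

/-- The refined `S`-multiplicity of an isomorphism class. -/
noncomputable def classMult (S : Finset (Finset ℕ)) : IsoClass Δ g → ℤ[T;T⁻¹] :=
  Quotient.lift (mult S) fun _ _ ⟨φ⟩ => φ.mult_eq S

end MarkedFloorDiagram

/-- `G_g(Δ, S)`: the sum of the refined `S`-multiplicities over the isomorphism classes of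
marked floor diagrams with Newton polygon `Δ` and genus `g` (there are finitely many). -/
noncomputable def refinedInvariant (Δ : LatticePolygon) (g : ℕ) (S : Finset (Finset ℕ)) :
    ℤ[T;T⁻¹] :=
  ∑ᶠ c : MarkedFloorDiagram.IsoClass Δ g, MarkedFloorDiagram.classMult S c

/-- The codegree `i` coefficient of `G_g(Δ, S)`, i.e. its coefficient of
`q^{g_max(Δ) - g - i} = T^{2 (g_max(Δ) - g - i)}`. -/
noncomputable def codegreeCoeff (Δ : LatticePolygon) (g : ℕ) (S : Finset (Finset ℕ)) (i : ℕ) : ℤ :=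
  (refinedInvariant Δ g S).coeff (2 * ((Δ.gMax : ℤ) - g - i))

/-! Two facts give the inequality: the sum of the multiplicities depends only on the order of the
pairing, and adding a pair can only lower its coefficients. By the first, both pairings may be
replaced by initial ones {1, 2}, {3, 4}, …, and these are nested.

The second fact holds diagram by diagram (`coeffNonneg_mult_sub_mult_insert`). A new pair replaces a
local factor [a]² by [a](q²), or [a]² [b]² by [a] [b] [a + b] / [2], or makes the multiplicity
vanish. The other factors have nonnegative coefficients, and so do the differences [a]² − [a](q²)
and [a]² [b]² − [a] [b] [a + b] / [2].

For the first fact, it is enough to move one pair from {j + 1, j + 2} to {j, j + 1} when j is free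
(`sum_mult_insert_eq`). The multiplicity factors into a part that ignores the marks j, j + 1, j + 2
and a local part. If the unpaired one of the three elements is incident to neither of the others, it
can be marked on the other side of the pair without any change. In the blocked configurations three
things happen. An edge between two consecutive vertices gives the same term on both sides. Two edges
entering (or leaving) the same vertex balance after symmetrization, by `two_mul_pairFactor_eq`. A
chain edge, vertex, edge gives different terms on the two sides; the difference is made up by
diagrams in which the lighter edge is reglued past the vertex, so that two edges leave or enter a
common vertex (`quantum_exchange`, `lowerSum_add_forkSum`).

All sums are taken over diagrams on fixed sets of vertices and edges. A marked diagram has no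
nontrivial automorphism, so each isomorphism class is counted |V|! |E|! times (`sum_mult_eq`), and
bijections between diagrams can be written edge by edge. Finally, `y_le` ensures that the marks up
to 2 s_max all exist. -/

/-! ### Laurent polynomials with nonnegative coefficients -/

/-- All coefficients are nonnegative. -/
def CoeffNonneg (f : ℤ[T;T⁻¹]) : Prop := ∀ n, 0 ≤ f.coeff n

namespace CoeffNonneg

variable {f h : ℤ[T;T⁻¹]}

theorem zero : CoeffNonneg 0 := fun n => by simp

theorem single (n r : ℤ) (hr : 0 ≤ r) : CoeffNonneg (AddMonoidAlgebra.single n r) := by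
  intro k
  rw [AddMonoidAlgebra.coeff_single, Finsupp.single_apply]
  split_ifs <;> simp [hr]

theorem T (n : ℤ) : CoeffNonneg (LaurentPolynomial.T n) := single n 1 zero_le_one

theorem one : CoeffNonneg 1 := single 0 1 zero_le_one

theorem add (hf : CoeffNonneg f) (hh : CoeffNonneg h) : CoeffNonneg (f + h) := fun n => by
  rw [AddMonoidAlgebra.coeff_add, Finsupp.add_apply]
  exact add_nonneg (hf n) (hh n)

theorem sum {ι : Type*} {s : Finset ι} {F : ι → ℤ[T;T⁻¹]} (hF : ∀ i ∈ s, CoeffNonneg (F i)) :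
    CoeffNonneg (∑ i ∈ s, F i) :=
  Finset.sum_induction F CoeffNonneg (fun _ _ => add) zero hF

theorem mul (hf : CoeffNonneg f) (hh : CoeffNonneg h) : CoeffNonneg (f * h) := by
  rw [AddMonoidAlgebra.mul_def]
  exact sum fun i _ => sum fun j _ => single _ _ (mul_nonneg (hf i) (hh j))

theorem prod {ι : Type*} {s : Finset ι} {F : ι → ℤ[T;T⁻¹]} (hF : ∀ i ∈ s, CoeffNonneg (F i)) :
    CoeffNonneg (∏ i ∈ s, F i) :=
  Finset.prod_induction F CoeffNonneg (fun _ _ => mul) one hF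

theorem coeff_le (hf : CoeffNonneg (f - h)) (n : ℤ) : h.coeff n ≤ f.coeff n := by
  have e : f = (f - h) + h := by ring
  rw [e, AddMonoidAlgebra.coeff_add, Finsupp.add_apply]
  have := hf n
  omega

end CoeffNonneg

/-! ### Identities and inequalities between quantum integers. -/

theorem CoeffNonneg.quantum (j n : ℕ) : CoeffNonneg (quantum j n) := sum fun _ _ => T _

theorem quantum_mul_T_sub_T (n : ℕ) :
    quantum 1 n * (LaurentPolynomial.T 1 - LaurentPolynomial.T (-1)) =
      LaurentPolynomial.T (n : ℤ) - LaurentPolynomial.T (-(n : ℤ)) := by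
  simpa using quantum_mul 1 n

theorem quantum_one_two :
    quantum 1 2 = LaurentPolynomial.T 1 + LaurentPolynomial.T (-1) := by
  simp [quantum, Finset.sum_range_succ]

theorem T_mul_T_neg (n : ℤ) :
    (LaurentPolynomial.T n * LaurentPolynomial.T (-n) : ℤ[T;T⁻¹]) = 1 := by
  rw [← LaurentPolynomial.T_add]
  simp

theorem coeff_T (n : ℤ) :
    (LaurentPolynomial.T n : ℤ[T;T⁻¹]).coeff = Finsupp.single n 1 := rfl

theorem T_one_sub_T_neg_one_ne_zero :
    (LaurentPolynomial.T 1 - LaurentPolynomial.T (-1) : ℤ[T;T⁻¹]) ≠ 0 := by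
  intro h
  have := congrArg (fun f => f.coeff 1) h
  simp [coeff_T] at this

theorem quantum_one_two_ne_zero : quantum 1 2 ≠ 0 := by
  intro h
  have := congrArg (fun f => f.coeff 1) h
  rw [quantum_one_two] at this
  simp [coeff_T] at this

/-- In the expansion of [n]² over pairs of indices, the diagonal is exactly [n](q²); the
off-diagonal monomials remain. -/
theorem coeffNonneg_quantum_sq_sub (n : ℕ) : CoeffNonneg (quantum 1 n ^ 2 - quantum 2 n) := by
  classical
  have h : quantum 1 n ^ 2 - quantum 2 n =
      ∑ k ∈ Finset.range n, ∑ l ∈ (Finset.range n).erase k,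
        LaurentPolynomial.T (((n : ℤ) - 1 - 2 * k) + ((n : ℤ) - 1 - 2 * l)) := by
    rw [sq, sub_eq_iff_eq_add]
    unfold quantum
    rw [Finset.sum_mul_sum, ← Finset.sum_add_distrib]
    refine Finset.sum_congr rfl fun k hk => ?_
    rw [← Finset.sum_erase_add _ _ hk]
    congr 1
    · refine Finset.sum_congr rfl fun l _ => ?_
      rw [← LaurentPolynomial.T_add]
      simp
    · rw [← LaurentPolynomial.T_add]
      congr 1
      push_cast
      ring
  rw [h]
  exact .sum fun _ _ => .sum fun _ _ => .T _

/-- If one of the factors of `[a] [b] [c]` has an even argument, the quotient by `[2]` has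
nonnegative coefficients. -/
theorem exists_two_mul_eq_quantum (a b c : ℕ) (h : Even (a + b + c)) :
    ∃ K, CoeffNonneg K ∧ quantum 1 2 * K = quantum 1 a * quantum 1 b * quantum 1 c := by
  have ev : ∀ n, Even n → ∃ K, CoeffNonneg K ∧ quantum 1 2 * K = quantum 1 n := by
    rintro n ⟨k, rfl⟩
    exact ⟨quantum 2 k, .quantum _ _, by rw [← two_mul, quantum_two_mul]⟩
  have q := CoeffNonneg.quantum 1
  by_cases ha : Even a
  · obtain ⟨K, hK, e⟩ := ev a ha
    exact ⟨K * quantum 1 b * quantum 1 c, (hK.mul (q b)).mul (q c), by rw [← e]; ring⟩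
  by_cases hb : Even b
  · obtain ⟨K, hK, e⟩ := ev b hb
    exact ⟨quantum 1 a * K * quantum 1 c, ((q a).mul hK).mul (q c), by rw [← e]; ring⟩
  · obtain ⟨K, hK, e⟩ := ev c (by simpa [Nat.even_add, ha, hb] using h)
    exact ⟨quantum 1 a * quantum 1 b * K, ((q a).mul (q b)).mul hK, by rw [← e]; ring⟩

theorem coeffNonneg_pairFactor (a b : ℕ) : CoeffNonneg (pairFactor a b) := by
  obtain ⟨K, hK, e⟩ := exists_two_mul_eq_quantum a b (a + b) ⟨a + b, rfl⟩
  rw [← two_mul_pairFactor] at e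
  rwa [← mul_left_cancel₀ quantum_one_two_ne_zero e]

/-- After multiplication by (T − T⁻¹)² the quantum integers become differences of monomials, and
only T · T⁻¹ = 1 is needed. The identity serves to write the difference in
`coeffNonneg_sq_mul_sq_sub` without signs. -/
theorem quantum_two_mul_mul (a b : ℕ) :
    quantum 1 2 * (quantum 1 (a + 1) * quantum 1 (b + 1)) =
      quantum 1 2 * (quantum 1 a * quantum 1 b) + quantum 1 (a + 1 + (b + 1)) +
        quantum 1 (a + b) := by
  have h1 := quantum_mul_T_sub_T a
  have h2 := quantum_mul_T_sub_T b
  have h3 := quantum_mul_T_sub_T (a + 1)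
  have h4 := quantum_mul_T_sub_T (b + 1)
  have h5 := quantum_mul_T_sub_T (a + 1 + (b + 1))
  have h6 := quantum_mul_T_sub_T (a + b)
  push_cast at h3 h4 h5 h6
  rw [neg_add] at h3 h4 h6
  rw [neg_add, neg_add, neg_add] at h5
  simp only [LaurentPolynomial.T_add] at h3 h4 h5 h6
  have k := T_mul_T_neg 1
  rw [quantum_one_two]
  refine mul_right_cancel₀ (pow_ne_zero 2 T_one_sub_T_neg_one_ne_zero) ?_
  generalize quantum 1 (a + 1) = qa' at *
  generalize quantum 1 (b + 1) = qb' at *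
  generalize quantum 1 a = qa at *
  generalize quantum 1 b = qb at *
  generalize quantum 1 (a + 1 + (b + 1)) = qs at *
  generalize quantum 1 (a + b) = qt at *
  generalize (LaurentPolynomial.T (a : ℤ) : ℤ[T;T⁻¹]) = A at *
  generalize (LaurentPolynomial.T (-(a : ℤ)) : ℤ[T;T⁻¹]) = A' at *
  generalize (LaurentPolynomial.T (b : ℤ) : ℤ[T;T⁻¹]) = B at *
  generalize (LaurentPolynomial.T (-(b : ℤ)) : ℤ[T;T⁻¹]) = B' at *
  generalize (LaurentPolynomial.T 1 : ℤ[T;T⁻¹]) = t at *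
  generalize (LaurentPolynomial.T (-1) : ℤ[T;T⁻¹]) = t' at *
  have e1 : (t + t') * (qa' * qb') * (t - t') ^ 2 = (t + t') * ((A * t - A' * t') * (B * t - B' * t')) := by
    rw [← h3, ← h4]; ring
  have e2 : ((t + t') * (qa * qb) + qs + qt) * (t - t') ^ 2 = (t + t') * ((A - A') * (B - B')) +
      (A * t * (B * t) - A' * t' * (B' * t') + (A * B - A' * B')) * (t - t') := by
    rw [← h1, ← h2, ← h5, ← h6]; ring
  rw [e1, e2]
  linear_combination (-A' * t' * B - A * t * B' - A' * B * t - A * B' * t' + 2 * A * B * t + 2 * A' * B' * t') * k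

/-- For arguments a + 1 and b + 1 the difference equals [a + 1] [b + 1] [a] [b] + [a + 1] [b + 1] [a
+ b] / [2], and the last quotient is nonnegative because the three arguments have an even sum. -/
theorem coeffNonneg_sq_mul_sq_sub (a b : ℕ) (ha : 0 < a) (hb : 0 < b) :
    CoeffNonneg (quantum 1 a ^ 2 * quantum 1 b ^ 2 - pairFactor a b) := by
  obtain ⟨a, rfl⟩ := Nat.exists_eq_add_of_lt ha
  obtain ⟨b, rfl⟩ := Nat.exists_eq_add_of_lt hb
  simp only [zero_add]
  obtain ⟨K, hK, e⟩ := exists_two_mul_eq_quantum (a + 1) (b + 1) (a + b)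
    ⟨a + b + 1, by ring⟩
  have q := CoeffNonneg.quantum 1
  have : quantum 1 (a + 1) ^ 2 * quantum 1 (b + 1) ^ 2 - pairFactor (a + 1) (b + 1) =
      quantum 1 (a + 1) * quantum 1 (b + 1) * (quantum 1 a * quantum 1 b) + K := by
    refine mul_left_cancel₀ quantum_one_two_ne_zero ?_
    rw [mul_sub, two_mul_pairFactor, mul_add, e]
    linear_combination (quantum 1 (a + 1) * quantum 1 (b + 1)) * quantum_two_mul_mul a b
  rw [this]
  exact (((q _).mul (q _)).mul ((q _).mul (q _))).add hK

theorem quantum_one_two_mul_T_sub_T (n : ℕ) :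
    quantum 1 2 * quantum 2 n * (LaurentPolynomial.T 1 - LaurentPolynomial.T (-1)) =
      LaurentPolynomial.T (n : ℤ) ^ 2 - LaurentPolynomial.T (-(n : ℤ)) ^ 2 := by
  rw [← quantum_two_mul, quantum_mul_T_sub_T]
  simp only [LaurentPolynomial.T_pow]
  push_cast
  simp

/-- Two edges at the same vertex, paired together, count as the average of the two ways to pair one
of them with the vertex. -/
theorem two_mul_pairFactor_eq (a b : ℕ) :
    2 * pairFactor a b =
      quantum 1 a ^ 2 * quantum 2 b + quantum 1 b ^ 2 * quantum 2 a := by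
  have h1 := quantum_mul_T_sub_T a
  have h2 := quantum_mul_T_sub_T b
  have h3 := quantum_one_two_mul_T_sub_T a
  have h4 := quantum_one_two_mul_T_sub_T b
  have h5 := quantum_mul_T_sub_T (a + b)
  have h6 := two_mul_pairFactor a b
  push_cast at h5
  rw [neg_add] at h5
  simp only [LaurentPolynomial.T_add] at h5
  refine mul_left_cancel₀ quantum_one_two_ne_zero
    (mul_right_cancel₀ (pow_ne_zero 3 T_one_sub_T_neg_one_ne_zero) ?_)
  generalize quantum 1 2 = q2 at *
  generalize quantum 1 a = qa at *
  generalize quantum 1 b = qb at *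
  generalize quantum 1 (a + b) = qs at *
  generalize quantum 2 a = pa at *
  generalize quantum 2 b = pb at *
  generalize (LaurentPolynomial.T (a : ℤ) : ℤ[T;T⁻¹]) = A at *
  generalize (LaurentPolynomial.T (-(a : ℤ)) : ℤ[T;T⁻¹]) = A' at *
  generalize (LaurentPolynomial.T (b : ℤ) : ℤ[T;T⁻¹]) = B at *
  generalize (LaurentPolynomial.T (-(b : ℤ)) : ℤ[T;T⁻¹]) = B' at *
  generalize (LaurentPolynomial.T 1 - LaurentPolynomial.T (-1) : ℤ[T;T⁻¹]) = d at *
  have e1 : q2 * (2 * pairFactor a b) * d ^ 3 = 2 * ((A - A') * (B - B') * (A * B - A' * B')) := by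
    rw [← h1, ← h2, ← h5]; linear_combination 2 * d ^ 3 * h6
  have e2 : q2 * (qa ^ 2 * pb + qb ^ 2 * pa) * d ^ 3 =
      (A - A') ^ 2 * (B ^ 2 - B' ^ 2) + (B - B') ^ 2 * (A ^ 2 - A' ^ 2) := by
    rw [← h1, ← h2, ← h3, ← h4]; ring
  rw [e1, e2]
  ring

/-- The balance for a vertex between edges of weights b + c and b, when its partner changes. The
correction is twice the factor of two paired edges of weights c and b, which are the weights after
regluing. -/
theorem quantum_exchange (b c : ℕ) :
    quantum 2 (b + c) * quantum 1 b ^ 2 + 2 * pairFactor c b =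
      quantum 1 (b + c) ^ 2 * quantum 2 b := by
  have h2 := quantum_mul_T_sub_T b
  have h1 := quantum_mul_T_sub_T c
  have h3 := quantum_one_two_mul_T_sub_T (b + c)
  have h4 := quantum_one_two_mul_T_sub_T b
  have h5 := quantum_mul_T_sub_T (b + c)
  have h6 := two_mul_pairFactor c b
  rw [add_comm c b] at h6
  push_cast at h5 h3
  rw [neg_add] at h5 h3
  simp only [LaurentPolynomial.T_add] at h5 h3
  have k1 := T_mul_T_neg b
  refine mul_left_cancel₀ quantum_one_two_ne_zero
    (mul_right_cancel₀ (pow_ne_zero 3 T_one_sub_T_neg_one_ne_zero) ?_)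
  generalize quantum 1 2 = q2 at *
  generalize quantum 1 c = qc at *
  generalize quantum 1 (b + c) = qs at *
  generalize quantum 1 b = qb at *
  generalize quantum 2 (b + c) = ps at *
  generalize quantum 2 b = pb at *
  generalize (LaurentPolynomial.T (c : ℤ) : ℤ[T;T⁻¹]) = C at *
  generalize (LaurentPolynomial.T (-(c : ℤ)) : ℤ[T;T⁻¹]) = C' at *
  generalize (LaurentPolynomial.T (b : ℤ) : ℤ[T;T⁻¹]) = B at *
  generalize (LaurentPolynomial.T (-(b : ℤ)) : ℤ[T;T⁻¹]) = B' at *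
  generalize (LaurentPolynomial.T 1 - LaurentPolynomial.T (-1) : ℤ[T;T⁻¹]) = d at *
  have e1 : q2 * (ps * qb ^ 2 + 2 * pairFactor c b) * d ^ 3 =
      ((B * C) ^ 2 - (B' * C') ^ 2) * (B - B') ^ 2 +
        2 * ((C - C') * (B - B') * (B * C - B' * C')) := by
    rw [← h1, ← h2, ← h5, ← h3]
    linear_combination 2 * d ^ 3 * h6
  have e2 : q2 * (qs ^ 2 * pb) * d ^ 3 = (B * C - B' * C') ^ 2 * (B ^ 2 - B' ^ 2) := by
    rw [← h5, ← h4]; ring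
  rw [e1, e2]
  linear_combination (B - B') * (B * C - B' * C') * (2 * (C' - C)) * k1

/-! ### Lattice points on the boundary of a polygon -/

namespace LatticePolygon

variable (Δ : LatticePolygon)

theorem convex : Convex ℝ Δ.carrier := by
  obtain ⟨s, hs⟩ := Δ.exists_vertices
  rw [hs]
  exact convex_convexHull _ _

theorem isCompact : IsCompact Δ.carrier := by
  obtain ⟨s, hs⟩ := Δ.exists_vertices
  rw [hs]
  exact Set.Finite.isCompact_convexHull ℝ (s.finite_toSet.image _)

theorem nonempty : Δ.carrier.Nonempty := Δ.interior_nonempty.mono interior_subset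

theorem finite_lattice_points : {p : ℤ × ℤ | latticeToPlane p ∈ Δ.carrier}.Finite := by
  obtain ⟨r, hr⟩ := Δ.isCompact.isBounded.subset_closedBall 0
  obtain ⟨N, hN⟩ := exists_nat_ge r
  refine (Set.finite_Icc ((-N, -N) : ℤ × ℤ) (N, N)).subset ?_
  rintro ⟨a, b⟩ hp
  have := hr hp
  rw [mem_closedBall_zero_iff, Prod.norm_def, latticeToPlane, max_le_iff] at this
  simp only [Real.norm_eq_abs, abs_le] at this
  obtain ⟨⟨h1, h2⟩, h3, h4⟩ := this
  have k1 : ((-N : ℤ) : ℝ) ≤ a := by push_cast; linarith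
  have k2 : (a : ℝ) ≤ (N : ℤ) := by push_cast; linarith
  have k3 : ((-N : ℤ) : ℝ) ≤ b := by push_cast; linarith
  have k4 : (b : ℝ) ≤ (N : ℤ) := by push_cast; linarith
  simp only [Set.mem_Icc, Prod.mk_le_mk]
  exact ⟨⟨by exact_mod_cast k1, by exact_mod_cast k3⟩, by exact_mod_cast k2, by exact_mod_cast k4⟩

/-- A boundary point has a supporting line. -/
theorem exists_supporting_form {p : ℝ × ℝ} (hp : p ∈ frontier Δ.carrier) :
    ∃ a b : ℝ, (a ≠ 0 ∨ b ≠ 0) ∧ ∀ q ∈ Δ.carrier, a * q.1 + b * q.2 ≤ a * p.1 + b * p.2 := by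
  have hpi : p ∉ interior Δ.carrier := hp.2
  obtain ⟨f, hf⟩ := geometric_hahn_banach_open_point Δ.convex.interior isOpen_interior hpi
  have hfe : ∀ q : ℝ × ℝ, f q = f (1, 0) * q.1 + f (0, 1) * q.2 := by
    intro q
    have : q = q.1 • ((1, 0) : ℝ × ℝ) + q.2 • ((0, 1) : ℝ × ℝ) := by ext <;> simp
    conv_lhs => rw [this, map_add, map_smul, map_smul]
    simp [mul_comm]
  refine ⟨f (1, 0), f (0, 1), ?_, ?_⟩
  · by_contra! h
    obtain ⟨c, hc⟩ := Δ.interior_nonempty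
    have := hf c hc
    rw [hfe c, hfe p, h.1, h.2] at this
    simp at this
  · intro q hq
    rw [← hfe, ← hfe]
    -- Separation controls f on the interior only; a convex set with nonempty interior lies in the
    -- closure of its interior.
    have hcl : q ∈ closure (interior Δ.carrier) := by
      rw [Δ.convex.closure_interior_eq_closure_of_nonempty_interior Δ.interior_nonempty]
      exact subset_closure hq
    exact closure_minimal (s := interior Δ.carrier) (t := {q | f q ≤ f p}) (fun c hc => (hf c hc).le)
      (isClosed_le f.continuous continuous_const) hcl

theorem exists_vertex_snd_max : ∃ t : ℤ × ℤ, latticeToPlane t ∈ Δ.carrier ∧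
    ∀ q ∈ Δ.carrier, q.2 ≤ t.2 := by
  obtain ⟨s, hs⟩ := Δ.exists_vertices
  have hne : s.Nonempty := by
    rw [Finset.nonempty_iff_ne_empty]
    rintro rfl
    have := Δ.nonempty
    simp [hs] at this
  obtain ⟨t, ht, hmax⟩ := s.exists_max_image Prod.snd hne
  refine ⟨t, ?_, ?_⟩
  · rw [hs]
    exact subset_convexHull ℝ _ ⟨t, ht, rfl⟩
  · have : Δ.carrier ⊆ {q : ℝ × ℝ | q.2 ≤ t.2} := by
      rw [hs]
      refine convexHull_min ?_ (convex_halfSpace_le ⟨fun _ _ => rfl, fun _ _ => rfl⟩ _)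
      rintro _ ⟨q, hq, rfl⟩
      have := hmax q hq
      simp only [latticeToPlane, Set.mem_ofPred_eq]
      exact_mod_cast this
    exact this

theorem exists_vertex_snd_min : ∃ t : ℤ × ℤ, latticeToPlane t ∈ Δ.carrier ∧
    ∀ q ∈ Δ.carrier, (t.2 : ℝ) ≤ q.2 := by
  obtain ⟨s, hs⟩ := Δ.exists_vertices
  have hne : s.Nonempty := by
    rw [Finset.nonempty_iff_ne_empty]
    rintro rfl
    have := Δ.nonempty
    simp [hs] at this
  obtain ⟨t, ht, hmin⟩ := s.exists_min_image Prod.snd hne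
  refine ⟨t, ?_, ?_⟩
  · rw [hs]
    exact subset_convexHull ℝ _ ⟨t, ht, rfl⟩
  · have : Δ.carrier ⊆ {q : ℝ × ℝ | (t.2 : ℝ) ≤ q.2} := by
      rw [hs]
      refine convexHull_min ?_ (convex_halfSpace_ge ⟨fun _ _ => rfl, fun _ _ => rfl⟩ _)
      rintro _ ⟨q, hq, rfl⟩
      have := hmin q hq
      simp only [latticeToPlane, Set.mem_ofPred_eq]
      exact_mod_cast this
    exact this

/-- The number of boundary lattice points is at most `2 a(Δ) + e^{+∞}(Δ) + e^{-∞}(Δ)`: a row strictly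
between the bottom and the top one meets the boundary in at most two points. -/
theorem y_le (a : ℕ) (ha : (a : ℝ) = Δ.height) : Δ.y ≤ 2 * a + Δ.ePlus + Δ.eMinus := by
  classical
  obtain ⟨t, ht, htmax⟩ := Δ.exists_vertex_snd_max
  obtain ⟨b, hb, hbmin⟩ := Δ.exists_vertex_snd_min
  have hsup : sSup (Prod.snd '' Δ.carrier) = t.2 := by
    refine IsGreatest.csSup_eq ⟨⟨_, ht, rfl⟩, ?_⟩
    rintro _ ⟨q, hq, rfl⟩
    exact htmax q hq
  have hinf : sInf (Prod.snd '' Δ.carrier) = b.2 := by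
    refine IsLeast.csInf_eq ⟨⟨_, hb, rfl⟩, ?_⟩
    rintro _ ⟨q, hq, rfl⟩
    exact hbmin q hq
  have hab : (a : ℤ) = t.2 - b.2 := by
    rw [height, hsup, hinf] at ha
    exact_mod_cast ha
  -- Otherwise the polygon lies on a horizontal line and has empty interior.
  have hpos : b.2 < t.2 := by
    obtain ⟨c, hc⟩ := Δ.interior_nonempty
    have hle : (b.2 : ℝ) ≤ t.2 := htmax _ hb
    have hle' : b.2 ≤ t.2 := by exact_mod_cast hle
    refine lt_of_le_of_ne hle' fun h => ?_
    have hsub : Δ.carrier ⊆ {q : ℝ × ℝ | q.2 = t.2} := fun q hq =>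
      le_antisymm (htmax q hq) (h ▸ hbmin q hq)
    have hsub' : Δ.carrier ⊆ Set.univ ×ˢ {(t.2 : ℝ)} := fun q hq =>
      Set.mem_prod.2 ⟨Set.mem_univ _, hsub hq⟩
    have := interior_mono hsub' hc
    rw [interior_prod_eq] at this
    simp at this
  have hfin := Δ.finite_lattice_points
  have hclosed := Δ.isCompact.isClosed
  have htop : {p : ℤ × ℤ | latticeToPlane p ∈ Δ.face (0, 1)}.ncard = Δ.ePlus + 1 := by
    have : {p : ℤ × ℤ | latticeToPlane p ∈ Δ.face (0, 1)}.ncard ≠ 0 := by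
      refine ((Set.ncard_pos (hfin.subset fun p hp => hp.1)).2 ?_).ne'
      exact ⟨t, ht, fun q hq => by simpa [latticeToPlane] using htmax q hq⟩
    rw [ePlus, sideLength]
    omega
  have hbot : {p : ℤ × ℤ | latticeToPlane p ∈ Δ.face (0, -1)}.ncard = Δ.eMinus + 1 := by
    have : {p : ℤ × ℤ | latticeToPlane p ∈ Δ.face (0, -1)}.ncard ≠ 0 := by
      refine ((Set.ncard_pos (hfin.subset fun p hp => hp.1)).2 ?_).ne'
      exact ⟨b, hb, fun q hq => by simpa [latticeToPlane] using hbmin q hq⟩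
    rw [eMinus, sideLength]
    omega
  set row : ℤ → Set (ℤ × ℤ) := fun k =>
    {p | latticeToPlane p ∈ frontier Δ.carrier ∧ p.2 = k} with hrow
  have hfr : ∀ p : ℤ × ℤ, latticeToPlane p ∈ frontier Δ.carrier → latticeToPlane p ∈ Δ.carrier :=
    fun p hp => hclosed.frontier_subset hp
  have hrowfin : ∀ k, (row k).Finite := fun k => hfin.subset fun p hp => hfr p hp.1
  have hrow2 : ∀ k, b.2 < k → k < t.2 → (row k).ncard ≤ 2 := by
    intro k h1 h2
    by_contra! h3
    have h1' : (b.2 : ℝ) < k := by exact_mod_cast h1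
    have h2' : (k : ℝ) < t.2 := by exact_mod_cast h2
    obtain ⟨p, hp, q, hq, r, hr, hpq, hpr, hqr⟩ := (Set.two_lt_ncard (hrowfin k)).1 h3
    -- At the middle one of three boundary points in a row, the supporting form cannot increase in
    -- either direction along the row, so it is purely vertical. It is then maximal on the top or
    -- the bottom row only.
    have mid : ∀ p q r : ℤ × ℤ, p ∈ row k → q ∈ row k → r ∈ row k → p.1 < q.1 → ¬ q.1 < r.1 := by
      intro p q r hp hq hr hpq hqr
      obtain ⟨u, v, huv, hmax⟩ := Δ.exists_supporting_form hq.1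
      have e1 := hmax _ (hfr p hp.1)
      have e2 := hmax _ (hfr r hr.1)
      have e3 := hmax _ ht
      have e4 := hmax _ hb
      have hpq' : (p.1 : ℝ) < q.1 := by exact_mod_cast hpq
      have hqr' : (q.1 : ℝ) < r.1 := by exact_mod_cast hqr
      simp only [latticeToPlane, hp.2, hq.2, hr.2] at e1 e2 e3 e4
      have hu : u = 0 := by
        rcases lt_trichotomy u 0 with h | h | h
        · nlinarith
        · exact h
        · nlinarith
      subst hu
      have hv : v ≠ 0 := by simpa using huv
      rcases lt_or_gt_of_ne hv with h | h <;> nlinarith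
    have ne : ∀ p q : ℤ × ℤ, p ∈ row k → q ∈ row k → p ≠ q → p.1 ≠ q.1 := fun p q hp hq h h' =>
      h (Prod.ext h' (hp.2.trans hq.2.symm))
    have a1 := ne p q hp hq hpq
    have a2 := ne p r hp hr hpr
    have a3 := ne q r hq hr hqr
    have b1 := mid p q r hp hq hr
    have b2 := mid p r q hp hr hq
    have b3 := mid q p r hq hp hr
    have b4 := mid q r p hq hr hp
    have b5 := mid r p q hr hp hq
    have b6 := mid r q p hr hq hp
    omega
  have hcover : {p : ℤ × ℤ | latticeToPlane p ∈ frontier Δ.carrier} ⊆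
      {p : ℤ × ℤ | latticeToPlane p ∈ Δ.face (0, 1)} ∪
        {p : ℤ × ℤ | latticeToPlane p ∈ Δ.face (0, -1)} ∪
          ⋃ k ∈ Finset.Ioo b.2 t.2, row k := by
    intro p hp
    have hpc := hfr p hp
    have h1 : b.2 ≤ p.2 := by
      have := hbmin _ hpc
      simpa [latticeToPlane] using this
    have h2 : p.2 ≤ t.2 := by
      have := htmax _ hpc
      simpa [latticeToPlane] using this
    rcases h1.eq_or_lt with h | h
    · refine Or.inl (Or.inr ⟨hpc, fun q hq => ?_⟩)
      have := hbmin q hq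
      rw [h] at this
      simpa [latticeToPlane] using this
    rcases h2.eq_or_lt with h' | h'
    · refine Or.inl (Or.inl ⟨hpc, fun q hq => ?_⟩)
      have := htmax q hq
      rw [← h'] at this
      simpa [latticeToPlane] using this
    · refine Or.inr (Set.mem_biUnion (x := p.2) ?_ ⟨hp, rfl⟩)
      simp [h, h']
  have hmidfin : (⋃ k ∈ Finset.Ioo b.2 t.2, row k).Finite :=
    (Finset.finite_toSet _).biUnion fun k _ => hrowfin k
  -- There are a − 1 intermediate rows; the extreme faces contribute `ePlus + 1` and `eMinus + 1`
  -- points, which restores the missing 2.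
  have hmid : (⋃ k ∈ Finset.Ioo b.2 t.2, row k).ncard ≤ 2 * (a - 1) := by
    calc _ ≤ ∑ k ∈ Finset.Ioo b.2 t.2, (row k).ncard := Finset.set_ncard_biUnion_le _ _
      _ ≤ ∑ k ∈ Finset.Ioo b.2 t.2, 2 := Finset.sum_le_sum fun k hk =>
          hrow2 k (Finset.mem_Ioo.1 hk).1 (Finset.mem_Ioo.1 hk).2
      _ = 2 * (a - 1) := by
          simp only [Finset.sum_const, Int.card_Ioo, smul_eq_mul]
          omega
  have hf1 : {p : ℤ × ℤ | latticeToPlane p ∈ Δ.face (0, 1)}.Finite := hfin.subset fun p hp => hp.1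
  have hf2 : {p : ℤ × ℤ | latticeToPlane p ∈ Δ.face (0, -1)}.Finite := hfin.subset fun p hp => hp.1
  have h1 := Set.ncard_le_ncard hcover ((hf1.union hf2).union hmidfin)
  have h2 := Set.ncard_union_le ({p : ℤ × ℤ | latticeToPlane p ∈ Δ.face (0, 1)} ∪
        {p : ℤ × ℤ | latticeToPlane p ∈ Δ.face (0, -1)}) (⋃ k ∈ Finset.Ioo b.2 t.2, row k)
  have h3 := Set.ncard_union_le {p : ℤ × ℤ | latticeToPlane p ∈ Δ.face (0, 1)}
        {p : ℤ × ℤ | latticeToPlane p ∈ Δ.face (0, -1)}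
  rw [y]
  omega

end LatticePolygon

/-! ### Factorization of the multiplicity -/

theorem WeightedGraph.parallel_comm (Γ : WeightedGraph) (e e' : Γ.E) :
    Γ.Parallel e e' ↔ Γ.Parallel e' e :=
  exists_congr fun _ => or_congr and_comm and_comm

namespace MarkedFloorDiagram

variable {Δ : LatticePolygon} {g : ℕ} (D : MarkedFloorDiagram Δ g)

theorem m_injective : Function.Injective D.m := Set.injOn_univ.1 D.m_bijOn.injOn

theorem exists_m_eq {k : ℕ} (h1 : 1 ≤ k) (h2 : k ≤ D.numElt) : ∃ x, D.m x = k := by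
  obtain ⟨x, -, hx⟩ := D.m_bijOn.surjOn ⟨h1, h2⟩
  exact ⟨x, hx⟩

/-- The contribution of an unpaired element. -/
noncomputable def soloFactor : D.V ⊕ D.E → ℤ[T;T⁻¹]
  | Sum.inl _ => 1
  | Sum.inr e => quantum 1 (D.w e) ^ 2

open Classical in
/-- The contribution of two elements that are paired together. -/
noncomputable def duoFactor : D.V ⊕ D.E → D.V ⊕ D.E → ℤ[T;T⁻¹]
  | Sum.inl _, Sum.inl _ => 0
  | Sum.inr e, Sum.inl v => if D.Adj e v then quantum 2 (D.w e) else 0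
  | Sum.inl v, Sum.inr e => if D.Adj e v then quantum 2 (D.w e) else 0
  | Sum.inr e, Sum.inr e' => if D.Parallel e e' then pairFactor (D.w e) (D.w e') else 0

open Classical in
/-- The product defining the multiplicity for the pairing `T`, without the unpaired edges
whose mark lies in `W`. -/
noncomputable def multAway (T : Finset (Finset ℕ)) (W : Finset ℕ) : ℤ[T;T⁻¹] :=
  if D.Compatible T then
    (∏ e ∈ D.E₀ T with D.m (Sum.inr e) ∉ W, quantum 1 (D.w e) ^ 2) *
      (∏ e ∈ D.E₁ T, quantum 2 (D.w e)) * ∏ z ∈ D.E₂ T, D.pairWeight z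
  else 0

theorem multAway_empty (T : Finset (Finset ℕ)) : D.multAway T ∅ = D.mult T := by
  simp [multAway, mult]

theorem coeffNonneg_multAway (T : Finset (Finset ℕ)) (W : Finset ℕ) :
    CoeffNonneg (D.multAway T W) := by
  unfold multAway
  split_ifs
  · refine (CoeffNonneg.mul (.prod fun e _ => ?_) (.prod fun e _ => .quantum _ _)).mul
      (.prod fun z _ => ?_)
    · rw [sq]
      exact (CoeffNonneg.quantum _ _).mul (.quantum _ _)
    · induction z using Sym2.ind with
      | _ a b => exact coeffNonneg_pairFactor _ _
  · exact .zero

/-- `W` filters edges only, so the mark of a vertex changes nothing, while the mark of an unpaired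
edge removes exactly its square. -/
theorem multAway_eq_mul_soloFactor (T : Finset (Finset ℕ)) (W : Finset ℕ) (x : D.V ⊕ D.E)
    (hW : D.m x ∉ W) (hT : ∀ α ∈ T, D.m x ∉ α) :
    D.multAway T W = D.multAway T (insert (D.m x) W) * D.soloFactor x := by
  classical
  unfold multAway
  split_ifs with hc
  · rcases x with v | e
    · have : ∀ e, D.m (Sum.inr e) ≠ D.m (Sum.inl v) := fun e h => by
        simpa using D.m_injective h
      simp [soloFactor, this]
    · have : ({e' ∈ D.E₀ T | D.m (Sum.inr e') ∉ W} : Finset D.E) =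
          insert e {e' ∈ D.E₀ T | D.m (Sum.inr e') ∉ insert (D.m (Sum.inr e)) W} := by
        ext e'
        simp only [Finset.mem_filter, Finset.mem_insert, D.m_injective.eq_iff, Sum.inr.injEq]
        constructor
        · tauto
        · rintro (rfl | h)
          · refine ⟨?_, hW⟩
            simpa [E₀, pre] using hT
          · tauto
      rw [this, Finset.prod_insert (by simp)]
      simp only [soloFactor]
      ring
  · simp

theorem pre_pair (x y : D.V ⊕ D.E) : D.pre {D.m x, D.m y} = {x, y} := by
  ext z
  simp [pre, D.m_injective.eq_iff]

theorem duoFactor_comm (x y : D.V ⊕ D.E) : D.duoFactor x y = D.duoFactor y x := by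
  rcases x with v | e <;> rcases y with v' | e'
  · rfl
  · rfl
  · rfl
  · simp only [duoFactor]
    rw [pairFactor_comm]
    classical exact if_congr (D.parallel_comm e e') rfl rfl

theorem compatible_insert (α : Finset ℕ) (T : Finset (Finset ℕ)) :
    D.Compatible (insert α T) ↔ D.Compatible {α} ∧ D.Compatible T := by
  simp [Compatible]

/-- Incompatibility is absorbed by the value 0 of `duoFactor`, so adjacency need not be assumed. The
two marks join `W` on the right because there the edge is unpaired and its square must not be
counted. -/
theorem multAway_insert_edge_vertex (T : Finset (Finset ℕ)) (W : Finset ℕ) (e : D.E) (v : D.V)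
    (hT : ∀ β ∈ T, Disjoint {D.m (Sum.inr e), D.m (Sum.inl v)} β) :
    D.multAway (insert {D.m (Sum.inr e), D.m (Sum.inl v)} T) W =
      D.multAway T (W ∪ {D.m (Sum.inr e), D.m (Sum.inl v)}) *
        D.duoFactor (Sum.inr e) (Sum.inl v) := by
  classical
  have hα : D.Compatible {{D.m (Sum.inr e), D.m (Sum.inl v)}} ↔ D.Adj e v := by
    simp only [Compatible, Finset.mem_singleton, forall_eq, D.pre_pair]
    constructor
    · rintro (⟨e', v', h, h'⟩ | ⟨e', e'', h, -, h'⟩)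
      · have h1 : (Sum.inr e : D.V ⊕ D.E) ∈ ({Sum.inr e', Sum.inl v'} : Set _) := by simp [← h']
        have h2 : (Sum.inl v : D.V ⊕ D.E) ∈ ({Sum.inr e', Sum.inl v'} : Set _) := by simp [← h']
        simp only [Set.mem_insert_iff, Set.mem_singleton_iff, Sum.inr.injEq, Sum.inl.injEq,
          reduceCtorEq, or_false, false_or] at h1 h2
        subst h1 h2
        exact h
      · have h2 : (Sum.inl v : D.V ⊕ D.E) ∈ ({Sum.inr e', Sum.inr e''} : Set _) := by simp [← h']
        simp at h2
    · exact fun h => Or.inl ⟨e, v, h, rfl⟩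
  unfold multAway
  rw [compatible_insert, hα]
  by_cases hc : D.Compatible T
  swap
  · simp [hc]
  by_cases ha : D.Adj e v
  swap
  · simp [hc, ha, duoFactor]
  rw [if_pos ⟨ha, hc⟩, if_pos hc]
  have hnot : ∀ β ∈ T, Sum.inr e ∉ D.pre β := by
    intro β hβ h
    exact Finset.disjoint_left.1 (hT β hβ) (by simp) h
  have h0 : ({e' ∈ D.E₀ (insert {D.m (Sum.inr e), D.m (Sum.inl v)} T) | D.m (Sum.inr e') ∉ W}
      : Finset D.E) =
      {e' ∈ D.E₀ T | D.m (Sum.inr e') ∉ W ∪ {D.m (Sum.inr e), D.m (Sum.inl v)}} := by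
    ext e'
    simp only [E₀, Finset.mem_filter, Finset.mem_univ, true_and, Finset.forall_mem_insert,
      Finset.mem_union, pre, Set.mem_preimage, Finset.mem_coe]
    tauto
  have h1 : D.E₁ (insert {D.m (Sum.inr e), D.m (Sum.inl v)} T) = insert e (D.E₁ T) := by
    ext e'
    rw [Finset.mem_insert]
    simp only [E₁, Finset.mem_filter, Finset.mem_univ, true_and, Finset.exists_mem_insert,
      D.pre_pair, exists_or]
    refine or_congr_left ⟨?_, ?_⟩
    · rintro ⟨v', h⟩
      have h1 : (Sum.inr e' : D.V ⊕ D.E) ∈ ({Sum.inr e, Sum.inl v} : Set _) := by simp [h]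
      simpa using h1
    · rintro rfl
      exact ⟨v, rfl⟩
  have h2 : D.E₂ (insert {D.m (Sum.inr e), D.m (Sum.inl v)} T) = D.E₂ T := by
    ext z
    simp only [E₂, Finset.mem_filter, Finset.mem_univ, true_and, Finset.exists_mem_insert,
      D.pre_pair]
    refine exists_congr fun a => exists_congr fun b => and_congr_right fun _ =>
      and_congr_right fun _ => or_iff_right ?_
    intro h
    have h1 : (Sum.inl v : D.V ⊕ D.E) ∈ ({Sum.inr a, Sum.inr b} : Set _) := by simp [← h]
    simp at h1
  have he : e ∉ D.E₁ T := by
    simp only [E₁, Finset.mem_filter, Finset.mem_univ, true_and, not_exists, not_and]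
    intro v' β hβ h
    exact hnot β hβ (by simp [h])
  rw [h0, h1, h2, Finset.prod_insert he]
  simp only [duoFactor, if_pos ha]
  ring

theorem multAway_insert_edge_edge (T : Finset (Finset ℕ)) (W : Finset ℕ) (e e' : D.E)
    (hne : e ≠ e') (hT : ∀ β ∈ T, Disjoint {D.m (Sum.inr e), D.m (Sum.inr e')} β) :
    D.multAway (insert {D.m (Sum.inr e), D.m (Sum.inr e')} T) W =
      D.multAway T (W ∪ {D.m (Sum.inr e), D.m (Sum.inr e')}) *
        D.duoFactor (Sum.inr e) (Sum.inr e') := by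
  classical
  -- The preimage of a pair is an unordered set, so the two edges are recovered up to order only.
  have key : ∀ a b : D.E, ({Sum.inr e, Sum.inr e'} : Set (D.V ⊕ D.E)) = {Sum.inr a, Sum.inr b} →
      (a = e ∧ b = e') ∨ (a = e' ∧ b = e) := by
    intro a b h
    rw [Set.pair_eq_pair_iff] at h
    simp only [Sum.inr.injEq] at h
    tauto
  have hα : D.Compatible {{D.m (Sum.inr e), D.m (Sum.inr e')}} ↔ D.Parallel e e' := by
    simp only [Compatible, Finset.mem_singleton, forall_eq, D.pre_pair]
    constructor
    · rintro (⟨a, v', h, h'⟩ | ⟨a, b, h, hp, h'⟩)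
      · have h2 : (Sum.inl v' : D.V ⊕ D.E) ∈ ({Sum.inr e, Sum.inr e'} : Set _) := by simp [h']
        simp at h2
      · rcases key a b h' with ⟨rfl, rfl⟩ | ⟨rfl, rfl⟩
        · exact hp
        · exact (D.parallel_comm _ _).2 hp
    · exact fun h => Or.inr ⟨e, e', hne, h, rfl⟩
  unfold multAway
  rw [compatible_insert, hα]
  by_cases hc : D.Compatible T
  swap
  · simp [hc]
  by_cases ha : D.Parallel e e'
  swap
  · simp [hc, ha, duoFactor]
  rw [if_pos ⟨ha, hc⟩, if_pos hc]
  have hnot : ∀ β ∈ T, Sum.inr e ∉ D.pre β := by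
    intro β hβ h
    exact Finset.disjoint_left.1 (hT β hβ) (by simp) h
  have h0 : ({a ∈ D.E₀ (insert {D.m (Sum.inr e), D.m (Sum.inr e')} T) | D.m (Sum.inr a) ∉ W}
      : Finset D.E) =
      {a ∈ D.E₀ T | D.m (Sum.inr a) ∉ W ∪ {D.m (Sum.inr e), D.m (Sum.inr e')}} := by
    ext a
    simp only [E₀, Finset.mem_filter, Finset.mem_univ, true_and, Finset.forall_mem_insert,
      Finset.mem_union, pre, Set.mem_preimage, Finset.mem_coe]
    tauto
  have h1 : D.E₁ (insert {D.m (Sum.inr e), D.m (Sum.inr e')} T) = D.E₁ T := by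
    ext a
    simp only [E₁, Finset.mem_filter, Finset.mem_univ, true_and, Finset.exists_mem_insert,
      D.pre_pair]
    refine exists_congr fun v => or_iff_right ?_
    intro h
    have h1 : (Sum.inl v : D.V ⊕ D.E) ∈ ({Sum.inr e, Sum.inr e'} : Set _) := by simp [h]
    simp at h1
  have h2 : D.E₂ (insert {D.m (Sum.inr e), D.m (Sum.inr e')} T) = insert s(e, e') (D.E₂ T) := by
    ext z
    rw [Finset.mem_insert]
    simp only [E₂, Finset.mem_filter, Finset.mem_univ, true_and, Finset.exists_mem_insert,
      D.pre_pair, and_or_left, exists_or]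
    refine or_congr_left ⟨?_, ?_⟩
    · rintro ⟨a, b, -, rfl, h⟩
      rcases key a b h with ⟨rfl, rfl⟩ | ⟨rfl, rfl⟩
      · rfl
      · exact Sym2.eq_swap
    · rintro rfl
      exact ⟨e, e', hne, rfl, rfl⟩
  have he : s(e, e') ∉ D.E₂ T := by
    simp only [E₂, Finset.mem_filter, Finset.mem_univ, true_and, not_exists, not_and]
    intro a b _ hz β hβ h
    refine hnot β hβ ?_
    rw [h]
    have : e ∈ s(a, b) := by rw [← hz]; simp
    simpa using this
  rw [h0, h1, h2, Finset.prod_insert he]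
  simp only [duoFactor, if_pos ha, pairWeight, Sym2.lift_mk]
  ring

theorem multAway_insert (T : Finset (Finset ℕ)) (W : Finset ℕ) (x y : D.V ⊕ D.E)
    (hne : x ≠ y) (hT : ∀ β ∈ T, Disjoint {D.m x, D.m y} β) :
    D.multAway (insert {D.m x, D.m y} T) W =
      D.multAway T (W ∪ {D.m x, D.m y}) * D.duoFactor x y := by
  rcases x with v | e <;> rcases y with v' | e'
  · have hα : ¬ D.Compatible {{D.m (Sum.inl v), D.m (Sum.inl v')}} := by
      simp only [Compatible, Finset.mem_singleton, forall_eq, D.pre_pair]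
      rintro (⟨a, b, -, h⟩ | ⟨a, b, -, -, h⟩)
      all_goals
        have h1 : (Sum.inr a : D.V ⊕ D.E) ∈ ({Sum.inl v, Sum.inl v'} : Set _) := by simp [h]
        simp at h1
    simp [duoFactor, multAway, compatible_insert, hα]
  · rw [Finset.pair_comm, duoFactor_comm]
    refine D.multAway_insert_edge_vertex T W e' v ?_
    rwa [Finset.pair_comm]
  · exact D.multAway_insert_edge_vertex T W e v' hT
  · exact D.multAway_insert_edge_edge T W e e' (by simpa using hne) hT

/-- Adding a pair to the pairing does not increase the coefficients of the multiplicity. -/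
theorem coeffNonneg_mult_sub_mult_insert (T : Finset (Finset ℕ)) (j : ℕ) (h1 : 1 ≤ j)
    (h2 : j + 1 ≤ D.numElt) (hT : ∀ β ∈ T, Disjoint {j, j + 1} β) :
    CoeffNonneg (D.mult T - D.mult (insert {j, j + 1} T)) := by
  obtain ⟨x, hx⟩ := D.exists_m_eq h1 (by omega)
  obtain ⟨y, hy⟩ := D.exists_m_eq (k := j + 1) (by omega) h2
  have hne : x ≠ y := by
    rintro rfl
    omega
  have hTx : ∀ β ∈ T, D.m x ∉ β := fun β hβ => Finset.disjoint_left.1 (hT β hβ) (by simp [hx])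
  have hTy : ∀ β ∈ T, D.m y ∉ β := fun β hβ => Finset.disjoint_left.1 (hT β hβ) (by simp [hy])
  rw [← hy, ← hx] at hT ⊢
  rw [← multAway_empty, ← multAway_empty, D.multAway_insert T ∅ x y hne hT,
    D.multAway_eq_mul_soloFactor T ∅ y (by simp) hTy,
    D.multAway_eq_mul_soloFactor T _ x (by simp [D.m_injective.eq_iff, hne]) hTx]
  have : (∅ ∪ {D.m x, D.m y} : Finset ℕ) = insert (D.m x) (insert (D.m y) ∅) := by simp
  rw [this, mul_assoc, ← mul_sub]
  refine (D.coeffNonneg_multAway _ _).mul ?_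
  have sqn : ∀ n, CoeffNonneg (quantum 1 n ^ 2) := fun n => by
    rw [sq]
    exact (CoeffNonneg.quantum _ _).mul (.quantum _ _)
  -- Only the local factors of the two elements remain to be compared; where compatibility fails,
  -- the subtracted factor is 0.
  rcases x with v | e <;> rcases y with v' | e' <;> simp only [duoFactor, soloFactor]
  · simpa using CoeffNonneg.one
  · split_ifs
    · simpa using coeffNonneg_quantum_sq_sub _
    · simpa using sqn _
  · split_ifs
    · simpa using coeffNonneg_quantum_sq_sub _
    · simpa using sqn _
  · split_ifs
    · exact coeffNonneg_sq_mul_sq_sub _ _ (D.w_pos _) (D.w_pos _)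
    · simpa using (sqn _).mul (sqn _)

end MarkedFloorDiagram

/-! ### Marked floor diagrams on fixed sets of vertices and edges -/

/-- A weighted oriented graph with given sets of vertices and edges. -/
structure LabeledGraph (V E : Type) where
  src : E → Option V
  tgt : E → Option V
  adjacent : ∀ e, src e ≠ none ∨ tgt e ≠ none
  w : E → ℕ
  w_pos : ∀ e, 0 < w e

/-- The underlying weighted graph. -/
abbrev LabeledGraph.toGraph {V E : Type} [Fintype V] [Fintype E] (Γ : LabeledGraph V E) :
    WeightedGraph :=
  ⟨V, E, Γ.src, Γ.tgt, Γ.adjacent, Γ.w, Γ.w_pos⟩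

/-- A marked floor diagram with given sets of vertices and edges. -/
structure LabeledDiagram (V E : Type) [Fintype V] [Fintype E] (Δ : LatticePolygon) (g : ℕ)
    extends LabeledGraph V E where
  L : V → ℤ
  R : V → ℤ
  m : V ⊕ E → ℕ
  connected : toLabeledGraph.toGraph.Connected
  acyclic : toLabeledGraph.toGraph.Acyclic
  genus_eq : toLabeledGraph.toGraph.genus = g
  card_vertices : (Fintype.card V : ℝ) = Δ.height
  card_sinks : toLabeledGraph.toGraph.numSinks = Δ.ePlus
  card_sources : toLabeledGraph.toGraph.numSources = Δ.eMinus
  weight_infinite : ∀ e, src e = none ∨ tgt e = none → w e = 1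
  card_left : ∀ k : ℤ, Nat.card {v // L v = k} = Δ.bLeft k
  card_right : ∀ k : ℤ, Nat.card {v // R v = k} = Δ.bRight k
  div_eq : ∀ v, toLabeledGraph.toGraph.div v = L v + R v
  m_bijOn : Set.BijOn m Set.univ (Set.Icc 1 toLabeledGraph.toGraph.numElt)
  m_increasing : ∀ α β, toLabeledGraph.toGraph.Prec α β → m α < m β

/-- Serves twice: for regluing, with the identity on vertices, and for transport along a bijection.
-/
theorem WeightedGraph.connected_of_step (Γ Γ' : WeightedGraph) (f : Γ.V → Γ'.V)
    (hf : Function.Surjective f)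
    (h : ∀ u v, Γ.Step u v → Quot.mk Γ'.Step (f u) = Quot.mk Γ'.Step (f v))
    (hc : Γ.Connected) : Γ'.Connected := by
  rw [Connected, Nat.card_eq_one_iff_unique] at hc ⊢
  obtain ⟨h1, ⟨x⟩⟩ := hc
  let F : Γ.Components → Γ'.Components := Quot.lift (fun u => Quot.mk Γ'.Step (f u)) h
  have hF : Function.Surjective F := by
    rintro ⟨v⟩
    obtain ⟨u, rfl⟩ := hf v
    exact ⟨Quot.mk _ u, rfl⟩
  exact ⟨hF.subsingleton, ⟨F x⟩⟩

-- In this form each edge is one summand, so a regluing of two edges is checked on two summands.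
open Classical in
theorem WeightedGraph.div_eq_sum (Γ : WeightedGraph) (v : Γ.V) :
    Γ.div v = ∑ e, (Γ.w e : ℤ) *
      ((if Γ.tgt e = some v then 1 else 0) - (if Γ.src e = some v then 1 else 0)) := by
  rw [div, Finset.sum_filter, Finset.sum_filter, ← Finset.sum_sub_distrib]
  refine Finset.sum_congr rfl fun e _ => ?_
  split_ifs <;> simp

theorem WeightedGraph.card_E (Γ : WeightedGraph) :
    Fintype.card Γ.E = Γ.numBounded + Γ.numSinks + Γ.numSources := by
  classical
  have h1 : Γ.numBounded = ({e | Γ.src e ≠ none ∧ Γ.tgt e ≠ none} : Finset Γ.E).card := by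
    rw [numBounded, Nat.card_eq_fintype_card, Fintype.card_subtype]
  have h2 : Γ.numSinks = ({e | Γ.tgt e = none} : Finset Γ.E).card := by
    rw [numSinks, Nat.card_eq_fintype_card, Fintype.card_subtype]
  have h3 : Γ.numSources = ({e | Γ.src e = none} : Finset Γ.E).card := by
    rw [numSources, Nat.card_eq_fintype_card, Fintype.card_subtype]
  rw [h1, h2, h3, ← Finset.card_univ, ← Finset.card_union_of_disjoint,
    ← Finset.card_union_of_disjoint]
  · congr 1
    ext e
    simp
    tauto
  · rw [Finset.disjoint_left]
    intro e he he'
    have := Γ.adjacent e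
    simp at he he'
    tauto
  · rw [Finset.disjoint_left]
    intro e he he'
    simp at he he'
    tauto

/-- Monotonicity along paths reduces to the two ends of each edge; the same local condition excludes
oriented cycles. -/
theorem WeightedGraph.lt_of_prec (Γ : WeightedGraph) (m : Γ.V ⊕ Γ.E → ℕ)
    (hsrc : ∀ e v, Γ.src e = some v → m (Sum.inl v) < m (Sum.inr e))
    (htgt : ∀ e v, Γ.tgt e = some v → m (Sum.inr e) < m (Sum.inl v)) :
    ∀ α β, Γ.Prec α β → m α < m β := by
  intro α β h
  induction h with
  | single h =>
    cases h with
    | leave h => exact hsrc _ _ h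
    | enter h => exact htgt _ _ h
  | tail _ h ih =>
    refine ih.trans ?_
    cases h with
    | leave h => exact hsrc _ _ h
    | enter h => exact htgt _ _ h

theorem WeightedGraph.acyclic_of_lt (Γ : WeightedGraph) (m : Γ.V ⊕ Γ.E → ℕ)
    (hsrc : ∀ e v, Γ.src e = some v → m (Sum.inl v) < m (Sum.inr e))
    (htgt : ∀ e v, Γ.tgt e = some v → m (Sum.inr e) < m (Sum.inl v)) : Γ.Acyclic := by
  have : ∀ u v, Relation.TransGen Γ.Step u v → m (Sum.inl u) < m (Sum.inl v) := by
    intro u v h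
    induction h with
    | single h =>
      obtain ⟨e, h1, h2⟩ := h
      exact (hsrc _ _ h1).trans (htgt _ _ h2)
    | tail _ h ih =>
      obtain ⟨e, h1, h2⟩ := h
      exact ih.trans ((hsrc _ _ h1).trans (htgt _ _ h2))
  exact fun v h => lt_irrefl _ (this v v h)

namespace LabeledDiagram

variable {V E : Type} [Fintype V] [Fintype E] {Δ : LatticePolygon} {g : ℕ}

/-- Forget the labelling. -/
abbrev toMarked (p : LabeledDiagram V E Δ g) : MarkedFloorDiagram Δ g where
  toWeightedGraph := p.toLabeledGraph.toGraph
  L := p.L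
  R := p.R
  connected := p.connected
  acyclic := p.acyclic
  genus_eq := p.genus_eq
  card_vertices := p.card_vertices
  card_sinks := p.card_sinks
  card_sources := p.card_sources
  weight_infinite := p.weight_infinite
  card_left := p.card_left
  card_right := p.card_right
  div_eq := p.div_eq
  m := p.m
  m_bijOn := p.m_bijOn
  m_increasing := p.m_increasing

theorem ext_data {p p' : LabeledDiagram V E Δ g} (h1 : p.src = p'.src) (h2 : p.tgt = p'.tgt)
    (h3 : p.w = p'.w) (h4 : p.L = p'.L) (h5 : p.R = p'.R) (h6 : p.m = p'.m) : p = p' := by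
  rcases p with ⟨⟨_, _, _, _, _⟩, _, _, _, _, _, _, _, _, _, _, _, _, _, _, _⟩
  rcases p' with ⟨⟨_, _, _, _, _⟩, _, _, _, _, _, _, _, _, _, _, _, _, _, _, _⟩
  simp only at h1 h2 h3 h4 h5 h6
  subst h1 h2 h3 h4 h5 h6
  rfl

theorem m_src_lt (p : LabeledDiagram V E Δ g) {e : E} {v : V} (h : p.src e = some v) :
    p.m (Sum.inl v) < p.m (Sum.inr e) :=
  p.m_increasing _ _ (.single (.leave h))

theorem m_lt_tgt (p : LabeledDiagram V E Δ g) {e : E} {v : V} (h : p.tgt e = some v) :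
    p.m (Sum.inr e) < p.m (Sum.inl v) :=
  p.m_increasing _ _ (.single (.enter h))

theorem m_injective (p : LabeledDiagram V E Δ g) : Function.Injective p.m := p.toMarked.m_injective

open Classical in
/-- Change the graph and the marking of a labelled diagram, keeping the divergences, the
connected components and the infinite edges. -/
def modify (p : LabeledDiagram V E Δ g) (src tgt : E → Option V) (w : E → ℕ) (m : V ⊕ E → ℕ)
    (hsrc : ∀ e, src e = none ↔ p.src e = none) (htgt : ∀ e, tgt e = none ↔ p.tgt e = none)
    (hw : ∀ e, 0 < w e) (hinf : ∀ e, src e = none ∨ tgt e = none → w e = 1)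
    (hstep : ∀ e u v, p.src e = some u → p.tgt e = some v →
      Relation.EqvGen (fun u v => ∃ e, src e = some u ∧ tgt e = some v) u v)
    (hdiv : ∀ v, ∑ e, (w e : ℤ) *
      ((if tgt e = some v then 1 else 0) - (if src e = some v then 1 else 0)) =
        ∑ e, (p.w e : ℤ) *
      ((if p.tgt e = some v then 1 else 0) - (if p.src e = some v then 1 else 0)))
    (hm : Set.BijOn m Set.univ (Set.Icc 1 (Fintype.card V + Fintype.card E)))
    (hmsrc : ∀ e v, src e = some v → m (Sum.inl v) < m (Sum.inr e))
    (hmtgt : ∀ e v, tgt e = some v → m (Sum.inr e) < m (Sum.inl v)) :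
    LabeledDiagram V E Δ g :=
  have hadj : ∀ e, src e ≠ none ∨ tgt e ≠ none := fun e => by
    simpa only [ne_eq, hsrc, htgt] using p.adjacent e
  have hconn : (LabeledGraph.toGraph ⟨src, tgt, hadj, w, hw⟩).Connected :=
    WeightedGraph.connected_of_step p.toGraph _ id Function.surjective_id
      (fun u v ⟨e, h1, h2⟩ => Quot.eqvGen_sound (hstep e u v h1 h2)) p.connected
  { src := src
    tgt := tgt
    adjacent := hadj
    w := w
    w_pos := hw
    L := p.L
    R := p.R
    m := m
    connected := hconn
    acyclic := WeightedGraph.acyclic_of_lt _ m hmsrc hmtgt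
    -- Both graphs have one component and the same bounded edges, so the Betti numbers agree.
    genus_eq := by
      rw [← p.genus_eq]
      have h1 := p.connected
      have h2 := hconn
      unfold WeightedGraph.Connected at h1 h2
      rw [WeightedGraph.genus, WeightedGraph.genus, h1, h2]
      simp only [WeightedGraph.numBounded, ne_eq, hsrc, htgt]
    card_vertices := p.card_vertices
    card_sinks := by
      rw [← p.card_sinks]
      simp only [WeightedGraph.numSinks, htgt]
    card_sources := by
      rw [← p.card_sources]
      simp only [WeightedGraph.numSources, hsrc]
    weight_infinite := hinf
    card_left := p.card_left
    card_right := p.card_right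
    div_eq := fun v => by
      rw [← p.div_eq, WeightedGraph.div_eq_sum, WeightedGraph.div_eq_sum]
      exact hdiv v
    m_bijOn := hm
    m_increasing := (LabeledGraph.toGraph ⟨src, tgt, hadj, w, hw⟩).lt_of_prec m hmsrc hmtgt }

open Classical in
/-- Transport a marked floor diagram along bijections of vertices and edges. -/
def pullback (D : MarkedFloorDiagram Δ g) (eV : V ≃ D.V) (eE : E ≃ D.E) :
    LabeledDiagram V E Δ g :=
  have hsrc : ∀ e v, (D.src (eE e)).map eV.symm = some v ↔ D.src (eE e) = some (eV v) := by
    intro e v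
    rw [Option.map_eq_some_iff]
    simp [Equiv.symm_apply_eq]
  have htgt : ∀ e v, (D.tgt (eE e)).map eV.symm = some v ↔ D.tgt (eE e) = some (eV v) := by
    intro e v
    rw [Option.map_eq_some_iff]
    simp [Equiv.symm_apply_eq]
  have hmsrc : ∀ e v, (D.src (eE e)).map eV.symm = some v →
      D.m (Sum.inl (eV v)) < D.m (Sum.inr (eE e)) := fun e v h =>
    D.m_increasing _ _ (.single (.leave ((hsrc e v).1 h)))
  have hmtgt : ∀ e v, (D.tgt (eE e)).map eV.symm = some v →
      D.m (Sum.inr (eE e)) < D.m (Sum.inl (eV v)) := fun e v h =>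
    D.m_increasing _ _ (.single (.enter ((htgt e v).1 h)))
  have hadj : ∀ e, (D.src (eE e)).map eV.symm ≠ none ∨ (D.tgt (eE e)).map eV.symm ≠ none :=
    fun e => by simpa using D.adjacent (eE e)
  have hconn : (LabeledGraph.toGraph ⟨fun e => (D.src (eE e)).map eV.symm,
      fun e => (D.tgt (eE e)).map eV.symm, hadj, fun e => D.w (eE e),
      fun e => D.w_pos (eE e)⟩).Connected := by
    refine WeightedGraph.connected_of_step D.toWeightedGraph _ eV.symm eV.symm.surjective ?_
      D.connected
    rintro u v ⟨e, h1, h2⟩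
    exact Quot.sound ⟨eE.symm e, by simp [h1], by simp [h2]⟩
  { src := fun e => (D.src (eE e)).map eV.symm
    tgt := fun e => (D.tgt (eE e)).map eV.symm
    adjacent := hadj
    w := fun e => D.w (eE e)
    w_pos := fun e => D.w_pos (eE e)
    L := fun v => D.L (eV v)
    R := fun v => D.R (eV v)
    m := fun x => D.m (Sum.map eV eE x)
    connected := hconn
    acyclic := WeightedGraph.acyclic_of_lt _ (fun x => D.m (Sum.map eV eE x)) hmsrc hmtgt
    genus_eq := by
      rw [← D.genus_eq]
      have h1 := D.connected
      have h2 := hconn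
      unfold WeightedGraph.Connected at h1 h2
      rw [WeightedGraph.genus, WeightedGraph.genus, h1, h2, Fintype.card_congr eV]
      congr 3
      exact Nat.card_congr (eE.subtypeEquiv fun e => by simp)
    card_vertices := by rw [Fintype.card_congr eV, D.card_vertices]
    card_sinks := by
      rw [← D.card_sinks]
      exact Nat.card_congr (eE.subtypeEquiv fun e => by simp)
    card_sources := by
      rw [← D.card_sources]
      exact Nat.card_congr (eE.subtypeEquiv fun e => by simp)
    weight_infinite := fun e h => D.weight_infinite (eE e) (by simpa using h)
    card_left := fun k => by
      rw [← D.card_left]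
      exact Nat.card_congr (eV.subtypeEquiv fun e => by simp)
    card_right := fun k => by
      rw [← D.card_right]
      exact Nat.card_congr (eV.subtypeEquiv fun e => by simp)
    div_eq := fun v => by
      rw [← D.div_eq, WeightedGraph.div_eq_sum, WeightedGraph.div_eq_sum]
      refine Fintype.sum_equiv eE _ _ fun e => ?_
      exact congrArg₂ (fun a b => (D.w (eE e) : ℤ) * (a - b))
        (if_congr (htgt e v) rfl rfl) (if_congr (hsrc e v) rfl rfl)
    m_bijOn := by
      have h : (LabeledGraph.toGraph ⟨fun e => (D.src (eE e)).map eV.symm,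
          fun e => (D.tgt (eE e)).map eV.symm, hadj, fun e => D.w (eE e),
          fun e => D.w_pos (eE e)⟩).numElt = D.numElt := by
        simp only [WeightedGraph.numElt]
        rw [Fintype.card_congr eV, Fintype.card_congr eE]
      rw [h]
      exact D.m_bijOn.comp (Set.bijOn_univ.2 (Equiv.sumCongr eV eE).bijective)
    m_increasing := (LabeledGraph.toGraph ⟨fun e => (D.src (eE e)).map eV.symm,
      fun e => (D.tgt (eE e)).map eV.symm, hadj, fun e => D.w (eE e),
      fun e => D.w_pos (eE e)⟩).lt_of_prec (fun x => D.m (Sum.map eV eE x)) hmsrc hmtgt }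

/-- The transported diagram is isomorphic to the given one. -/
def pullbackIso (D : MarkedFloorDiagram Δ g) (eV : V ≃ D.V) (eE : E ≃ D.E) :
    (pullback D eV eE).toMarked.Iso D where
  onV := eV
  onE := eE
  src_eq e := by simp [pullback, Option.map_map]
  tgt_eq e := by simp [pullback, Option.map_map]
  w_eq _ := rfl
  L_eq _ := rfl
  R_eq _ := rfl
  m_inl _ := rfl
  m_inr _ := rfl

/-- Hence the labelled diagrams in the class of `D` are exactly its transports. -/
theorem eq_pullback {D : MarkedFloorDiagram Δ g} {p : LabeledDiagram V E Δ g}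
    (φ : p.toMarked.Iso D) : p = pullback D φ.onV φ.onE := by
  refine ext_data ?_ ?_ ?_ ?_ ?_ ?_
  · funext e
    have := φ.src_eq e
    simp only [pullback]
    rw [this, Option.map_map]
    simp
  · funext e
    have := φ.tgt_eq e
    simp only [pullback]
    rw [this, Option.map_map]
    simp
  · funext e
    exact (φ.w_eq e).symm
  · funext v
    exact (φ.L_eq v).symm
  · funext v
    exact (φ.R_eq v).symm
  · funext x
    rcases x with v | e
    · exact (φ.m_inl v).symm
    · exact (φ.m_inr e).symm

/-- The marking separates all elements, so no nontrivial relabelling fixes a labelled diagram. -/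
theorem pullback_injective (D : MarkedFloorDiagram Δ g) :
    Function.Injective fun φ : (V ≃ D.V) × (E ≃ D.E) => pullback D φ.1 φ.2 := by
  rintro ⟨a, b⟩ ⟨a', b'⟩ h
  have hm : ∀ x, D.m (Sum.map a b x) = D.m (Sum.map a' b' x) := fun x =>
    congrFun (congrArg LabeledDiagram.m h) x
  refine Prod.ext (Equiv.ext fun v => ?_) (Equiv.ext fun e => ?_)
  · simpa using D.m_injective (hm (Sum.inl v))
  · simpa using D.m_injective (hm (Sum.inr e))

/-! ### Finiteness of the set of labelled diagrams. -/

theorem m_le (p : LabeledDiagram V E Δ g) (x : V ⊕ E) :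
    p.m x ≤ Fintype.card V + Fintype.card E := (p.m_bijOn.mapsTo (Set.mem_univ x)).2

-- Summation by parts: divergences weighted by marks become weights multiplied by increases of the
-- mark, where 0 stands for the missing end of an infinite edge.
open Classical in
theorem sum_m_mul_div (p : LabeledDiagram V E Δ g) :
    ∑ v, (p.m (Sum.inl v) : ℤ) * p.toGraph.div v =
      ∑ e, (p.w e : ℤ) * ((p.tgt e).elim 0 (fun v => (p.m (Sum.inl v) : ℤ)) -
        (p.src e).elim 0 (fun v => (p.m (Sum.inl v) : ℤ))) := by
  simp_rw [WeightedGraph.div_eq_sum, Finset.mul_sum]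
  rw [Finset.sum_comm]
  refine Finset.sum_congr rfl fun e _ => ?_
  have key : ∀ o : Option V, ∑ v, (p.m (Sum.inl v) : ℤ) * (if o = some v then 1 else 0) =
      o.elim 0 (fun v => (p.m (Sum.inl v) : ℤ)) := by
    rintro (_ | u) <;> simp
  rw [← key, ← key, ← Finset.sum_sub_distrib, Finset.mul_sum]
  refine Finset.sum_congr rfl fun v _ => ?_
  ring

theorem exists_L_eq (p p' : LabeledDiagram V E Δ g) (v : V) : ∃ u, p'.L u = p.L v := by
  have h1 := p.card_left (p.L v)
  rw [← p'.card_left] at h1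
  have : 0 < Nat.card {u // p.L u = p.L v} := Nat.card_pos_iff.2 ⟨⟨⟨v, rfl⟩⟩, inferInstance⟩
  rw [h1] at this
  obtain ⟨⟨u, hu⟩⟩ := (Nat.card_pos_iff.1 this).1
  exact ⟨u, hu⟩

theorem exists_R_eq (p p' : LabeledDiagram V E Δ g) (v : V) : ∃ u, p'.R u = p.R v := by
  have h1 := p.card_right (p.R v)
  rw [← p'.card_right] at h1
  have : 0 < Nat.card {u // p.R u = p.R v} := Nat.card_pos_iff.2 ⟨⟨⟨v, rfl⟩⟩, inferInstance⟩
  rw [h1] at this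
  obtain ⟨⟨u, hu⟩⟩ := (Nat.card_pos_iff.1 this).1
  exact ⟨u, hu⟩

/-- The weights of the diagrams with a given Newton polygon are bounded. -/
theorem exists_weight_le (p' : LabeledDiagram V E Δ g) :
    ∃ B : ℕ, ∀ (p : LabeledDiagram V E Δ g) (e : E), p.w e ≤ B := by
  set N : ℤ := Fintype.card V + Fintype.card E with hN
  set C : ℤ := ∑ u, |p'.L u| + ∑ u, |p'.R u| with hC
  have hC0 : 0 ≤ C := add_nonneg (Finset.sum_nonneg fun _ _ => abs_nonneg _)
    (Finset.sum_nonneg fun _ _ => abs_nonneg _)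
  have hN0 : 0 ≤ N := by positivity
  -- Each vertex contributes at most N · C to the sum of divergences weighted by marks. Each edge
  -- contributes at least its weight minus N + 1: bounded edges and sources gain at least their
  -- weight, and a sink has weight 1 and loses at most N.
  refine ⟨(∑ _v : V, N * C + ∑ _e : E, (N + 1)).toNat, fun p e => ?_⟩
  have hm : ∀ x, (p.m x : ℤ) ≤ N := fun x => by
    rw [hN]
    exact_mod_cast p.m_le x
  have hdiv : ∀ v, p.toGraph.div v ≤ C := by
    intro v
    obtain ⟨a, ha⟩ := exists_L_eq p p' v
    obtain ⟨b, hb⟩ := exists_R_eq p p' v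
    rw [p.div_eq, ← ha, ← hb]
    refine add_le_add ((le_abs_self _).trans ?_) ((le_abs_self _).trans ?_)
    · exact Finset.single_le_sum (f := fun u => |p'.L u|) (fun _ _ => abs_nonneg _)
        (Finset.mem_univ a)
    · exact Finset.single_le_sum (f := fun u => |p'.R u|) (fun _ _ => abs_nonneg _)
        (Finset.mem_univ b)
  have h1 : ∑ v, (p.m (Sum.inl v) : ℤ) * p.toGraph.div v ≤ ∑ _v : V, N * C :=
    Finset.sum_le_sum fun v _ => calc
      (p.m (Sum.inl v) : ℤ) * p.toGraph.div v ≤ (p.m (Sum.inl v) : ℤ) * C :=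
        mul_le_mul_of_nonneg_left (hdiv v) (by positivity)
      _ ≤ N * C := mul_le_mul_of_nonneg_right (hm _) hC0
  have h2 : ∀ e, (p.w e : ℤ) - (N + 1) ≤
      (p.w e : ℤ) * ((p.tgt e).elim 0 (fun v => (p.m (Sum.inl v) : ℤ)) -
        (p.src e).elim 0 (fun v => (p.m (Sum.inl v) : ℤ))) := by
    intro e
    have hw : (0 : ℤ) < p.w e := by exact_mod_cast p.w_pos e
    rcases ht : p.tgt e with _ | t
    · have hw1 := p.weight_infinite e (Or.inr ht)
      rw [hw1]
      rcases hs : p.src e with _ | s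
      · simp only [Option.elim]
        push_cast
        linarith
      · have := hm (Sum.inl s)
        simp only [Option.elim]
        push_cast
        linarith
    · have h3 := p.m_lt_tgt ht
      rcases hs : p.src e with _ | s
      · have : (1 : ℤ) ≤ p.m (Sum.inl t) := by exact_mod_cast (by omega : 1 ≤ p.m (Sum.inl t))
        simp only [Option.elim]
        nlinarith
      · have h4 := p.m_src_lt hs
        have : (1 : ℤ) ≤ p.m (Sum.inl t) - p.m (Sum.inl s) := by omega
        simp only [Option.elim]
        nlinarith
  rw [sum_m_mul_div] at h1
  have h3 := (Finset.sum_le_sum fun e (_ : e ∈ Finset.univ) => h2 e).trans h1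
  rw [Finset.sum_sub_distrib] at h3
  have h4 : (p.w e : ℤ) ≤ ∑ e, (p.w e : ℤ) :=
    Finset.single_le_sum (f := fun e => (p.w e : ℤ)) (fun _ _ => by positivity)
      (Finset.mem_univ e)
  omega

/-- With bounded weights, and with `L` and `R` confined to the values they take in one fixed
diagram, all the data range over finite sets. -/
instance : Finite (LabeledDiagram V E Δ g) := by
  classical
  rcases isEmpty_or_nonempty (LabeledDiagram V E Δ g) with h | ⟨⟨p'⟩⟩
  · infer_instance
  obtain ⟨B, hB⟩ := exists_weight_le p'
  let F : LabeledDiagram V E Δ g → (E → Option V) × (E → Option V) × (E → Fin (B + 1)) ×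
      (V → Set.range p'.L) × (V → Set.range p'.R) ×
      (V ⊕ E → Fin (Fintype.card V + Fintype.card E + 1)) := fun p =>
    (p.src, p.tgt, fun e => ⟨p.w e, Nat.lt_succ_of_le (hB p e)⟩,
      fun v => ⟨p.L v, exists_L_eq p p' v⟩, fun v => ⟨p.R v, exists_R_eq p p' v⟩,
      fun x => ⟨p.m x, Nat.lt_succ_of_le (p.m_le x)⟩)
  refine Finite.of_injective F fun p q h => ?_
  simp only [F, Prod.mk.injEq, funext_iff, Fin.mk.injEq] at h
  obtain ⟨h1, h2, h3, h4, h5, h6⟩ := h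
  exact ext_data (funext h1) (funext h2) (funext h3) (funext fun v => congrArg Subtype.val (h4 v))
    (funext fun v => congrArg Subtype.val (h5 v)) (funext h6)

noncomputable instance : Fintype (LabeledDiagram V E Δ g) := Fintype.ofFinite _

/-- Each isomorphism class has `|V|! |E|!` labellings. -/
theorem sum_mult_eq (hV : ∀ D : MarkedFloorDiagram Δ g, Nonempty (V ≃ D.V))
    (hE : ∀ D : MarkedFloorDiagram Δ g, Nonempty (E ≃ D.E)) (S : Finset (Finset ℕ)) :
    ∑ p : LabeledDiagram V E Δ g, p.toMarked.mult S =
      ((Fintype.card V).factorial * (Fintype.card E).factorial) • refinedInvariant Δ g S := by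
  classical
  let cls : LabeledDiagram V E Δ g → MarkedFloorDiagram.IsoClass Δ g :=
    fun p => Quotient.mk _ p.toMarked
  have hcls : Function.Surjective cls := by
    intro c
    induction c using Quotient.inductionOn with
    | _ D =>
    obtain ⟨eV⟩ := hV D
    obtain ⟨eE⟩ := hE D
    exact ⟨pullback D eV eE, Quotient.sound ⟨pullbackIso D eV eE⟩⟩
  -- This makes the `finsum` a genuine finite sum.
  have : Finite (MarkedFloorDiagram.IsoClass Δ g) := Finite.of_surjective cls hcls
  have : Fintype (MarkedFloorDiagram.IsoClass Δ g) := Fintype.ofFinite _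
  rw [refinedInvariant, finsum_eq_sum_of_fintype, Finset.smul_sum,
    ← Finset.sum_fiberwise Finset.univ cls]
  refine Finset.sum_congr rfl fun c _ => ?_
  have hcard : (Finset.univ.filter fun p => cls p = c).card =
      (Fintype.card V).factorial * (Fintype.card E).factorial := by
    induction c using Quotient.inductionOn with
    | _ D =>
    obtain ⟨eV⟩ := hV D
    obtain ⟨eE⟩ := hE D
    -- The fibre over the class of `D` is the injective image of the set of pairs of bijections.
    rw [← Fintype.card_equiv eV, ← Fintype.card_equiv eE, ← Fintype.card_prod, ← Finset.card_univ,
      ← Finset.card_image_of_injective _ (pullback_injective (V := V) (E := E) D)]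
    congr 1
    ext p
    simp only [Finset.mem_filter, Finset.mem_univ, true_and, Finset.mem_image, Prod.exists]
    constructor
    · intro h
      obtain ⟨φ⟩ := Quotient.exact h
      exact ⟨φ.onV, φ.onE, (eq_pullback φ).symm⟩
    · rintro ⟨a, b, rfl⟩
      exact Quotient.sound ⟨pullbackIso D a b⟩
  rw [← hcard, ← Finset.sum_const]
  refine Finset.sum_congr rfl fun p hp => ?_
  rw [← (Finset.mem_filter.1 hp).2]
  rfl

end LabeledDiagram

/-! ### Local modifications of labelled diagrams -/

namespace LabeledDiagram

variable {V E : Type} [Fintype V] [Fintype E] {Δ : LatticePolygon} {g : ℕ}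

/-- A change confined to the elements with marks in `W`, a set that meets no pair of `T`, is
invisible to the remaining product. -/
theorem multAway_congr (p p' : LabeledDiagram V E Δ g) (T : Finset (Finset ℕ)) (W : Finset ℕ)
    (hT : ∀ α ∈ T, Disjoint α W) (hm : ∀ x, p.m x ∉ W → p'.m x = p.m x)
    (hmW : ∀ x, p.m x ∈ W → p'.m x ∈ W)
    (h : ∀ e, p.m (Sum.inr e) ∉ W → p'.src e = p.src e ∧ p'.tgt e = p.tgt e ∧ p'.w e = p.w e) :
    p'.toMarked.multAway T W = p.toMarked.multAway T W := by
  classical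
  have hW : ∀ x, p'.m x ∈ W ↔ p.m x ∈ W := by
    intro x
    by_cases hx : p.m x ∈ W
    · simp [hx, hmW x hx]
    · rw [hm x hx]
  have hpre : ∀ α ∈ T, p'.toMarked.pre α = p.toMarked.pre α := by
    intro α hα
    ext x
    change p'.m x ∈ α ↔ p.m x ∈ α
    by_cases hx : p.m x ∈ W
    · exact iff_of_false (Finset.disjoint_right.1 (hT α hα) (hmW x hx))
        (Finset.disjoint_right.1 (hT α hα) hx)
    · rw [hm x hx]
  have hout : ∀ α ∈ T, ∀ e, Sum.inr e ∈ p.toMarked.pre α → p.m (Sum.inr e) ∉ W :=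
    fun α hα e he => Finset.disjoint_left.1 (hT α hα) he
  have hcomp : p'.toMarked.Compatible T ↔ p.toMarked.Compatible T := by
    refine forall₂_congr fun α hα => or_congr ?_ ?_
    · refine exists_congr fun e => exists_congr fun v => ?_
      rw [hpre α hα, and_congr_left_iff]
      intro hp
      have := h e (hout α hα e (by simp [hp]))
      change p'.src e = some v ∨ p'.tgt e = some v ↔ p.src e = some v ∨ p.tgt e = some v
      rw [this.1, this.2.1]
    · refine exists_congr fun e => exists_congr fun e' => ?_
      rw [hpre α hα]
      refine and_congr_right fun _ => ?_
      rw [and_congr_left_iff]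
      intro hp
      have h1 := h e (hout α hα e (by simp [hp]))
      have h2 := h e' (hout α hα e' (by simp [hp]))
      refine exists_congr fun v => ?_
      change (p'.tgt e = some v ∧ p'.tgt e' = some v) ∨ (p'.src e = some v ∧ p'.src e' = some v) ↔
        (p.tgt e = some v ∧ p.tgt e' = some v) ∨ (p.src e = some v ∧ p.src e' = some v)
      rw [h1.1, h1.2.1, h2.1, h2.2.1]
  unfold MarkedFloorDiagram.multAway
  by_cases hc : p.toMarked.Compatible T
  swap
  · rw [if_neg hc, if_neg (fun h => hc (hcomp.1 h))]
  rw [if_pos hc, if_pos (hcomp.2 hc)]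
  refine congrArg₂ (· * ·) (congrArg₂ (· * ·) ?_ ?_) ?_
  · refine Finset.prod_congr ?_ ?_
    · ext e
      simp only [MarkedFloorDiagram.E₀, Finset.mem_filter, Finset.mem_univ, true_and]
      refine and_congr ?_ (not_congr (hW _))
      exact forall₂_congr fun α hα => by rw [hpre α hα]
    · intro e he
      exact congrArg (fun n => quantum 1 n ^ 2) (h e (Finset.mem_filter.1 he).2).2.2
  · refine Finset.prod_congr ?_ ?_
    · ext e
      simp only [MarkedFloorDiagram.E₁, Finset.mem_filter, Finset.mem_univ, true_and]
      refine exists_congr fun v => exists_congr fun α => and_congr_right fun hα => ?_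
      rw [hpre α hα]
    · intro e he
      simp only [MarkedFloorDiagram.E₁, Finset.mem_filter, Finset.mem_univ, true_and] at he
      obtain ⟨v, α, hα, hp⟩ := he
      exact congrArg (quantum 2) (h e (hout α hα e (by simp [hp]))).2.2
  · refine Finset.prod_congr ?_ ?_
    · ext z
      simp only [MarkedFloorDiagram.E₂, Finset.mem_filter, Finset.mem_univ, true_and]
      refine exists_congr fun e => exists_congr fun e' => and_congr_right fun _ =>
        and_congr_right fun _ => exists_congr fun α => and_congr_right fun hα => ?_
      rw [hpre α hα]
    · intro z hz
      simp only [MarkedFloorDiagram.E₂, Finset.mem_filter, Finset.mem_univ, true_and] at hz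
      obtain ⟨e, e', -, rfl, α, hα, hp⟩ := hz
      simp only [MarkedFloorDiagram.pairWeight, Sym2.lift_mk]
      rw [(h e (hout α hα e (by simp [hp]))).2.2, (h e' (hout α hα e' (by simp [hp]))).2.2]

theorem soloFactor_congr {p p' : LabeledDiagram V E Δ g} (h : p'.w = p.w) (x : V ⊕ E) :
    p'.toMarked.soloFactor x = p.toMarked.soloFactor x := by
  rcases x with v | e
  · rfl
  · change quantum 1 (p'.w e) ^ 2 = quantum 1 (p.w e) ^ 2
    rw [h]

theorem duoFactor_congr {p p' : LabeledDiagram V E Δ g} (h1 : p'.src = p.src)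
    (h2 : p'.tgt = p.tgt) (h3 : p'.w = p.w) (x y : V ⊕ E) :
    p'.toMarked.duoFactor x y = p.toMarked.duoFactor x y := by
  rcases p with ⟨⟨_, _, _, _, _⟩, _, _, _, _, _, _, _, _, _, _, _, _, _, _, _⟩
  rcases p' with ⟨⟨_, _, _, _, _⟩, _, _, _, _, _, _, _, _, _, _, _, _, _, _, _⟩
  simp only at h1 h2 h3
  subst h1 h2 h3
  rcases x with v | e <;> rcases y with v' | e' <;> rfl

/-! ### Exchange of two consecutive marks. -/

/-- Two elements are incident. -/
def Near (p : LabeledDiagram V E Δ g) : V ⊕ E → V ⊕ E → Prop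
  | Sum.inl v, Sum.inr e => p.src e = some v ∨ p.tgt e = some v
  | Sum.inr e, Sum.inl v => p.src e = some v ∨ p.tgt e = some v
  | _, _ => False

theorem near_comm (p : LabeledDiagram V E Δ g) (x y : V ⊕ E) : p.Near x y ↔ p.Near y x := by
  rcases x with v | e <;> rcases y with v' | e' <;> rfl

theorem near_congr {p p' : LabeledDiagram V E Δ g} (h1 : p'.src = p.src)
    (h2 : p'.tgt = p.tgt) (x y : V ⊕ E) : p'.Near x y ↔ p.Near x y := by
  rcases x with v | e <;> rcases y with v' | e' <;> simp [Near, h1, h2]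

theorem exists_m_eq (p : LabeledDiagram V E Δ g) {k : ℕ} (h1 : 1 ≤ k)
    (h2 : k ≤ Fintype.card V + Fintype.card E) : ∃ x, p.m x = k :=
  p.toMarked.exists_m_eq h1 h2

theorem swap_bijOn (p : LabeledDiagram V E Δ g) {k : ℕ} (h1 : 1 ≤ k)
    (h2 : k + 1 ≤ Fintype.card V + Fintype.card E) :
    Set.BijOn (fun x => Equiv.swap k (k + 1) (p.m x)) Set.univ
      (Set.Icc 1 (Fintype.card V + Fintype.card E)) :=
  (Equiv.swap_bijOn_self (by simp only [Set.mem_Icc]; omega)).comp p.m_bijOn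

/-- The elements marked `k` and `k + 1` may be exchanged. -/
def Swappable (p : LabeledDiagram V E Δ g) (k : ℕ) : Prop :=
  1 ≤ k ∧ k + 1 ≤ Fintype.card V + Fintype.card E ∧
    ∀ x y, p.m x = k → p.m y = k + 1 → ¬ p.Near x y

/-- Exchanging consecutive integers reverses one inequality only, the one between them. -/
theorem swap_lt_swap {a b k : ℕ} (h : a < b) (hk : ¬ (a = k ∧ b = k + 1)) :
    Equiv.swap k (k + 1) a < Equiv.swap k (k + 1) b := by
  simp only [Equiv.swap_apply_def]
  split_ifs <;> omega

open Classical in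
/-- Exchange the marks `k` and `k + 1`, if this is possible. -/
noncomputable def swapMarks (k : ℕ) (p : LabeledDiagram V E Δ g) : LabeledDiagram V E Δ g :=
  if h : p.Swappable k then
    p.modify p.src p.tgt p.w (fun x => Equiv.swap k (k + 1) (p.m x)) (fun _ => Iff.rfl)
      (fun _ => Iff.rfl) p.w_pos p.weight_infinite (fun e _ _ h1 h2 => .rel _ _ ⟨e, h1, h2⟩)
      (fun _ => rfl) (p.swap_bijOn h.1 h.2.1)
      (fun _ _ h' => swap_lt_swap (p.m_src_lt h') fun ⟨h1, h2⟩ => h.2.2 _ _ h1 h2 (Or.inl h'))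
      (fun _ _ h' => swap_lt_swap (p.m_lt_tgt h') fun ⟨h1, h2⟩ => h.2.2 _ _ h1 h2 (Or.inr h'))
  -- Doing nothing here makes the exchange an involution on all labelled diagrams, ready for
  -- reindexing sums.
  else p

section swapMarks

variable (k : ℕ) (p : LabeledDiagram V E Δ g)

theorem swapMarks_src : (p.swapMarks k).src = p.src := by
  unfold swapMarks
  split_ifs <;> rfl

theorem swapMarks_tgt : (p.swapMarks k).tgt = p.tgt := by
  unfold swapMarks
  split_ifs <;> rfl

theorem swapMarks_w : (p.swapMarks k).w = p.w := by
  unfold swapMarks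
  split_ifs <;> rfl

theorem swapMarks_L : (p.swapMarks k).L = p.L := by
  unfold swapMarks
  split_ifs <;> rfl

theorem swapMarks_R : (p.swapMarks k).R = p.R := by
  unfold swapMarks
  split_ifs <;> rfl

variable {p k}

theorem swapMarks_m (h : p.Swappable k) (x : V ⊕ E) :
    (p.swapMarks k).m x = Equiv.swap k (k + 1) (p.m x) := by
  unfold swapMarks
  rw [dif_pos h]
  rfl

theorem Swappable.swapMarks (h : p.Swappable k) : (p.swapMarks k).Swappable k := by
  refine ⟨h.1, h.2.1, fun x y hx hy => ?_⟩
  rw [swapMarks_m h] at hx hy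
  rw [near_congr (swapMarks_src k p) (swapMarks_tgt k p), near_comm]
  refine h.2.2 y x ?_ ?_
  · rw [Equiv.swap_apply_eq_iff] at hy
    simpa using hy
  · rw [Equiv.swap_apply_eq_iff] at hx
    simpa using hx

variable (p k)

theorem swapMarks_swapMarks : (p.swapMarks k).swapMarks k = p := by
  by_cases h : p.Swappable k
  · refine ext_data ?_ ?_ ?_ ?_ ?_ ?_
    · simp only [swapMarks_src]
    · simp only [swapMarks_tgt]
    · simp only [swapMarks_w]
    · simp only [swapMarks_L]
    · simp only [swapMarks_R]
    · funext x
      rw [swapMarks_m h.swapMarks, swapMarks_m h, Equiv.swap_apply_self]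
  · have : p.swapMarks k = p := by
      unfold swapMarks
      rw [dif_neg h]
    rw [this, this]

theorem multAway_swapMarks (T : Finset (Finset ℕ)) (W : Finset ℕ) (hT : ∀ α ∈ T, Disjoint α W)
    (hk : k ∈ W) (hk' : k + 1 ∈ W) :
    (p.swapMarks k).toMarked.multAway T W = p.toMarked.multAway T W := by
  by_cases h : p.Swappable k
  · refine multAway_congr _ _ T W hT (fun x hx => ?_) (fun x hx => ?_) fun e _ => ?_
    · rw [swapMarks_m h, Equiv.swap_apply_of_ne_of_ne]
      · rintro rfl
        exact hx hk
      · rintro h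
        rw [h] at hx
        exact hx hk'
    · rw [swapMarks_m h, Equiv.swap_apply_def]
      split_ifs <;> assumption
    · rw [swapMarks_src, swapMarks_tgt, swapMarks_w]
      exact ⟨rfl, rfl, rfl⟩
  · unfold swapMarks
    rw [dif_neg h]

end swapMarks

/-- For the divergence condition of `modify`: a regluing preserves the joint contribution of the two
edges it touches. -/
theorem sum_eq_of_eq_off_pair {f h : E → ℤ} {a b : E} (hab : a ≠ b)
    (hoff : ∀ e, e ≠ a → e ≠ b → f e = h e) (hpair : f a + f b = h a + h b) :
    ∑ e, f e = ∑ e, h e := by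
  classical
  have : ∀ f : E → ℤ, ∑ e, f e = (f a + f b) + ∑ e ∈ (Finset.univ.erase a).erase b, f e := by
    intro f
    rw [← Finset.add_sum_erase _ f (Finset.mem_univ a),
      ← Finset.add_sum_erase _ f (Finset.mem_erase.2 ⟨hab.symm, Finset.mem_univ b⟩), add_assoc]
  rw [this f, this h, hpair]
  congr 1
  refine Finset.sum_congr rfl fun e he => ?_
  simp only [Finset.mem_erase] at he
  exact hoff e he.2.1 he.1

/-- `x`, `y`, `z` are the elements marked `j`, `j + 1`, `j + 2`. -/
def At (j : ℕ) (x y z : V ⊕ E) (p : LabeledDiagram V E Δ g) : Prop :=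
  p.m x = j ∧ p.m y = j + 1 ∧ p.m z = j + 2

end LabeledDiagram

/-! ### Regluing an edge past a vertex. -/

namespace LabeledDiagram

variable {V E : Type} [Fintype V] [Fintype E] {Δ : LatticePolygon} {g : ℕ}

section Reglue

variable {j : ℕ} {e e' : E} {v : V} {p : LabeledDiagram V E Δ g}

/-- `e`, `v`, `e'` are consecutive, `e` enters `v` and `e'` leaves it. -/
def IsChain (j : ℕ) (e e' : E) (v : V) (p : LabeledDiagram V E Δ g) : Prop :=
  p.At j (Sum.inr e) (Sum.inl v) (Sum.inr e') ∧ p.tgt e = some v ∧ p.src e' = some v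

/-- `e`, `e'`, `v` are consecutive, `e` and `e'` leave the same vertex, and `e` enters `v`
while `e'` does not. -/
def IsFork (j : ℕ) (e e' : E) (v : V) (p : LabeledDiagram V E Δ g) : Prop :=
  p.At j (Sum.inr e) (Sum.inr e') (Sum.inl v) ∧ p.tgt e = some v ∧ p.tgt e' ≠ some v ∧
    p.src e' = p.src e ∧ p.src e ≠ none

/-- `v`, `e`, `e'` are consecutive, `e` and `e'` enter the same vertex, and `e'` leaves `v`
while `e` does not. -/
def IsJoin (j : ℕ) (e e' : E) (v : V) (p : LabeledDiagram V E Δ g) : Prop :=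
  p.At j (Sum.inl v) (Sum.inr e) (Sum.inr e') ∧ p.src e' = some v ∧ p.src e ≠ some v ∧
    p.tgt e = p.tgt e' ∧ p.tgt e' ≠ none

theorem m_inr_ne {a b : E} (h : a ≠ b) : p.m (Sum.inr a) ≠ p.m (Sum.inr b) :=
  fun h' => h (by simpa using p.m_injective h')

theorem m_inl_ne_inr (a : V) (b : E) : p.m (Sum.inl a) ≠ p.m (Sum.inr b) :=
  fun h' => by simpa using p.m_injective h'

open Classical in
/-- Move the origin of `e'` from `v` to the origin of `e`. -/
noncomputable def chainToFork (h1 : 1 ≤ j) (h2 : j + 2 ≤ Fintype.card V + Fintype.card E)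
    (h : p.IsChain j e e' v) (hw : p.w e' < p.w e) : LabeledDiagram V E Δ g :=
  have hne : e ≠ e' := by
    have h3 := h.1.1
    have h4 := h.1.2.2
    rintro rfl
    omega
  -- Infinite edges have weight 1, whereas e is strictly heavier than e'.
  have hsrc : p.src e ≠ none := fun h' => by
    have h3 := p.weight_infinite e (Or.inl h')
    have h4 := p.w_pos e'
    omega
  p.modify (Function.update p.src e' (p.src e)) p.tgt (Function.update p.w e (p.w e - p.w e'))
    (fun x => Equiv.swap (j + 1) (j + 2) (p.m x))
    (fun a => by
      by_cases ha : a = e'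
      · subst ha
        simp [hsrc, h.2.2]
      · simp [ha])
    (fun _ => Iff.rfl)
    (fun a => by
      by_cases ha : a = e
      · subst ha
        simpa using hw
      · simpa [ha] using p.w_pos a)
    (fun a ha => by
      by_cases hae : a = e
      · subst hae
        simp [hne, hsrc, h.2.1] at ha
      · by_cases hae' : a = e'
        · subst hae'
          simp only [Function.update_self, hsrc, false_or] at ha
          simpa [hae] using p.weight_infinite _ (Or.inr ha)
        · simp only [ne_eq, hae', not_false_eq_true, Function.update_of_ne] at ha
          simpa [hae] using p.weight_infinite _ ha)
    -- The former step along e' is replaced by going back along e to its origin and then forward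
    -- along the moved e'.
    (fun a u t hu ht => by
      by_cases hae' : a = e'
      · subst hae'
        obtain ⟨s, hs⟩ := Option.ne_none_iff_exists'.1 hsrc
        have huv : u = v := by simpa [h.2.2] using hu.symm
        subst huv
        exact .trans _ s _ (.symm _ _ (.rel _ _ ⟨e, by simp [hne, hs], h.2.1⟩))
          (.rel _ _ ⟨a, by simp [hs], ht⟩)
      · exact .rel _ _ ⟨a, by simp [hae', hu], ht⟩)
    -- At v the difference w(e) − w(e') is now carried by e alone; at the origin of e the outgoing
    -- weight w(e) is split between e and e'.
    (fun u => by
      refine sum_eq_of_eq_off_pair hne (fun a ha ha' => by simp [ha, ha']) ?_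
      simp only [Function.update_self, Function.update_of_ne hne, Function.update_of_ne hne.symm,
        h.2.1, h.2.2]
      rw [Nat.cast_sub hw.le]
      ring)
    (p.swap_bijOn (by omega) (by omega))
    (fun a u hu => by
      have k1 := h.1.1
      have k2 := h.1.2.1
      have k3 := h.1.2.2
      by_cases hae' : a = e'
      · subst hae'
        rw [Function.update_self] at hu
        have := p.m_src_lt hu
        simp only [Equiv.swap_apply_def]
        split_ifs <;> omega
      · rw [Function.update_of_ne hae'] at hu
        have := p.m_src_lt hu
        have := p.m_inr_ne hae'
        refine swap_lt_swap ‹_› ?_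
        omega)
    (fun a u hu => by
      have k1 := h.1.1
      have k2 := h.1.2.1
      have k3 := h.1.2.2
      have := p.m_lt_tgt hu
      refine swap_lt_swap this ?_
      have := p.m_inl_ne_inr v a
      omega)

open Classical in
/-- Move the origin of `e'` to `v`. -/
noncomputable def forkToChain (h1 : 1 ≤ j) (h2 : j + 2 ≤ Fintype.card V + Fintype.card E)
    (h : p.IsFork j e e' v) : LabeledDiagram V E Δ g :=
  have hne : e ≠ e' := by
    have h3 := h.1.1
    have h4 := h.1.2.1
    rintro rfl
    omega
  have hsrc : p.src e ≠ none := h.2.2.2.2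
  p.modify (Function.update p.src e' (some v)) p.tgt (Function.update p.w e (p.w e + p.w e'))
    (fun x => Equiv.swap (j + 1) (j + 2) (p.m x))
    (fun a => by
      by_cases ha : a = e'
      · subst ha
        simp [hsrc, h.2.2.2.1]
      · simp [ha])
    (fun _ => Iff.rfl)
    (fun a => by
      by_cases ha : a = e
      · subst ha
        have := p.w_pos a
        simp only [Function.update_self]
        omega
      · simpa [ha] using p.w_pos a)
    (fun a ha => by
      by_cases hae : a = e
      · subst hae
        simp [hne, hsrc, h.2.1] at ha
      · by_cases hae' : a = e'
        · subst hae'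
          simp only [Function.update_self, reduceCtorEq, false_or] at ha
          simpa [hae] using p.weight_infinite _ (Or.inr ha)
        · simp only [ne_eq, hae', not_false_eq_true, Function.update_of_ne] at ha
          simpa [hae] using p.weight_infinite _ ha)
    (fun a u t hu ht => by
      by_cases hae' : a = e'
      · subst hae'
        exact .trans _ v _ (.rel _ _ ⟨e, by simp [hne, ← h.2.2.2.1, hu], h.2.1⟩)
          (.rel _ _ ⟨a, by simp, ht⟩)
      · exact .rel _ _ ⟨a, by simp [hae', hu], ht⟩)
    (fun u => by
      refine sum_eq_of_eq_off_pair hne (fun a ha ha' => by simp [ha, ha']) ?_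
      simp only [Function.update_self, Function.update_of_ne hne, Function.update_of_ne hne.symm,
        h.2.1, h.2.2.2.1]
      push_cast
      ring)
    (p.swap_bijOn (by omega) (by omega))
    (fun a u hu => by
      have k1 := h.1.1
      have k2 := h.1.2.1
      have k3 := h.1.2.2
      by_cases hae' : a = e'
      · subst hae'
        rw [Function.update_self, Option.some.injEq] at hu
        subst hu
        simp only [Equiv.swap_apply_def]
        split_ifs <;> omega
      · rw [Function.update_of_ne hae'] at hu
        have := p.m_src_lt hu
        have := p.m_inl_ne_inr u e'
        refine swap_lt_swap ‹_› ?_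
        omega)
    (fun a u hu => by
      have k1 := h.1.1
      have k2 := h.1.2.1
      have k3 := h.1.2.2
      have := p.m_lt_tgt hu
      refine swap_lt_swap this ?_
      -- The only inequality that the exchange could break comes from e' entering v, which `IsFork`
      -- excludes.
      rintro ⟨k4, k5⟩
      have ha : a = e' := by simpa using p.m_injective (k4.trans k2.symm)
      have hu' : u = v := by simpa using p.m_injective (k5.trans k3.symm)
      subst ha hu'
      exact h.2.2.1 hu)

open Classical in
/-- Move the end of `e` from `v` to the end of `e'`. -/
noncomputable def chainToJoin (h1 : 1 ≤ j) (h2 : j + 2 ≤ Fintype.card V + Fintype.card E)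
    (h : p.IsChain j e e' v) (hw : p.w e < p.w e') : LabeledDiagram V E Δ g :=
  have hne : e ≠ e' := by
    have h3 := h.1.1
    have h4 := h.1.2.2
    rintro rfl
    omega
  have htgt : p.tgt e' ≠ none := fun h' => by
    have h3 := p.weight_infinite e' (Or.inr h')
    have h4 := p.w_pos e
    omega
  p.modify p.src (Function.update p.tgt e (p.tgt e')) (Function.update p.w e' (p.w e' - p.w e))
    (fun x => Equiv.swap j (j + 1) (p.m x))
    (fun _ => Iff.rfl)
    (fun a => by
      by_cases ha : a = e
      · subst ha
        simp [htgt, h.2.1]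
      · simp [ha])
    (fun a => by
      by_cases ha : a = e'
      · subst ha
        simpa using hw
      · simpa [ha] using p.w_pos a)
    (fun a ha => by
      by_cases hae' : a = e'
      · subst hae'
        simp [hne.symm, htgt, h.2.2] at ha
      · by_cases hae : a = e
        · subst hae
          simp only [Function.update_self, htgt, or_false] at ha
          simpa [hae'] using p.weight_infinite _ (Or.inl ha)
        · simp only [ne_eq, hae, not_false_eq_true, Function.update_of_ne] at ha
          simpa [hae'] using p.weight_infinite _ ha)
    (fun a u t hu ht => by
      by_cases hae : a = e
      · subst hae
        obtain ⟨s, hs⟩ := Option.ne_none_iff_exists'.1 htgt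
        have htv : t = v := by simpa [h.2.1] using ht.symm
        subst htv
        exact .trans _ s _ (.rel _ _ ⟨a, hu, by simp [hs]⟩)
          (.symm _ _ (.rel _ _ ⟨e', h.2.2, by simp [hne.symm, hs]⟩))
      · exact .rel _ _ ⟨a, hu, by simp [hae, ht]⟩)
    (fun u => by
      refine sum_eq_of_eq_off_pair hne (fun a ha ha' => by simp [ha, ha']) ?_
      simp only [Function.update_self, Function.update_of_ne hne, Function.update_of_ne hne.symm,
        h.2.1, h.2.2]
      rw [Nat.cast_sub hw.le]
      ring)
    (p.swap_bijOn (by omega) (by omega))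
    (fun a u hu => by
      have k1 := h.1.1
      have k2 := h.1.2.1
      have k3 := h.1.2.2
      have := p.m_src_lt hu
      refine swap_lt_swap this ?_
      have := p.m_inl_ne_inr v a
      omega)
    (fun a u hu => by
      have k1 := h.1.1
      have k2 := h.1.2.1
      have k3 := h.1.2.2
      by_cases hae : a = e
      · subst hae
        rw [Function.update_self] at hu
        have := p.m_lt_tgt hu
        simp only [Equiv.swap_apply_def]
        split_ifs <;> omega
      · rw [Function.update_of_ne hae] at hu
        have := p.m_lt_tgt hu
        have := p.m_inr_ne hae
        refine swap_lt_swap ‹_› ?_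
        omega)

open Classical in
/-- Move the end of `e` to `v`. -/
noncomputable def joinToChain (h1 : 1 ≤ j) (h2 : j + 2 ≤ Fintype.card V + Fintype.card E)
    (h : p.IsJoin j e e' v) : LabeledDiagram V E Δ g :=
  have hne : e ≠ e' := by
    have h3 := h.1.2.1
    have h4 := h.1.2.2
    rintro rfl
    omega
  have htgt : p.tgt e' ≠ none := h.2.2.2.2
  p.modify p.src (Function.update p.tgt e (some v)) (Function.update p.w e' (p.w e' + p.w e))
    (fun x => Equiv.swap j (j + 1) (p.m x))
    (fun _ => Iff.rfl)
    (fun a => by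
      by_cases ha : a = e
      · subst ha
        simp [htgt, h.2.2.2.1]
      · simp [ha])
    (fun a => by
      by_cases ha : a = e'
      · subst ha
        have := p.w_pos a
        simp only [Function.update_self]
        omega
      · simpa [ha] using p.w_pos a)
    (fun a ha => by
      by_cases hae' : a = e'
      · subst hae'
        simp [hne.symm, htgt, h.2.1] at ha
      · by_cases hae : a = e
        · subst hae
          simp only [Function.update_self, reduceCtorEq, or_false] at ha
          simpa [hae'] using p.weight_infinite _ (Or.inl ha)
        · simp only [ne_eq, hae, not_false_eq_true, Function.update_of_ne] at ha
          simpa [hae'] using p.weight_infinite _ ha)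
    (fun a u t hu ht => by
      by_cases hae : a = e
      · subst hae
        exact .trans _ v _ (.rel _ _ ⟨a, hu, by simp⟩)
          (.rel _ _ ⟨e', h.2.1, by simp [hne.symm, ← h.2.2.2.1, ht]⟩)
      · exact .rel _ _ ⟨a, hu, by simp [hae, ht]⟩)
    (fun u => by
      refine sum_eq_of_eq_off_pair hne (fun a ha ha' => by simp [ha, ha']) ?_
      simp only [Function.update_self, Function.update_of_ne hne, Function.update_of_ne hne.symm,
        h.2.1, h.2.2.2.1]
      push_cast
      ring)
    (p.swap_bijOn (by omega) (by omega))
    (fun a u hu => by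
      have k1 := h.1.1
      have k2 := h.1.2.1
      have k3 := h.1.2.2
      have := p.m_src_lt hu
      refine swap_lt_swap this ?_
      rintro ⟨k4, k5⟩
      have ha : a = e := by simpa using p.m_injective (k5.trans k2.symm)
      have hu' : u = v := by simpa using p.m_injective (k4.trans k1.symm)
      subst ha hu'
      exact h.2.2.1 hu)
    (fun a u hu => by
      have k1 := h.1.1
      have k2 := h.1.2.1
      have k3 := h.1.2.2
      by_cases hae : a = e
      · subst hae
        rw [Function.update_self, Option.some.injEq] at hu
        subst hu
        simp only [Equiv.swap_apply_def]
        split_ifs <;> omega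
      · rw [Function.update_of_ne hae] at hu
        have := p.m_lt_tgt hu
        have := p.m_inl_ne_inr u e
        refine swap_lt_swap ‹_› ?_
        omega)

theorem IsChain.ne (h : p.IsChain j e e' v) : e ≠ e' := by
  have h3 := h.1.1
  have h4 := h.1.2.2
  rintro rfl
  omega

theorem IsFork.ne (h : p.IsFork j e e' v) : e ≠ e' := by
  have h3 := h.1.1
  have h4 := h.1.2.1
  rintro rfl
  omega

theorem IsJoin.ne (h : p.IsJoin j e e' v) : e ≠ e' := by
  have h3 := h.1.2.1
  have h4 := h.1.2.2
  rintro rfl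
  omega

/-- e' cannot enter v because it was marked after v; the common origin is a vertex because e has
weight greater than 1. -/
theorem isFork_chainToFork (h1 : 1 ≤ j) (h2 : j + 2 ≤ Fintype.card V + Fintype.card E)
    (h : p.IsChain j e e' v) (hw : p.w e' < p.w e) :
    (chainToFork h1 h2 h hw).IsFork j e e' v := by
  classical
  obtain ⟨⟨k1, k2, k3⟩, k4, k5⟩ := id h
  refine ⟨⟨?_, ?_, ?_⟩, k4, fun h' => ?_, ?_, ?_⟩
  · change Equiv.swap (j + 1) (j + 2) (p.m _) = _
    rw [k1, Equiv.swap_apply_of_ne_of_ne] <;> omega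
  · change Equiv.swap (j + 1) (j + 2) (p.m _) = _
    rw [k3, Equiv.swap_apply_right]
  · change Equiv.swap (j + 1) (j + 2) (p.m _) = _
    rw [k2, Equiv.swap_apply_left]
  · have := p.m_lt_tgt h'
    omega
  · change Function.update p.src e' (p.src e) e' = Function.update p.src e' (p.src e) e
    rw [Function.update_self, Function.update_of_ne h.ne]
  · change Function.update p.src e' (p.src e) e ≠ none
    rw [Function.update_of_ne h.ne]
    intro h'
    have h3 := p.weight_infinite e (Or.inl h')
    have h4 := p.w_pos e'
    omega

theorem isChain_forkToChain (h1 : 1 ≤ j) (h2 : j + 2 ≤ Fintype.card V + Fintype.card E)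
    (h : p.IsFork j e e' v) :
    (forkToChain h1 h2 h).IsChain j e e' v ∧
      (forkToChain h1 h2 h).w e' < (forkToChain h1 h2 h).w e := by
  classical
  obtain ⟨⟨k1, k2, k3⟩, k4, -⟩ := id h
  refine ⟨⟨⟨?_, ?_, ?_⟩, k4, ?_⟩, ?_⟩
  · change Equiv.swap (j + 1) (j + 2) (p.m _) = _
    rw [k1, Equiv.swap_apply_of_ne_of_ne] <;> omega
  · change Equiv.swap (j + 1) (j + 2) (p.m _) = _
    rw [k3, Equiv.swap_apply_right]
  · change Equiv.swap (j + 1) (j + 2) (p.m _) = _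
    rw [k2, Equiv.swap_apply_left]
  · change Function.update p.src e' (some v) e' = some v
    rw [Function.update_self]
  · change Function.update p.w e (p.w e + p.w e') e' < Function.update p.w e (p.w e + p.w e') e
    rw [Function.update_self, Function.update_of_ne h.ne.symm]
    have := p.w_pos e
    omega

theorem isJoin_chainToJoin (h1 : 1 ≤ j) (h2 : j + 2 ≤ Fintype.card V + Fintype.card E)
    (h : p.IsChain j e e' v) (hw : p.w e < p.w e') :
    (chainToJoin h1 h2 h hw).IsJoin j e e' v := by
  classical
  obtain ⟨⟨k1, k2, k3⟩, k4, k5⟩ := id h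
  refine ⟨⟨?_, ?_, ?_⟩, k5, fun h' => ?_, ?_, ?_⟩
  · change Equiv.swap j (j + 1) (p.m _) = _
    rw [k2, Equiv.swap_apply_right]
  · change Equiv.swap j (j + 1) (p.m _) = _
    rw [k1, Equiv.swap_apply_left]
  · change Equiv.swap j (j + 1) (p.m _) = _
    rw [k3, Equiv.swap_apply_of_ne_of_ne] <;> omega
  · have := p.m_src_lt h'
    omega
  · change Function.update p.tgt e (p.tgt e') e = Function.update p.tgt e (p.tgt e') e'
    rw [Function.update_self, Function.update_of_ne h.ne.symm]
  · change Function.update p.tgt e (p.tgt e') e' ≠ none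
    rw [Function.update_of_ne h.ne.symm]
    intro h'
    have h3 := p.weight_infinite e' (Or.inr h')
    have h4 := p.w_pos e
    omega

theorem isChain_joinToChain (h1 : 1 ≤ j) (h2 : j + 2 ≤ Fintype.card V + Fintype.card E)
    (h : p.IsJoin j e e' v) :
    (joinToChain h1 h2 h).IsChain j e e' v ∧
      (joinToChain h1 h2 h).w e < (joinToChain h1 h2 h).w e' := by
  classical
  obtain ⟨⟨k1, k2, k3⟩, k4, -⟩ := id h
  refine ⟨⟨⟨?_, ?_, ?_⟩, ?_, k4⟩, ?_⟩
  · change Equiv.swap j (j + 1) (p.m _) = _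
    rw [k2, Equiv.swap_apply_right]
  · change Equiv.swap j (j + 1) (p.m _) = _
    rw [k1, Equiv.swap_apply_left]
  · change Equiv.swap j (j + 1) (p.m _) = _
    rw [k3, Equiv.swap_apply_of_ne_of_ne] <;> omega
  · change Function.update p.tgt e (some v) e = some v
    rw [Function.update_self]
  · change Function.update p.w e' (p.w e' + p.w e) e < Function.update p.w e' (p.w e' + p.w e) e'
    rw [Function.update_self, Function.update_of_ne h.ne]
    have := p.w_pos e'
    omega

theorem forkToChain_chainToFork (h1 : 1 ≤ j) (h2 : j + 2 ≤ Fintype.card V + Fintype.card E)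
    (h : p.IsChain j e e' v) (hw : p.w e' < p.w e) :
    forkToChain h1 h2 (isFork_chainToFork h1 h2 h hw) = p := by
  classical
  refine ext_data ?_ rfl ?_ rfl rfl ?_
  · change Function.update (Function.update p.src e' (p.src e)) e' (some v) = p.src
    rw [Function.update_idem, ← h.2.2, Function.update_eq_self]
  · change Function.update (Function.update p.w e (p.w e - p.w e')) e
      (Function.update p.w e (p.w e - p.w e') e + Function.update p.w e (p.w e - p.w e') e') = p.w
    rw [Function.update_idem, Function.update_self, Function.update_of_ne h.ne.symm,
      Nat.sub_add_cancel hw.le, Function.update_eq_self]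
  · funext x
    exact Equiv.swap_apply_self _ _ (p.m x)

theorem chainToFork_forkToChain (h1 : 1 ≤ j) (h2 : j + 2 ≤ Fintype.card V + Fintype.card E)
    (h : p.IsFork j e e' v) :
    chainToFork h1 h2 (isChain_forkToChain h1 h2 h).1 (isChain_forkToChain h1 h2 h).2 = p := by
  classical
  refine ext_data ?_ rfl ?_ rfl rfl ?_
  · change Function.update (Function.update p.src e' (some v)) e'
      (Function.update p.src e' (some v) e) = p.src
    rw [Function.update_idem, Function.update_of_ne h.ne, ← h.2.2.2.1, Function.update_eq_self]
  · change Function.update (Function.update p.w e (p.w e + p.w e')) e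
      (Function.update p.w e (p.w e + p.w e') e - Function.update p.w e (p.w e + p.w e') e') = p.w
    rw [Function.update_idem, Function.update_self, Function.update_of_ne h.ne.symm,
      Nat.add_sub_cancel, Function.update_eq_self]
  · funext x
    exact Equiv.swap_apply_self _ _ (p.m x)

theorem joinToChain_chainToJoin (h1 : 1 ≤ j) (h2 : j + 2 ≤ Fintype.card V + Fintype.card E)
    (h : p.IsChain j e e' v) (hw : p.w e < p.w e') :
    joinToChain h1 h2 (isJoin_chainToJoin h1 h2 h hw) = p := by
  classical
  refine ext_data rfl ?_ ?_ rfl rfl ?_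
  · change Function.update (Function.update p.tgt e (p.tgt e')) e (some v) = p.tgt
    rw [Function.update_idem, ← h.2.1, Function.update_eq_self]
  · change Function.update (Function.update p.w e' (p.w e' - p.w e)) e'
      (Function.update p.w e' (p.w e' - p.w e) e' + Function.update p.w e' (p.w e' - p.w e) e) =
        p.w
    rw [Function.update_idem, Function.update_self, Function.update_of_ne h.ne,
      Nat.sub_add_cancel hw.le, Function.update_eq_self]
  · funext x
    exact Equiv.swap_apply_self _ _ (p.m x)

theorem chainToJoin_joinToChain (h1 : 1 ≤ j) (h2 : j + 2 ≤ Fintype.card V + Fintype.card E)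
    (h : p.IsJoin j e e' v) :
    chainToJoin h1 h2 (isChain_joinToChain h1 h2 h).1 (isChain_joinToChain h1 h2 h).2 = p := by
  classical
  refine ext_data rfl ?_ ?_ rfl rfl ?_
  · change Function.update (Function.update p.tgt e (some v)) e
      (Function.update p.tgt e (some v) e') = p.tgt
    rw [Function.update_idem, Function.update_of_ne h.ne.symm, ← h.2.2.2.1,
      Function.update_eq_self]
  · change Function.update (Function.update p.w e' (p.w e' + p.w e)) e'
      (Function.update p.w e' (p.w e' + p.w e) e' - Function.update p.w e' (p.w e' + p.w e) e) =
        p.w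
    rw [Function.update_idem, Function.update_self, Function.update_of_ne h.ne,
      Nat.add_sub_cancel, Function.update_eq_self]
  · funext x
    exact Equiv.swap_apply_self _ _ (p.m x)

/-! ### Effect of the regluing on multiplicities. -/

variable {T : Finset (Finset ℕ)}

theorem multAway_chainToFork (hT : ∀ α ∈ T, Disjoint α {j, j + 1, j + 2}) (h1 : 1 ≤ j)
    (h2 : j + 2 ≤ Fintype.card V + Fintype.card E) (h : p.IsChain j e e' v)
    (hw : p.w e' < p.w e) :
    (chainToFork h1 h2 h hw).toMarked.multAway T {j, j + 1, j + 2} =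
      p.toMarked.multAway T {j, j + 1, j + 2} := by
  classical
  obtain ⟨⟨k1, k2, k3⟩, -, -⟩ := id h
  refine multAway_congr _ _ T _ hT (fun x hx => ?_) (fun x hx => ?_) fun a ha => ⟨?_, rfl, ?_⟩
  · change Equiv.swap (j + 1) (j + 2) (p.m x) = p.m x
    simp only [Finset.mem_insert, Finset.mem_singleton, not_or] at hx
    exact Equiv.swap_apply_of_ne_of_ne hx.2.1 hx.2.2
  · change Equiv.swap (j + 1) (j + 2) (p.m x) ∈ _
    rw [Equiv.swap_apply_def]
    split_ifs <;> simp_all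
  · change Function.update p.src e' (p.src e) a = p.src a
    refine Function.update_of_ne ?_ _ _
    rintro rfl
    simp [k3] at ha
  · change Function.update p.w e (p.w e - p.w e') a = p.w a
    refine Function.update_of_ne ?_ _ _
    rintro rfl
    simp [k1] at ha

theorem multAway_chainToJoin (hT : ∀ α ∈ T, Disjoint α {j, j + 1, j + 2}) (h1 : 1 ≤ j)
    (h2 : j + 2 ≤ Fintype.card V + Fintype.card E) (h : p.IsChain j e e' v)
    (hw : p.w e < p.w e') :
    (chainToJoin h1 h2 h hw).toMarked.multAway T {j, j + 1, j + 2} =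
      p.toMarked.multAway T {j, j + 1, j + 2} := by
  classical
  obtain ⟨⟨k1, k2, k3⟩, -, -⟩ := id h
  refine multAway_congr _ _ T _ hT (fun x hx => ?_) (fun x hx => ?_) fun a ha => ⟨rfl, ?_, ?_⟩
  · change Equiv.swap j (j + 1) (p.m x) = p.m x
    simp only [Finset.mem_insert, Finset.mem_singleton, not_or] at hx
    exact Equiv.swap_apply_of_ne_of_ne hx.1 hx.2.1
  · change Equiv.swap j (j + 1) (p.m x) ∈ _
    rw [Equiv.swap_apply_def]
    split_ifs <;> simp_all
  · change Function.update p.tgt e (p.tgt e') a = p.tgt a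
    refine Function.update_of_ne ?_ _ _
    rintro rfl
    simp [k1] at ha
  · change Function.update p.w e' (p.w e' - p.w e) a = p.w a
    refine Function.update_of_ne ?_ _ _
    rintro rfl
    simp [k3] at ha

-- Regluing is a bijection, and it leaves the weights w(e) − w(e') and w(e'); the correction terms
-- of `quantum_exchange` for chains thereby become contributions of forks.
open Classical in
theorem sum_isFork (hT : ∀ α ∈ T, Disjoint α {j, j + 1, j + 2}) (h1 : 1 ≤ j)
    (h2 : j + 2 ≤ Fintype.card V + Fintype.card E) (e e' : E) (v : V) :
    ∑ p : LabeledDiagram V E Δ g with p.IsChain j e e' v ∧ p.w e' < p.w e,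
        p.toMarked.multAway T {j, j + 1, j + 2} * pairFactor (p.w e - p.w e') (p.w e') =
      ∑ p : LabeledDiagram V E Δ g with p.IsFork j e e' v,
        p.toMarked.multAway T {j, j + 1, j + 2} * pairFactor (p.w e) (p.w e') := by
  refine Finset.sum_bij'
    (fun p hp => chainToFork h1 h2 (Finset.mem_filter.1 hp).2.1 (Finset.mem_filter.1 hp).2.2)
    (fun p hp => forkToChain h1 h2 (Finset.mem_filter.1 hp).2) ?_ ?_ ?_ ?_ ?_
  · intro p hp
    exact Finset.mem_filter.2 ⟨Finset.mem_univ _, isFork_chainToFork _ _ _ _⟩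
  · intro p hp
    exact Finset.mem_filter.2 ⟨Finset.mem_univ _, isChain_forkToChain _ _ _⟩
  · intro p hp
    exact forkToChain_chainToFork _ _ _ _
  · intro p hp
    exact chainToFork_forkToChain _ _ _
  · intro p hp
    have h := (Finset.mem_filter.1 hp).2
    rw [multAway_chainToFork hT]
    change _ = _ * pairFactor (Function.update p.w e (p.w e - p.w e') e)
      (Function.update p.w e (p.w e - p.w e') e')
    rw [Function.update_self, Function.update_of_ne h.1.ne.symm]

open Classical in
theorem sum_isJoin (hT : ∀ α ∈ T, Disjoint α {j, j + 1, j + 2}) (h1 : 1 ≤ j)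
    (h2 : j + 2 ≤ Fintype.card V + Fintype.card E) (e e' : E) (v : V) :
    ∑ p : LabeledDiagram V E Δ g with p.IsChain j e e' v ∧ p.w e < p.w e',
        p.toMarked.multAway T {j, j + 1, j + 2} * pairFactor (p.w e' - p.w e) (p.w e) =
      ∑ p : LabeledDiagram V E Δ g with p.IsJoin j e e' v,
        p.toMarked.multAway T {j, j + 1, j + 2} * pairFactor (p.w e') (p.w e) := by
  refine Finset.sum_bij'
    (fun p hp => chainToJoin h1 h2 (Finset.mem_filter.1 hp).2.1 (Finset.mem_filter.1 hp).2.2)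
    (fun p hp => joinToChain h1 h2 (Finset.mem_filter.1 hp).2) ?_ ?_ ?_ ?_ ?_
  · intro p hp
    exact Finset.mem_filter.2 ⟨Finset.mem_univ _, isJoin_chainToJoin _ _ _ _⟩
  · intro p hp
    exact Finset.mem_filter.2 ⟨Finset.mem_univ _, isChain_joinToChain _ _ _⟩
  · intro p hp
    exact joinToChain_chainToJoin _ _ _ _
  · intro p hp
    exact chainToJoin_joinToChain _ _ _
  · intro p hp
    have h := (Finset.mem_filter.1 hp).2
    rw [multAway_chainToJoin hT]
    change _ = _ * pairFactor (Function.update p.w e' (p.w e' - p.w e) e')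
      (Function.update p.w e' (p.w e' - p.w e) e)
    rw [Function.update_self, Function.update_of_ne h.1.ne]

end Reglue

end LabeledDiagram

/-! ### Moving a pair by one step -/

namespace LabeledDiagram

variable {V E : Type} [Fintype V] [Fintype E] {Δ : LatticePolygon} {g : ℕ}

theorem sum_swapMarks (k : ℕ) {P Q : LabeledDiagram V E Δ g → Prop} [DecidablePred P]
    [DecidablePred Q]
    {f h : LabeledDiagram V E Δ g → ℤ[T;T⁻¹]} (hPQ : ∀ p, P p → Q (p.swapMarks k))
    (hQP : ∀ p, Q p → P (p.swapMarks k)) (hf : ∀ p, P p → f p = h (p.swapMarks k)) :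
    ∑ p with P p, f p = ∑ p with Q p, h p := by
  refine Finset.sum_nbij' (swapMarks k) (swapMarks k) ?_ ?_ ?_ ?_ ?_
  · intro p hp
    exact Finset.mem_filter.2 ⟨Finset.mem_univ _, hPQ p (Finset.mem_filter.1 hp).2⟩
  · intro p hp
    exact Finset.mem_filter.2 ⟨Finset.mem_univ _, hQP p (Finset.mem_filter.1 hp).2⟩
  · exact fun p _ => swapMarks_swapMarks k p
  · exact fun p _ => swapMarks_swapMarks k p
  · exact fun p hp => hf p (Finset.mem_filter.1 hp).2

variable {j : ℕ} {p : LabeledDiagram V E Δ g} {x y z : V ⊕ E}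

theorem At.swap_left (h1 : 1 ≤ j) (h2 : j + 2 ≤ Fintype.card V + Fintype.card E)
    (h : p.At j x y z) (hn : ¬ p.Near x y) : (p.swapMarks j).At j y x z := by
  obtain ⟨k1, k2, k3⟩ := h
  have hs : p.Swappable j := by
    refine ⟨h1, by omega, fun a b ha hb => ?_⟩
    rwa [p.m_injective (ha.trans k1.symm), p.m_injective (hb.trans k2.symm)]
  refine ⟨?_, ?_, ?_⟩ <;> rw [swapMarks_m hs]
  · rw [k2, Equiv.swap_apply_right]
  · rw [k1, Equiv.swap_apply_left]
  · rw [k3, Equiv.swap_apply_of_ne_of_ne] <;> omega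

theorem At.swap_right (h2 : j + 2 ≤ Fintype.card V + Fintype.card E)
    (h : p.At j x y z) (hn : ¬ p.Near y z) : (p.swapMarks (j + 1)).At j x z y := by
  obtain ⟨k1, k2, k3⟩ := h
  have hs : p.Swappable (j + 1) := by
    refine ⟨by omega, by omega, fun a b ha hb => ?_⟩
    rwa [p.m_injective (ha.trans k2.symm), p.m_injective (hb.trans k3.symm)]
  refine ⟨?_, ?_, ?_⟩ <;> rw [swapMarks_m hs]
  · rw [k1, Equiv.swap_apply_of_ne_of_ne] <;> omega
  · rw [k3, Equiv.swap_apply_right]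
  · rw [k2, Equiv.swap_apply_left]

theorem At.swap_left_edges (h1 : 1 ≤ j) (h2 : j + 2 ≤ Fintype.card V + Fintype.card E) {e e' : E}
    (h : p.At j (Sum.inr e) (Sum.inr e') z) :
    (p.swapMarks j).At j (Sum.inr e') (Sum.inr e) z :=
  h.swap_left h1 h2 id

theorem At.swap_right_edges (h2 : j + 2 ≤ Fintype.card V + Fintype.card E) {e e' : E}
    (h : p.At j x (Sum.inr e) (Sum.inr e')) :
    (p.swapMarks (j + 1)).At j x (Sum.inr e') (Sum.inr e) :=
  h.swap_right h2 id

section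

variable {T : Finset (Finset ℕ)}

open Classical in
/-- An element that is incident to neither of two paired elements may be moved past them. -/
theorem sum_rotate (hT : ∀ α ∈ T, Disjoint α {j, j + 1, j + 2}) (h1 : 1 ≤ j)
    (h2 : j + 2 ≤ Fintype.card V + Fintype.card E) (x y z : V ⊕ E) :
    ∑ p : LabeledDiagram V E Δ g with p.At j x y z ∧ ¬ p.Near z x ∧ ¬ p.Near z y,
        p.toMarked.multAway T {j, j + 1, j + 2} *
          (p.toMarked.duoFactor x y * p.toMarked.soloFactor z) =
      ∑ p : LabeledDiagram V E Δ g with p.At j z x y ∧ ¬ p.Near z x ∧ ¬ p.Near z y,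
        p.toMarked.multAway T {j, j + 1, j + 2} *
          (p.toMarked.duoFactor x y * p.toMarked.soloFactor z) := by
  have hf : ∀ k ∈ ({j, j + 1, j + 2} : Finset ℕ), k + 1 ∈ ({j, j + 1, j + 2} : Finset ℕ) →
      ∀ p : LabeledDiagram V E Δ g, p.toMarked.multAway T {j, j + 1, j + 2} *
          (p.toMarked.duoFactor x y * p.toMarked.soloFactor z) =
        (p.swapMarks k).toMarked.multAway T {j, j + 1, j + 2} *
          ((p.swapMarks k).toMarked.duoFactor x y * (p.swapMarks k).toMarked.soloFactor z) := by
    intro k hk hk' p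
    rw [multAway_swapMarks k p T _ hT hk hk',
      duoFactor_congr (swapMarks_src k p) (swapMarks_tgt k p) (swapMarks_w k p),
      soloFactor_congr (swapMarks_w k p)]
  have hnear : ∀ k (p : LabeledDiagram V E Δ g) a b, (p.swapMarks k).Near a b ↔ p.Near a b :=
    fun k p a b => near_congr (swapMarks_src k p) (swapMarks_tgt k p) a b
  have hn := fun p : LabeledDiagram V E Δ g => p.near_comm z x
  have hn' := fun p : LabeledDiagram V E Δ g => p.near_comm z y
  set F : LabeledDiagram V E Δ g → ℤ[T;T⁻¹] := fun p =>
    p.toMarked.multAway T {j, j + 1, j + 2} *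
      (p.toMarked.duoFactor x y * p.toMarked.soloFactor z)
  -- z passes y and then x; neither exchange is blocked, and the ends and weights of the edges do
  -- not change.
  refine (sum_swapMarks (j + 1) (f := F) (h := F)
    (P := fun p => p.At j x y z ∧ ¬ p.Near z x ∧ ¬ p.Near z y) (Q := fun p => p.At j x z y ∧ ¬ p.Near z x ∧ ¬ p.Near z y)
    (fun p hp => ⟨hp.1.swap_right h2 ((hn' p).not.1 hp.2.2), by simpa only [hnear] using hp.2⟩)
    (fun p hp => ⟨hp.1.swap_right h2 hp.2.2, by simpa only [hnear] using hp.2⟩)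
    (fun p _ => hf (j + 1) (by simp) (by simp) p)).trans ?_
  exact sum_swapMarks j (f := F) (h := F)
    (P := fun p => p.At j x z y ∧ ¬ p.Near z x ∧ ¬ p.Near z y)
    (Q := fun p => p.At j z x y ∧ ¬ p.Near z x ∧ ¬ p.Near z y)
    (fun p hp => ⟨hp.1.swap_left h1 h2 ((hn p).not.1 hp.2.1), by simpa only [hnear] using hp.2⟩)
    (fun p hp => ⟨hp.1.swap_left h1 h2 hp.2.1, by simpa only [hnear] using hp.2⟩)
    (fun p _ => hf j (by simp) (by simp) p)

open Classical in
/-- The contribution to the sum for the pair `{j, j + 1}` of the diagrams in which the element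
marked `j + 2` is incident to one of the two other ones. -/
noncomputable def lowerSum (Δ : LatticePolygon) (g : ℕ) (T : Finset (Finset ℕ)) (j : ℕ)
    (x y z : V ⊕ E) : ℤ[T;T⁻¹] :=
  ∑ p : LabeledDiagram V E Δ g with p.At j x y z ∧ ¬ (¬ p.Near z x ∧ ¬ p.Near z y),
    p.toMarked.multAway T {j, j + 1, j + 2} *
      (p.toMarked.duoFactor x y * p.toMarked.soloFactor z)

open Classical in
/-- The contribution to the sum for the pair `{j + 1, j + 2}` of the diagrams in which the
element marked `j` is incident to one of the two other ones. -/
noncomputable def upperSum (Δ : LatticePolygon) (g : ℕ) (T : Finset (Finset ℕ)) (j : ℕ)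
    (x y z : V ⊕ E) : ℤ[T;T⁻¹] :=
  ∑ p : LabeledDiagram V E Δ g with p.At j x y z ∧ ¬ (¬ p.Near x y ∧ ¬ p.Near x z),
    p.toMarked.multAway T {j, j + 1, j + 2} *
      (p.toMarked.duoFactor y z * p.toMarked.soloFactor x)

/-! ### Evaluation of the blocked configurations, by type of the three elements. -/

variable (Δ g T j)

theorem lowerSum_vertex_vertex (v v' : V) (z : V ⊕ E) :
    lowerSum Δ g T j (Sum.inl v) (Sum.inl v') z = 0 :=
  Finset.sum_eq_zero fun p _ => by simp [MarkedFloorDiagram.duoFactor]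

theorem upperSum_vertex_vertex (x : V ⊕ E) (v v' : V) :
    upperSum Δ g T j x (Sum.inl v) (Sum.inl v') = 0 :=
  Finset.sum_eq_zero fun p _ => by simp [MarkedFloorDiagram.duoFactor]

theorem lowerSum_edges (e e' e'' : E) :
    lowerSum Δ g T j (Sum.inr e) (Sum.inr e') (Sum.inr e'' : V ⊕ E) = 0 := by
  classical
  refine Finset.sum_eq_zero fun p hp => ?_
  exact absurd (Finset.mem_filter.1 hp).2.2 (by simp [Near])

theorem upperSum_edges (e e' e'' : E) :
    upperSum Δ g T j (Sum.inr e) (Sum.inr e') (Sum.inr e'' : V ⊕ E) = 0 := by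
  classical
  refine Finset.sum_eq_zero fun p hp => ?_
  exact absurd (Finset.mem_filter.1 hp).2.2 (by simp [Near])

/-- An edge marked before both vertices could only enter them, but it has a single end. -/
theorem lowerSum_edge_vertex_vertex (e : E) (v v' : V) :
    lowerSum Δ g T j (Sum.inr e) (Sum.inl v) (Sum.inl v') = 0 := by
  classical
  refine Finset.sum_eq_zero fun p hp => ?_
  obtain ⟨⟨k1, k2, k3⟩, hn⟩ := (Finset.mem_filter.1 hp).2
  have hnear : p.src e = some v' ∨ p.tgt e = some v' := by
    simpa [Near, or_iff_not_imp_left] using hn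
  have h1 : p.tgt e = some v' := hnear.resolve_left fun h => by
    have := p.m_src_lt h
    omega
  have hadj : ¬ p.toMarked.Adj e v := by
    rintro (h | h)
    · have := p.m_src_lt h
      omega
    · rw [show p.tgt e = some v from h, Option.some.injEq] at h1
      subst h1
      omega
  simp [MarkedFloorDiagram.duoFactor, hadj]

theorem upperSum_vertex_vertex_edge (e : E) (v v' : V) :
    upperSum Δ g T j (Sum.inl v) (Sum.inl v') (Sum.inr e) = 0 := by
  classical
  refine Finset.sum_eq_zero fun p hp => ?_
  obtain ⟨⟨k1, k2, k3⟩, hn⟩ := (Finset.mem_filter.1 hp).2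
  have hnear : p.src e = some v ∨ p.tgt e = some v := by
    simpa [Near, or_iff_not_imp_left] using hn
  have h1 : p.src e = some v := hnear.resolve_right fun h => by
    have := p.m_lt_tgt h
    omega
  have hadj : ¬ p.toMarked.Adj e v' := by
    rintro (h | h)
    · rw [show p.src e = some v' from h, Option.some.injEq] at h1
      subst h1
      omega
    · have := p.m_lt_tgt h
      omega
  simp [MarkedFloorDiagram.duoFactor, hadj]

/-- Diagram by diagram: on either side one adjacency is required by the blocking condition and the
other by `duoFactor`, and the term is then [w(e)](q²). -/
theorem lowerSum_vertex_edge_vertex (e : E) (v v' : V) :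
    lowerSum Δ g T j (Sum.inl v) (Sum.inr e) (Sum.inl v') =
      upperSum Δ g T j (Sum.inl v) (Sum.inr e) (Sum.inl v') := by
  classical
  unfold lowerSum upperSum
  rw [Finset.sum_filter, Finset.sum_filter]
  refine Finset.sum_congr rfl fun p _ => ?_
  have h1 : p.Near (Sum.inl v) (Sum.inr e) ↔ p.toMarked.Adj e v := Iff.rfl
  have h2 : p.Near (Sum.inl v') (Sum.inr e) ↔ p.toMarked.Adj e v' := Iff.rfl
  have h3 : ∀ u u' : V, ¬ p.Near (Sum.inl u) (Sum.inl u') := fun _ _ => id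
  simp only [MarkedFloorDiagram.duoFactor, MarkedFloorDiagram.soloFactor, h1, h2, h3]
  by_cases ha : p.toMarked.Adj e v <;> by_cases hb : p.toMarked.Adj e v' <;> simp [ha, hb]

-- The order of the marks fixes the orientations. If e does not enter v, then `duoFactor` is 0; if
-- e' does not leave v, the configuration is not blocked.
open Classical in
theorem lowerSum_chain (e e' : E) (v : V) :
    lowerSum Δ g T j (Sum.inr e) (Sum.inl v) (Sum.inr e') =
      ∑ p : LabeledDiagram V E Δ g with p.IsChain j e e' v,
        p.toMarked.multAway T {j, j + 1, j + 2} * (quantum 2 (p.w e) * quantum 1 (p.w e') ^ 2) := by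
  unfold lowerSum
  rw [Finset.sum_filter, Finset.sum_filter]
  refine Finset.sum_congr rfl fun p _ => ?_
  by_cases hat : p.At j (Sum.inr e) (Sum.inl v) (Sum.inr e')
  swap
  · simp [hat, IsChain]
  have h1 : p.toMarked.Adj e v ↔ p.tgt e = some v := or_iff_right fun h => by
    have := p.m_src_lt h
    have k1 := hat.1
    have k2 := hat.2.1
    omega
  have h2 : p.Near (Sum.inr e') (Sum.inl v) ↔ p.src e' = some v := or_iff_left fun h => by
    have := p.m_lt_tgt h
    have k1 := hat.2.2
    have k2 := hat.2.1
    omega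
  have h3 : ¬ p.Near (Sum.inr e') (Sum.inr e) := id
  simp only [MarkedFloorDiagram.duoFactor, MarkedFloorDiagram.soloFactor, h1, h2, h3, IsChain, hat]
  by_cases ha : p.tgt e = some v <;> by_cases hb : p.src e' = some v <;> simp [ha, hb]

open Classical in
theorem upperSum_chain (e e' : E) (v : V) :
    upperSum Δ g T j (Sum.inr e) (Sum.inl v) (Sum.inr e') =
      ∑ p : LabeledDiagram V E Δ g with p.IsChain j e e' v,
        p.toMarked.multAway T {j, j + 1, j + 2} * (quantum 2 (p.w e') * quantum 1 (p.w e) ^ 2) := by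
  unfold upperSum
  rw [Finset.sum_filter, Finset.sum_filter]
  refine Finset.sum_congr rfl fun p _ => ?_
  by_cases hat : p.At j (Sum.inr e) (Sum.inl v) (Sum.inr e')
  swap
  · simp [hat, IsChain]
  have h1 : p.toMarked.Adj e' v ↔ p.src e' = some v := or_iff_left fun h => by
    have := p.m_lt_tgt h
    have k1 := hat.2.2
    have k2 := hat.2.1
    omega
  have h2 : p.Near (Sum.inr e) (Sum.inl v) ↔ p.tgt e = some v := or_iff_right fun h => by
    have := p.m_src_lt h
    have k1 := hat.1
    have k2 := hat.2.1
    omega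
  have h3 : ¬ p.Near (Sum.inr e) (Sum.inr e') := id
  simp only [MarkedFloorDiagram.duoFactor, MarkedFloorDiagram.soloFactor, h1, h2, h3, IsChain, hat]
  by_cases ha : p.tgt e = some v <;> by_cases hb : p.src e' = some v <;> simp [ha, hb]

open Classical in
/-- The sum over the diagrams in which `e`, `e'`, `v` are consecutive and `e`, `e'` enter `v`. -/
noncomputable def enterSum (Δ : LatticePolygon) (g : ℕ) (T : Finset (Finset ℕ)) (j : ℕ)
    (f : ℕ → ℕ → ℤ[T;T⁻¹]) (e e' : E) (v : V) : ℤ[T;T⁻¹] :=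
  ∑ p : LabeledDiagram V E Δ g with p.At j (Sum.inr e) (Sum.inr e') (Sum.inl v) ∧
      p.tgt e = some v ∧ p.tgt e' = some v,
    p.toMarked.multAway T {j, j + 1, j + 2} * f (p.w e) (p.w e')

open Classical in
/-- The sum over the diagrams in which `v`, `e`, `e'` are consecutive and `e`, `e'` leave `v`. -/
noncomputable def leaveSum (Δ : LatticePolygon) (g : ℕ) (T : Finset (Finset ℕ)) (j : ℕ)
    (f : ℕ → ℕ → ℤ[T;T⁻¹]) (e e' : E) (v : V) : ℤ[T;T⁻¹] :=
  ∑ p : LabeledDiagram V E Δ g with p.At j (Sum.inl v) (Sum.inr e) (Sum.inr e') ∧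
      p.src e = some v ∧ p.src e' = some v,
    p.toMarked.multAway T {j, j + 1, j + 2} * f (p.w e) (p.w e')

open Classical in
/-- The sum over the diagrams that satisfy `IsFork`. -/
noncomputable def forkSum (Δ : LatticePolygon) (g : ℕ) (T : Finset (Finset ℕ)) (j : ℕ)
    (e e' : E) (v : V) : ℤ[T;T⁻¹] :=
  ∑ p : LabeledDiagram V E Δ g with p.IsFork j e e' v,
    p.toMarked.multAway T {j, j + 1, j + 2} * pairFactor (p.w e) (p.w e')

open Classical in
/-- The sum over the diagrams that satisfy `IsJoin`. -/
noncomputable def joinSum (Δ : LatticePolygon) (g : ℕ) (T : Finset (Finset ℕ)) (j : ℕ)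
    (e e' : E) (v : V) : ℤ[T;T⁻¹] :=
  ∑ p : LabeledDiagram V E Δ g with p.IsJoin j e e' v,
    p.toMarked.multAway T {j, j + 1, j + 2} * pairFactor (p.w e') (p.w e)

/-- The blocking condition forces e to enter v, and `duoFactor` forces e' to do so; a fork is
incompatible with the pair {e', v}. -/
theorem upperSum_enter (e e' : E) (v : V) :
    upperSum Δ g T j (Sum.inr e) (Sum.inr e') (Sum.inl v) =
      enterSum Δ g T j (fun a b => quantum 1 a ^ 2 * quantum 2 b) e e' v := by
  classical
  unfold upperSum enterSum
  rw [Finset.sum_filter, Finset.sum_filter]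
  refine Finset.sum_congr rfl fun p _ => ?_
  by_cases hat : p.At j (Sum.inr e) (Sum.inr e') (Sum.inl v)
  swap
  · simp [hat]
  have h1 : p.toMarked.Adj e' v ↔ p.tgt e' = some v := or_iff_right fun h => by
    have := p.m_src_lt h
    have k1 := hat.2.1
    have k2 := hat.2.2
    omega
  have h2 : p.Near (Sum.inr e) (Sum.inl v) ↔ p.tgt e = some v := or_iff_right fun h => by
    have := p.m_src_lt h
    have k1 := hat.1
    have k2 := hat.2.2
    omega
  have h3 : ¬ p.Near (Sum.inr e) (Sum.inr e') := id
  simp only [MarkedFloorDiagram.duoFactor, MarkedFloorDiagram.soloFactor, h1, h2, h3, hat]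
  by_cases ha : p.tgt e = some v <;> by_cases hb : p.tgt e' = some v <;> simp [ha, hb, mul_comm]

theorem lowerSum_leave (e e' : E) (v : V) :
    lowerSum Δ g T j (Sum.inl v) (Sum.inr e) (Sum.inr e') =
      leaveSum Δ g T j (fun a b => quantum 1 b ^ 2 * quantum 2 a) e e' v := by
  classical
  unfold lowerSum leaveSum
  rw [Finset.sum_filter, Finset.sum_filter]
  refine Finset.sum_congr rfl fun p _ => ?_
  by_cases hat : p.At j (Sum.inl v) (Sum.inr e) (Sum.inr e')
  swap
  · simp [hat]
  have h1 : p.toMarked.Adj e v ↔ p.src e = some v := or_iff_left fun h => by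
    have := p.m_lt_tgt h
    have k1 := hat.1
    have k2 := hat.2.1
    omega
  have h2 : p.Near (Sum.inr e') (Sum.inl v) ↔ p.src e' = some v := or_iff_left fun h => by
    have := p.m_lt_tgt h
    have k1 := hat.1
    have k2 := hat.2.2
    omega
  have h3 : ¬ p.Near (Sum.inr e') (Sum.inr e) := id
  simp only [MarkedFloorDiagram.duoFactor, MarkedFloorDiagram.soloFactor, h1, h2, h3, hat]
  by_cases ha : p.src e = some v <;> by_cases hb : p.src e' = some v <;> simp [ha, hb, mul_comm]

variable {T j}

/-- The pair {e, e'} is compatible in two ways: both edges enter v, or they share their origin and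
exactly one of them enters v. The second way gives the two fork sums, one for each choice of the
entering edge. -/
theorem lowerSum_enter (hT : ∀ α ∈ T, Disjoint α {j, j + 1, j + 2}) (h1 : 1 ≤ j)
    (h2 : j + 2 ≤ Fintype.card V + Fintype.card E) (e e' : E) (v : V) :
    lowerSum Δ g T j (Sum.inr e) (Sum.inr e') (Sum.inl v) =
      enterSum Δ g T j pairFactor e e' v + forkSum Δ g T j e e' v + forkSum Δ g T j e' e v := by
  classical
  -- In this sum e' is marked before e; an exchange of marks brings it to the order used elsewhere.
  have hswap : forkSum Δ g T j e' e v =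
      ∑ p : LabeledDiagram V E Δ g with p.At j (Sum.inr e) (Sum.inr e') (Sum.inl v) ∧
        p.tgt e' = some v ∧ p.tgt e ≠ some v ∧ p.src e = p.src e' ∧ p.src e' ≠ none,
      p.toMarked.multAway T {j, j + 1, j + 2} * pairFactor (p.w e') (p.w e) := by
    unfold forkSum
    refine sum_swapMarks j (V := V) (E := E) (Δ := Δ) (g := g)
      (fun p hp => ?_) (fun p hp => ?_) (fun p hp => ?_)
    · refine ⟨hp.1.swap_left_edges h1 h2, ?_⟩
      rw [swapMarks_src, swapMarks_tgt]
      exact hp.2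
    · refine ⟨hp.1.swap_left_edges h1 h2, ?_⟩
      rw [swapMarks_src, swapMarks_tgt]
      exact hp.2
    · rw [multAway_swapMarks j p T _ hT (by simp) (by simp), swapMarks_w]
  rw [hswap]
  unfold lowerSum enterSum forkSum
  rw [Finset.sum_filter, Finset.sum_filter, Finset.sum_filter, Finset.sum_filter,
    ← Finset.sum_add_distrib, ← Finset.sum_add_distrib]
  refine Finset.sum_congr rfl fun p _ => ?_
  by_cases hat : p.At j (Sum.inr e) (Sum.inr e') (Sum.inl v)
  swap
  · simp [hat, IsFork]
  have k1 := hat.1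
  have k2 := hat.2.1
  have k3 := hat.2.2
  have n1 : p.Near (Sum.inl v) (Sum.inr e) ↔ p.tgt e = some v := or_iff_right fun h => by
    have := p.m_src_lt h
    omega
  have n2 : p.Near (Sum.inl v) (Sum.inr e') ↔ p.tgt e' = some v := or_iff_right fun h => by
    have := p.m_src_lt h
    omega
  have hpar : p.toMarked.Parallel e e' ↔
      (p.tgt e = p.tgt e' ∧ p.tgt e ≠ none) ∨ (p.src e = p.src e' ∧ p.src e ≠ none) := by
    change (∃ u, (p.tgt e = some u ∧ p.tgt e' = some u) ∨ (p.src e = some u ∧ p.src e' = some u)) ↔ _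
    rw [exists_or]
    refine or_congr ?_ ?_
    · rcases p.tgt e with _ | a <;> simp [eq_comm]
    · rcases p.src e with _ | a <;> simp [eq_comm]
  simp only [MarkedFloorDiagram.duoFactor, MarkedFloorDiagram.soloFactor, n1, n2, hpar, hat, IsFork]
  by_cases ha : p.tgt e = some v <;> by_cases hb : p.tgt e' = some v
  · simp [ha, hb]
  · have hb' : some v ≠ p.tgt e' := fun h => hb h.symm
    simp [ha, hb, hb', eq_comm (a := p.src e')]
  · by_cases hs : p.src e = p.src e'
    · simp [ha, hb, hs, pairFactor_comm (p.w e)]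
    · simp [ha, hb, hs]
  · simp [ha, hb]

/-- The mirror image of `lowerSum_enter`, with origins and ends interchanged. -/
theorem upperSum_leave (hT : ∀ α ∈ T, Disjoint α {j, j + 1, j + 2})
    (h2 : j + 2 ≤ Fintype.card V + Fintype.card E) (e e' : E) (v : V) :
    upperSum Δ g T j (Sum.inl v) (Sum.inr e) (Sum.inr e') =
      leaveSum Δ g T j pairFactor e e' v + joinSum Δ g T j e e' v + joinSum Δ g T j e' e v := by
  classical
  have hswap : joinSum Δ g T j e' e v =
      ∑ p : LabeledDiagram V E Δ g with p.At j (Sum.inl v) (Sum.inr e) (Sum.inr e') ∧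
        p.src e = some v ∧ p.src e' ≠ some v ∧ p.tgt e' = p.tgt e ∧ p.tgt e ≠ none,
      p.toMarked.multAway T {j, j + 1, j + 2} * pairFactor (p.w e) (p.w e') := by
    unfold joinSum
    refine sum_swapMarks (j + 1) (V := V) (E := E) (Δ := Δ) (g := g)
      (fun p hp => ?_) (fun p hp => ?_) (fun p hp => ?_)
    · refine ⟨hp.1.swap_right_edges h2, ?_⟩
      rw [swapMarks_src, swapMarks_tgt]
      exact hp.2
    · refine ⟨hp.1.swap_right_edges h2, ?_⟩
      rw [swapMarks_src, swapMarks_tgt]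
      exact hp.2
    · rw [multAway_swapMarks (j + 1) p T _ hT (by simp) (by simp), swapMarks_w]
  rw [hswap]
  unfold upperSum leaveSum joinSum
  rw [Finset.sum_filter, Finset.sum_filter, Finset.sum_filter, Finset.sum_filter,
    ← Finset.sum_add_distrib, ← Finset.sum_add_distrib]
  refine Finset.sum_congr rfl fun p _ => ?_
  by_cases hat : p.At j (Sum.inl v) (Sum.inr e) (Sum.inr e')
  swap
  · simp [hat, IsJoin]
  have k1 := hat.1
  have k2 := hat.2.1
  have k3 := hat.2.2
  have n1 : p.Near (Sum.inl v) (Sum.inr e) ↔ p.src e = some v := or_iff_left fun h => by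
    have := p.m_lt_tgt h
    omega
  have n2 : p.Near (Sum.inl v) (Sum.inr e') ↔ p.src e' = some v := or_iff_left fun h => by
    have := p.m_lt_tgt h
    omega
  have hpar : p.toMarked.Parallel e e' ↔
      (p.tgt e = p.tgt e' ∧ p.tgt e ≠ none) ∨ (p.src e = p.src e' ∧ p.src e ≠ none) := by
    change (∃ u, (p.tgt e = some u ∧ p.tgt e' = some u) ∨ (p.src e = some u ∧ p.src e' = some u)) ↔ _
    rw [exists_or]
    refine or_congr ?_ ?_
    · rcases p.tgt e with _ | a <;> simp [eq_comm]
    · rcases p.src e with _ | a <;> simp [eq_comm]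
  simp only [MarkedFloorDiagram.duoFactor, MarkedFloorDiagram.soloFactor, n1, n2, hpar, hat, IsJoin]
  by_cases ha : p.src e = some v <;> by_cases hb : p.src e' = some v
  · simp [ha, hb]
  · have hb' : some v ≠ p.src e' := fun h => hb h.symm
    simp [ha, hb, hb', eq_comm (a := p.tgt e')]
  · by_cases hs : p.tgt e = p.tgt e'
    · simp [ha, hb, hs, pairFactor_comm (p.w e)]
    · simp [ha, hb, hs]
  · simp [ha, hb]

end

end LabeledDiagram

/-! ### Balance of the blocked configurations. -/

namespace LabeledDiagram

variable {V E : Type} [Fintype V] [Fintype E] {Δ : LatticePolygon} {g : ℕ}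
  {j : ℕ} {T : Finset (Finset ℕ)}

/-- Twice a double sum depends only on the symmetrized summand, and 2 can be cancelled. -/
theorem sum_sum_eq_of_symm {A B : E → E → ℤ[T;T⁻¹]}
    (h : ∀ e e', A e e' + A e' e = B e e' + B e' e) :
    ∑ e, ∑ e', A e e' = ∑ e, ∑ e', B e e' := by
  have key : ∀ A : E → E → ℤ[T;T⁻¹],
      2 * ∑ e, ∑ e', A e e' = ∑ e, ∑ e', (A e e' + A e' e) := by
    intro A
    simp only [Finset.sum_add_distrib]
    rw [Finset.sum_comm (f := fun e e' => A e' e), two_mul]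
  have h2 : (2 : ℤ[T;T⁻¹]) ≠ 0 := by
    intro h0
    have := congrArg (fun f => f.coeff 0) h0
    have e : (2 : ℤ[T;T⁻¹]) = LaurentPolynomial.T 0 + LaurentPolynomial.T 0 := by
      rw [LaurentPolynomial.T_zero]
      norm_num
    rw [e] at this
    simp at this
  refine mul_left_cancel₀ h2 ?_
  rw [key, key]
  simp only [h]

variable (Δ g)

/-- Exchanging the marks of the two edges swaps the arguments of `f`, so only its symmetrization
matters. -/
theorem sum_enterSum (hT : ∀ α ∈ T, Disjoint α {j, j + 1, j + 2}) (h1 : 1 ≤ j)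
    (h2 : j + 2 ≤ Fintype.card V + Fintype.card E) (v : V) {f h : ℕ → ℕ → ℤ[T;T⁻¹]}
    (hfh : ∀ a b, f a b + f b a = h a b + h b a) :
    ∑ e : E, ∑ e' : E, enterSum Δ g T j f e e' v = ∑ e : E, ∑ e' : E, enterSum Δ g T j h e e' v := by
  classical
  have hswap : ∀ (f : ℕ → ℕ → ℤ[T;T⁻¹]) (e e' : E),
      enterSum Δ g T j f e' e v = enterSum Δ g T j (fun a b => f b a) e e' v := by
    intro f e e'
    unfold enterSum
    refine sum_swapMarks j (V := V) (E := E) (Δ := Δ) (g := g)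
      (fun p hp => ?_) (fun p hp => ?_) (fun p hp => ?_)
    · refine ⟨hp.1.swap_left_edges h1 h2, ?_⟩
      rw [swapMarks_tgt]
      exact hp.2.symm
    · refine ⟨hp.1.swap_left_edges h1 h2, ?_⟩
      rw [swapMarks_tgt]
      exact hp.2.symm
    · rw [multAway_swapMarks j p T _ hT (by simp) (by simp), swapMarks_w]
  refine sum_sum_eq_of_symm fun e e' => ?_
  rw [hswap f, hswap h]
  unfold enterSum
  rw [← Finset.sum_add_distrib, ← Finset.sum_add_distrib]
  refine Finset.sum_congr rfl fun p _ => ?_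
  rw [← mul_add, ← mul_add, hfh]

theorem sum_leaveSum (hT : ∀ α ∈ T, Disjoint α {j, j + 1, j + 2})
    (h2 : j + 2 ≤ Fintype.card V + Fintype.card E) (v : V) {f h : ℕ → ℕ → ℤ[T;T⁻¹]}
    (hfh : ∀ a b, f a b + f b a = h a b + h b a) :
    ∑ e : E, ∑ e' : E, leaveSum Δ g T j f e e' v = ∑ e : E, ∑ e' : E, leaveSum Δ g T j h e e' v := by
  classical
  have hswap : ∀ (f : ℕ → ℕ → ℤ[T;T⁻¹]) (e e' : E),
      leaveSum Δ g T j f e' e v = leaveSum Δ g T j (fun a b => f b a) e e' v := by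
    intro f e e'
    unfold leaveSum
    refine sum_swapMarks (j + 1) (V := V) (E := E) (Δ := Δ) (g := g)
      (fun p hp => ?_) (fun p hp => ?_) (fun p hp => ?_)
    · refine ⟨hp.1.swap_right_edges h2, ?_⟩
      rw [swapMarks_src]
      exact hp.2.symm
    · refine ⟨hp.1.swap_right_edges h2, ?_⟩
      rw [swapMarks_src]
      exact hp.2.symm
    · rw [multAway_swapMarks (j + 1) p T _ hT (by simp) (by simp), swapMarks_w]
  refine sum_sum_eq_of_symm fun e e' => ?_
  rw [hswap f, hswap h]
  unfold leaveSum
  rw [← Finset.sum_add_distrib, ← Finset.sum_add_distrib]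
  refine Finset.sum_congr rfl fun p _ => ?_
  rw [← mul_add, ← mul_add, hfh]

/-- Chain by chain, this is `quantum_exchange` with b the smaller weight and c the difference. Forks
compensate the chains whose entering edge is heavier and joins those whose leaving edge is heavier;
equal weights need no correction. -/
theorem lowerSum_add_forkSum (hT : ∀ α ∈ T, Disjoint α {j, j + 1, j + 2}) (h1 : 1 ≤ j)
    (h2 : j + 2 ≤ Fintype.card V + Fintype.card E) (e e' : E) (v : V) :
    lowerSum Δ g T j (Sum.inr e) (Sum.inl v) (Sum.inr e') + 2 * forkSum Δ g T j e e' v =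
      upperSum Δ g T j (Sum.inr e) (Sum.inl v) (Sum.inr e') + 2 * joinSum Δ g T j e e' v := by
  classical
  unfold forkSum joinSum
  rw [← sum_isFork hT h1 h2, ← sum_isJoin hT h1 h2, lowerSum_chain, upperSum_chain]
  simp only [Finset.sum_filter, Finset.mul_sum]
  rw [← Finset.sum_add_distrib, ← Finset.sum_add_distrib]
  refine Finset.sum_congr rfl fun p _ => ?_
  by_cases hc : p.IsChain j e e' v
  swap
  · simp [hc]
  rcases lt_trichotomy (p.w e) (p.w e') with h | h | h
  · have := quantum_exchange (p.w e) (p.w e' - p.w e)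
    rw [Nat.add_sub_cancel' h.le] at this
    simp only [hc, h, h.not_gt, true_and, if_true, if_false]
    linear_combination (- p.toMarked.multAway T {j, j + 1, j + 2}) * this
  · simp [hc, h]
  · have := quantum_exchange (p.w e') (p.w e - p.w e')
    rw [Nat.add_sub_cancel' h.le] at this
    simp only [hc, h, h.not_gt, true_and, if_true, if_false]
    linear_combination (p.toMarked.multAway T {j, j + 1, j + 2}) * this

theorem sum_lowerSum (hT : ∀ α ∈ T, Disjoint α {j, j + 1, j + 2}) (h1 : 1 ≤ j)
    (h2 : j + 2 ≤ Fintype.card V + Fintype.card E) :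
    ∑ x : V ⊕ E, ∑ y : V ⊕ E, ∑ z : V ⊕ E, lowerSum Δ g T j x y z =
      ∑ x : V ⊕ E, ∑ y : V ⊕ E, ∑ z : V ⊕ E, upperSum Δ g T j x y z := by
  simp only [Fintype.sum_sum_type, lowerSum_vertex_vertex, upperSum_vertex_vertex, lowerSum_edges,
    upperSum_edges, lowerSum_edge_vertex_vertex, upperSum_vertex_vertex_edge,
    lowerSum_vertex_edge_vertex, lowerSum_leave, upperSum_enter,
    lowerSum_enter Δ g hT h1 h2, upperSum_leave Δ g hT h2, Finset.sum_const_zero, zero_add,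
    add_zero, Finset.sum_add_distrib]
  have hE : ∑ e : E, ∑ e' : E, ∑ v : V, enterSum Δ g T j pairFactor e e' v =
      ∑ e : E, ∑ e' : E, ∑ v : V,
        enterSum Δ g T j (fun a b => quantum 1 a ^ 2 * quantum 2 b) e e' v := by
    have comm : ∀ f : E → E → V → ℤ[T;T⁻¹],
        ∑ e, ∑ e', ∑ v, f e e' v = ∑ v, ∑ e, ∑ e', f e e' v := by
      intro f
      simp only [Finset.sum_comm (s := (Finset.univ : Finset E)) (t := (Finset.univ : Finset V))]
    rw [comm, comm]
    refine Finset.sum_congr rfl fun v _ => sum_enterSum Δ g hT h1 h2 v fun a b => ?_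
    rw [← two_mul_pairFactor_eq, two_mul, pairFactor_comm b a]
  have hL : ∑ v : V, ∑ e : E, ∑ e' : E, leaveSum Δ g T j pairFactor e e' v =
      ∑ v : V, ∑ e : E, ∑ e' : E,
        leaveSum Δ g T j (fun a b => quantum 1 b ^ 2 * quantum 2 a) e e' v := by
    refine Finset.sum_congr rfl fun v _ => sum_leaveSum Δ g hT h2 v fun a b => ?_
    rw [add_comm (_ * _), ← two_mul_pairFactor_eq, two_mul, pairFactor_comm b a]
  -- Both orders of the edges give the same total, which supplies the factor 2 in
  -- `lowerSum_add_forkSum`.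
  have hF : ∑ e : E, ∑ e' : E, ∑ v : V, forkSum Δ g T j e' e v =
      ∑ e : E, ∑ e' : E, ∑ v : V, forkSum Δ g T j e e' v := Finset.sum_comm
  have hJ : ∑ v : V, ∑ e : E, ∑ e' : E, joinSum Δ g T j e' e v =
      ∑ v : V, ∑ e : E, ∑ e' : E, joinSum Δ g T j e e' v :=
    Finset.sum_congr rfl fun v _ => Finset.sum_comm
  have hC : ∑ e : E, ∑ v : V, ∑ e' : E,
        lowerSum Δ g T j (Sum.inr e) (Sum.inl v) (Sum.inr e') +
          2 * ∑ e : E, ∑ e' : E, ∑ v : V, forkSum Δ g T j e e' v =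
      ∑ e : E, ∑ v : V, ∑ e' : E, upperSum Δ g T j (Sum.inr e) (Sum.inl v) (Sum.inr e') +
        2 * ∑ v : V, ∑ e : E, ∑ e' : E, joinSum Δ g T j e e' v := by
    have c1 : ∑ e : E, ∑ e' : E, ∑ v : V, forkSum Δ g T j e e' v =
        ∑ e : E, ∑ v : V, ∑ e' : E, forkSum Δ g T j e e' v :=
      Finset.sum_congr rfl fun e _ => Finset.sum_comm
    have c2 : ∑ v : V, ∑ e : E, ∑ e' : E, joinSum Δ g T j e e' v =
        ∑ e : E, ∑ v : V, ∑ e' : E, joinSum Δ g T j e e' v := Finset.sum_comm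
    rw [c1, c2]
    simp only [Finset.mul_sum, ← Finset.sum_add_distrib]
    simp only [lowerSum_add_forkSum Δ g hT h1 h2]
  rw [hE, hL, hF, hJ]
  linear_combination hC

variable {Δ g}

/-! ### Invariance under the move of a pair. -/

theorem sum_eq_sum_mark {k : ℕ} (h1 : 1 ≤ k) (h2 : k ≤ Fintype.card V + Fintype.card E)
    (s : Finset (LabeledDiagram V E Δ g)) [∀ x, DecidablePred fun p : LabeledDiagram V E Δ g => p.m x = k]
    (F : LabeledDiagram V E Δ g → ℤ[T;T⁻¹]) :
    ∑ p ∈ s, F p = ∑ x : V ⊕ E, ∑ p ∈ s with p.m x = k, F p := by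
  classical
  choose mark hmark using fun p : LabeledDiagram V E Δ g => p.exists_m_eq h1 h2
  rw [← Finset.sum_fiberwise s mark]
  refine Finset.sum_congr rfl fun x _ => Finset.sum_congr ?_ fun _ _ => rfl
  refine Finset.filter_congr fun p _ => ⟨?_, fun h => p.m_injective ((hmark p).trans h.symm)⟩
  rintro rfl
  exact hmark p

open Classical in
theorem sum_eq_sum_at (h1 : 1 ≤ j) (h2 : j + 2 ≤ Fintype.card V + Fintype.card E)
    (F : LabeledDiagram V E Δ g → ℤ[T;T⁻¹]) :
    ∑ p, F p = ∑ x, ∑ y, ∑ z, ∑ p : LabeledDiagram V E Δ g with p.At j x y z, F p := by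
  rw [sum_eq_sum_mark h1 (by omega)]
  refine Finset.sum_congr rfl fun x _ => ?_
  rw [sum_eq_sum_mark (k := j + 1) (by omega) (by omega)]
  refine Finset.sum_congr rfl fun y _ => ?_
  rw [sum_eq_sum_mark (k := j + 2) (by omega) (by omega)]
  refine Finset.sum_congr rfl fun z _ => Finset.sum_congr ?_ fun _ _ => rfl
  ext p
  simp only [Finset.mem_filter, Finset.mem_univ, true_and, and_assoc]
  rfl

/-- The first factor ignores the three marks and is common to both positions of the pair; only the
local factor differs. -/
theorem mult_insert_lower (hT : ∀ α ∈ T, Disjoint α {j, j + 1, j + 2})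
    {p : LabeledDiagram V E Δ g} {x y z : V ⊕ E} (h : p.At j x y z) :
    p.toMarked.mult (insert {j, j + 1} T) = p.toMarked.multAway T {j, j + 1, j + 2} *
      (p.toMarked.duoFactor x y * p.toMarked.soloFactor z) := by
  obtain ⟨k1, k2, k3⟩ := h
  have hxy : x ≠ y := by
    rintro rfl
    omega
  have hz : ∀ α ∈ insert {j, j + 1} T, p.toMarked.m z ∉ α := by
    intro α hα
    change p.m z ∉ α
    rw [k3]
    rcases Finset.mem_insert.1 hα with rfl | hα
    · simp
    · exact Finset.disjoint_right.1 (hT α hα) (by simp)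
  have hd : ∀ β ∈ T, Disjoint ({p.toMarked.m x, p.toMarked.m y} : Finset ℕ) β := by
    intro β hβ
    change Disjoint ({p.m x, p.m y} : Finset ℕ) β
    rw [k1, k2]
    refine (Finset.disjoint_of_subset_right ?_ (hT β hβ)).symm
    intro a
    simp
    tauto
  have e1 : ({j, j + 1} : Finset ℕ) = {p.toMarked.m x, p.toMarked.m y} := by
    change _ = ({p.m x, p.m y} : Finset ℕ)
    rw [k1, k2]
  rw [← MarkedFloorDiagram.multAway_empty, p.toMarked.multAway_eq_mul_soloFactor _ ∅ z (by simp) hz,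
    e1, p.toMarked.multAway_insert T _ x y hxy hd, ← e1, mul_assoc]
  congr 2
  change insert (p.m z) ∅ ∪ _ = _
  rw [k3]
  ext a
  simp
  tauto

theorem mult_insert_upper (hT : ∀ α ∈ T, Disjoint α {j, j + 1, j + 2})
    {p : LabeledDiagram V E Δ g} {x y z : V ⊕ E} (h : p.At j x y z) :
    p.toMarked.mult (insert {j + 1, j + 2} T) = p.toMarked.multAway T {j, j + 1, j + 2} *
      (p.toMarked.duoFactor y z * p.toMarked.soloFactor x) := by
  obtain ⟨k1, k2, k3⟩ := h
  have hyz : y ≠ z := by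
    rintro rfl
    omega
  have hx : ∀ α ∈ insert {j + 1, j + 2} T, p.toMarked.m x ∉ α := by
    intro α hα
    change p.m x ∉ α
    rw [k1]
    rcases Finset.mem_insert.1 hα with rfl | hα
    · simp
    · exact Finset.disjoint_right.1 (hT α hα) (by simp)
  have hd : ∀ β ∈ T, Disjoint ({p.toMarked.m y, p.toMarked.m z} : Finset ℕ) β := by
    intro β hβ
    change Disjoint ({p.m y, p.m z} : Finset ℕ) β
    rw [k2, k3]
    refine (Finset.disjoint_of_subset_right ?_ (hT β hβ)).symm
    intro a
    simp
    tauto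
  have e1 : ({j + 1, j + 2} : Finset ℕ) = {p.toMarked.m y, p.toMarked.m z} := by
    change _ = ({p.m y, p.m z} : Finset ℕ)
    rw [k2, k3]
  rw [← MarkedFloorDiagram.multAway_empty, p.toMarked.multAway_eq_mul_soloFactor _ ∅ x (by simp) hx,
    e1, p.toMarked.multAway_insert T _ y z hyz hd, ← e1, mul_assoc]
  congr 2
  change insert (p.m x) ∅ ∪ _ = _
  rw [k1]
  ext a
  simp
  tauto

theorem sum_filter_eq_add {α : Type*} [Fintype α] (P Q : α → Prop) [DecidablePred P]
    [DecidablePred Q] (F : α → ℤ[T;T⁻¹]) :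
    ∑ p with P p, F p = ∑ p with P p ∧ Q p, F p + ∑ p with P p ∧ ¬ Q p, F p := by
  simp only [Finset.sum_filter]
  rw [← Finset.sum_add_distrib]
  refine Finset.sum_congr rfl fun p _ => ?_
  by_cases hP : P p <;> by_cases hQ : Q p <;> simp [hP, hQ]

/-- Moving a pair by one step does not change the sum of the multiplicities. -/
theorem sum_mult_insert_eq (hT : ∀ α ∈ T, Disjoint α {j, j + 1, j + 2}) (h1 : 1 ≤ j)
    (h2 : j + 2 ≤ Fintype.card V + Fintype.card E) :
    ∑ p : LabeledDiagram V E Δ g, p.toMarked.mult (insert {j, j + 1} T) =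
      ∑ p : LabeledDiagram V E Δ g, p.toMarked.mult (insert {j + 1, j + 2} T) := by
  classical
  have hl : ∑ p : LabeledDiagram V E Δ g, p.toMarked.mult (insert {j, j + 1} T) =
      ∑ x : V ⊕ E, ∑ y, ∑ z,
        (∑ p : LabeledDiagram V E Δ g with p.At j z x y ∧ ¬ p.Near z x ∧ ¬ p.Near z y,
          p.toMarked.multAway T {j, j + 1, j + 2} *
            (p.toMarked.duoFactor x y * p.toMarked.soloFactor z)) +
      ∑ x : V ⊕ E, ∑ y, ∑ z, lowerSum Δ g T j x y z := by
    rw [sum_eq_sum_at h1 h2]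
    simp only [← Finset.sum_add_distrib]
    refine Finset.sum_congr rfl fun x _ => Finset.sum_congr rfl fun y _ =>
      Finset.sum_congr rfl fun z _ => ?_
    rw [← sum_rotate hT h1 h2, lowerSum, ← sum_filter_eq_add]
    exact Finset.sum_congr rfl fun p hp => mult_insert_lower hT (Finset.mem_filter.1 hp).2
  have hu : ∑ p : LabeledDiagram V E Δ g, p.toMarked.mult (insert {j + 1, j + 2} T) =
      ∑ x : V ⊕ E, ∑ y, ∑ z,
        (∑ p : LabeledDiagram V E Δ g with p.At j x y z ∧ ¬ p.Near x y ∧ ¬ p.Near x z,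
          p.toMarked.multAway T {j, j + 1, j + 2} *
            (p.toMarked.duoFactor y z * p.toMarked.soloFactor x)) +
      ∑ x : V ⊕ E, ∑ y, ∑ z, upperSum Δ g T j x y z := by
    rw [sum_eq_sum_at h1 h2]
    simp only [← Finset.sum_add_distrib]
    refine Finset.sum_congr rfl fun x _ => Finset.sum_congr rfl fun y _ =>
      Finset.sum_congr rfl fun z _ => ?_
    rw [upperSum, ← sum_filter_eq_add]
    exact Finset.sum_congr rfl fun p hp => mult_insert_upper hT (Finset.mem_filter.1 hp).2
  rw [hl, hu, sum_lowerSum Δ g hT h1 h2]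
  -- A cyclic renaming of the summation variables identifies the two sums over unblocked
  -- configurations.
  have rot : ∀ f : V ⊕ E → V ⊕ E → V ⊕ E → ℤ[T;T⁻¹],
      ∑ x, ∑ y, ∑ z, f z x y = ∑ x, ∑ y, ∑ z, f x y z := by
    intro f
    calc _ = ∑ x, ∑ z, ∑ y, f z x y := Finset.sum_congr rfl fun x _ => Finset.sum_comm
      _ = _ := Finset.sum_comm
  rw [rot fun x y z =>
    ∑ p : LabeledDiagram V E Δ g with p.At j x y z ∧ ¬ p.Near x y ∧ ¬ p.Near x z,
      p.toMarked.multAway T {j, j + 1, j + 2} *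
        (p.toMarked.duoFactor y z * p.toMarked.soloFactor x)]

end LabeledDiagram

/-! ### Comparison of pairings -/

/-- Euler characteristic: there are |V| − 1 + g bounded edges, and the horizontal sides count the
infinite ones. In particular all diagrams have equally many edges. -/
theorem MarkedFloorDiagram.card_E_add {Δ : LatticePolygon} {g : ℕ} (D : MarkedFloorDiagram Δ g) :
    Fintype.card D.E + 1 = Fintype.card D.V + g + Δ.ePlus + Δ.eMinus := by
  have h1 := D.toWeightedGraph.card_E
  have h2 := D.genus_eq
  have h3 := D.connected
  unfold WeightedGraph.Connected at h3
  rw [WeightedGraph.genus, h3] at h2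
  rw [D.card_sinks, D.card_sources] at h1
  omega

/-- By `y_le`, y − 1 + g is at most 2 |V| + e⁺ + e⁻ + g − 1, which is the number of elements. -/
theorem MarkedFloorDiagram.two_mul_sMax_le {Δ : LatticePolygon} {g : ℕ}
    (D : MarkedFloorDiagram Δ g) : 2 * Δ.sMax g ≤ Fintype.card D.V + Fintype.card D.E := by
  have h1 := D.card_E_add
  have h2 := Δ.y_le (Fintype.card D.V) D.card_vertices
  have h3 : 0 < Fintype.card D.V := by
    have h := D.connected
    rw [WeightedGraph.Connected, Nat.card_eq_one_iff_unique] at h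
    obtain ⟨⟨v⟩⟩ := h.2
    exact Fintype.card_pos_iff.2 ⟨v⟩
  rw [LatticePolygon.sMax]
  omega

/-- The pairs `{i, i + 1}` with `i ∈ P`. -/
def pairsOf (P : Finset ℕ) : Finset (Finset ℕ) := P.image fun i => {i, i + 1}

/-- The pairs `{i, i + 1}` with `i ∈ P` are disjoint subsets of `{1, …, n}`. -/
def IsSparse (n : ℕ) (P : Finset ℕ) : Prop := ∀ i ∈ P, 1 ≤ i ∧ i + 1 ≤ n ∧ i + 1 ∉ P

theorem pair_injective : Function.Injective fun i : ℕ => ({i, i + 1} : Finset ℕ) := by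
  intro a b h
  have h1 : a ∈ ({b, b + 1} : Finset ℕ) := by
    rw [← show ({a, a + 1} : Finset ℕ) = {b, b + 1} from h]
    simp
  have h2 : b ∈ ({a, a + 1} : Finset ℕ) := by
    rw [show ({a, a + 1} : Finset ℕ) = {b, b + 1} from h]
    simp
  simp only [Finset.mem_insert, Finset.mem_singleton] at h1 h2
  omega

/-- A pair is determined by its smaller element, and disjointness says that no two of these are
consecutive. -/
theorem IsPairing.exists_pairsOf {n s : ℕ} {S : Finset (Finset ℕ)} (h : IsPairing n s S) :
    ∃ P, IsSparse n P ∧ P.card = s ∧ S = pairsOf P := by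
  obtain ⟨h1, h2, h3⟩ := h
  choose! f hf using h1
  have hS : S = pairsOf (S.image f) := by
    rw [pairsOf, Finset.image_image]
    ext α
    simp only [Finset.mem_image, Function.comp_apply]
    constructor
    · exact fun hα => ⟨α, hα, (hf α hα).2.2.symm⟩
    · rintro ⟨β, hβ, rfl⟩
      rwa [← (hf β hβ).2.2]
  refine ⟨S.image f, ?_, ?_, hS⟩
  · intro i hi
    obtain ⟨α, hα, rfl⟩ := Finset.mem_image.1 hi
    refine ⟨(hf α hα).1, (hf α hα).2.1, fun h => ?_⟩
    obtain ⟨β, hβ, hβα⟩ := Finset.mem_image.1 h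
    have hne : α ≠ β := by
      rintro rfl
      omega
    have hd : Disjoint α β := h2 hα hβ hne
    rw [(hf α hα).2.2, (hf β hβ).2.2, hβα] at hd
    simp at hd
  · rw [← h3]
    conv_rhs => rw [hS, pairsOf, Finset.card_image_of_injective _ pair_injective]

/-- The starts `1, 3, …, 2 s - 1` of the pairs `{1, 2}, …, {2 s - 1, 2 s}`. -/
def initialStarts (s : ℕ) : Finset ℕ := (Finset.range s).image fun k => 2 * k + 1

theorem card_initialStarts (s : ℕ) : (initialStarts s).card = s := by
  rw [initialStarts, Finset.card_image_of_injective _ fun a b h => by simpa using h,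
    Finset.card_range]

theorem initialStarts_succ (s : ℕ) :
    initialStarts (s + 1) = insert (2 * s + 1) (initialStarts s) := by
  rw [initialStarts, Finset.range_add_one, Finset.image_insert, initialStarts]

/-- The hypothesis says that no pair can be moved down. Descent by steps of 2 from any start ends at
1 and meets only starts, so the starts are consecutive odd numbers. -/
theorem eq_initialStarts {P : Finset ℕ} (h : ∀ i ∈ P, i = 1 ∨ ∃ k ∈ P, i = k + 2) :
    P = initialStarts P.card := by
  have key : ∀ n, ∀ i ∈ P, i ≤ n → ∃ k, i = 2 * k + 1 ∧ initialStarts (k + 1) ⊆ P := by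
    intro n
    induction n with
    | zero =>
      intro i hi hn
      rcases h i hi with rfl | ⟨k, -, rfl⟩ <;> omega
    | succ n ih =>
      intro i hi hn
      rcases h i hi with rfl | ⟨k, hk, rfl⟩
      · exact ⟨0, rfl, by simpa [initialStarts] using hi⟩
      · obtain ⟨l, rfl, hl⟩ := ih k hk (by omega)
        refine ⟨l + 1, by ring, ?_⟩
        rw [initialStarts_succ]
        exact Finset.insert_subset (by rwa [mul_add, add_right_comm]) hl
  refine Finset.eq_of_subset_of_card_le (fun i hi => ?_) (card_initialStarts _).le
  obtain ⟨k, rfl, hk⟩ := key i i hi le_rfl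
  have := Finset.card_le_card hk
  rw [card_initialStarts] at this
  exact Finset.mem_image.2 ⟨k, Finset.mem_range.2 (by omega), rfl⟩

theorem pairsOf_insert (i : ℕ) (P : Finset ℕ) :
    pairsOf (insert i P) = insert {i, i + 1} (pairsOf P) := Finset.image_insert _ _ _

theorem disjoint_pairsOf {P : Finset ℕ} {A : Finset ℕ} (h : ∀ i ∈ P, i ∉ A ∧ i + 1 ∉ A) :
    ∀ α ∈ pairsOf P, Disjoint α A := by
  intro α hα
  obtain ⟨i, hi, rfl⟩ := Finset.mem_image.1 hα
  simp [h i hi]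

namespace LabeledDiagram

variable {V E : Type} [Fintype V] [Fintype E] {Δ : LatticePolygon} {g : ℕ}

/-- The sum of the multiplicities depends only on the order of the pairing. -/
theorem sum_mult_pairsOf {n : ℕ} (hn : n ≤ Fintype.card V + Fintype.card E) (P : Finset ℕ)
    (hP : IsSparse n P) :
    ∑ p : LabeledDiagram V E Δ g, p.toMarked.mult (pairsOf P) =
      ∑ p : LabeledDiagram V E Δ g, p.toMarked.mult (pairsOf (initialStarts P.card)) := by
  -- Each move of a pair down by one lowers the sum of the starts.
  induction hN : ∑ i ∈ P, i using Nat.strong_induction_on generalizing P with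
  | _ N ih =>
  by_cases hmove : ∀ i ∈ P, i = 1 ∨ ∃ k ∈ P, i = k + 2
  · rw [← eq_initialStarts hmove]
  push Not at hmove
  obtain ⟨i, hi, hi1, hi2⟩ := hmove
  -- The mark j lies in no pair: j is not a start by sparsity, and j − 1 is not one by the choice of
  -- i. So the pair {j + 1, j + 2} may be moved to {j, j + 1}.
  obtain ⟨j, rfl⟩ : ∃ j, i = j + 1 := ⟨i - 1, by have := (hP i hi).1; omega⟩
  have hj : j ∉ P := fun h => (hP j h).2.2 hi
  have hj1 : 1 ≤ j := by omega
  have hle := (hP _ hi).2.1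
  set Q := P.erase (j + 1) with hQ
  have hjQ : j ∉ Q := fun h => hj (Finset.mem_of_mem_erase h)
  have hPQ : P = insert (j + 1) Q := (Finset.insert_erase hi).symm
  have hnot : ∀ k ∈ Q, k ≠ j + 1 ∧ k ≠ j ∧ k ≠ j + 2 ∧ k + 1 ≠ j := by
    intro k hk
    obtain ⟨hk1, hk2⟩ := Finset.mem_erase.1 hk
    refine ⟨hk1, ?_, ?_, ?_⟩
    · rintro rfl
      exact hj hk2
    · rintro rfl
      exact (hP _ hi).2.2 hk2
    · rintro rfl
      exact hi2 k hk2 rfl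
  have hcard : (insert j Q).card = P.card := by
    rw [Finset.card_insert_of_notMem hjQ, hQ, Finset.card_erase_add_one hi]
  have hsum : ∑ i ∈ insert j Q, i < N := by
    rw [Finset.sum_insert hjQ, ← hN, ← Finset.add_sum_erase P (fun i => i) hi, ← hQ]
    omega
  have hsparse : IsSparse n (insert j Q) := by
    intro k hk
    rcases Finset.mem_insert.1 hk with rfl | hk
    · refine ⟨hj1, by omega, fun h => ?_⟩
      rcases Finset.mem_insert.1 h with h | h
      · omega
      · exact (hnot _ h).1 rfl
    · have h1 := hP k (Finset.mem_of_mem_erase hk)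
      refine ⟨h1.1, h1.2.1, fun h => ?_⟩
      rcases Finset.mem_insert.1 h with h | h
      · exact (hnot k hk).2.2.2 h
      · exact h1.2.2 (Finset.mem_of_mem_erase h)
  rw [← hcard, ← ih _ hsum _ hsparse rfl, pairsOf_insert, hPQ, pairsOf_insert]
  refine (sum_mult_insert_eq (disjoint_pairsOf fun k hk => ?_) hj1 (by omega)).symm
  have := hnot k hk
  simp only [Finset.mem_insert, Finset.mem_singleton]
  omega

/-- The initial pairings are nested, so the pairs are added one at a time and the diagrams compared
termwise. -/
theorem coeff_sum_mult_initialStarts_le {s s' : ℕ} (hs : s ≤ s')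
    (hs' : 2 * s' ≤ Fintype.card V + Fintype.card E) (n : ℤ) :
    (∑ p : LabeledDiagram V E Δ g, p.toMarked.mult (pairsOf (initialStarts s'))).coeff n ≤
      (∑ p : LabeledDiagram V E Δ g, p.toMarked.mult (pairsOf (initialStarts s))).coeff n := by
  induction s', hs using Nat.le_induction with
  | base => exact le_rfl
  | succ k hk ih =>
    refine le_trans ?_ (ih (by omega))
    refine CoeffNonneg.coeff_le ?_ n
    rw [← Finset.sum_sub_distrib, initialStarts_succ, pairsOf_insert]
    refine .sum fun p _ => p.toMarked.coeffNonneg_mult_sub_mult_insert _ _ (by omega) ?_ ?_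
    · change 2 * k + 1 + 1 ≤ Fintype.card V + Fintype.card E
      omega
    · refine fun β hβ => (disjoint_pairsOf (fun i hi => ?_) β hβ).symm
      obtain ⟨l, hl, rfl⟩ := Finset.mem_image.1 hi
      have := Finset.mem_range.1 hl
      simp only [Finset.mem_insert, Finset.mem_singleton]
      omega

end LabeledDiagram

/-- `G_g(Δ, s)` is `G_g(Δ, S)` for any pairing `S` of order `s` of `{1, …, 2 s_max(Δ, g)}`. The
claim is that the codegree `i` coefficient does not increase with the order, whatever
pairings of the given orders are used; for `s = s'` this contains the independence of the
pairing. -/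
theorem corollary3p6 (Δ : LatticePolygon) (hΔ : Δ.HTransverse) (g i s s' : ℕ)
    (hs : s ≤ s') (hs' : s' ≤ Δ.sMax g) (S S' : Finset (Finset ℕ))
    (hS : IsPairing (2 * Δ.sMax g) s S) (hS' : IsPairing (2 * Δ.sMax g) s' S') :
    codegreeCoeff Δ g S' i ≤ codegreeCoeff Δ g S i := by
  -- Without diagrams both coefficients are 0; otherwise one diagram provides the vertex and edge
  -- sets on which all the others are labelled.
  rcases isEmpty_or_nonempty (MarkedFloorDiagram Δ g) with hD | ⟨⟨D⟩⟩
  · have : IsEmpty (MarkedFloorDiagram.IsoClass Δ g) :=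
      ⟨fun c => Quotient.inductionOn c fun D => hD.elim D⟩
    simp only [codegreeCoeff, refinedInvariant, finsum_of_isEmpty, le_refl]
  have hmax := D.two_mul_sMax_le
  have hcard : ∀ D' : MarkedFloorDiagram Δ g, Fintype.card D.V = Fintype.card D'.V := fun D' => by
    exact_mod_cast D.card_vertices.trans D'.card_vertices.symm
  have hV : ∀ D' : MarkedFloorDiagram Δ g, Nonempty (D.V ≃ D'.V) := fun D' =>
    Fintype.card_eq.1 (hcard D')
  have hE : ∀ D' : MarkedFloorDiagram Δ g, Nonempty (D.E ≃ D'.E) := fun D' => by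
    refine Fintype.card_eq.1 ?_
    have h1 := D.card_E_add
    have h2 := D'.card_E_add
    have h3 := hcard D'
    omega
  obtain ⟨P, hP, rfl, rfl⟩ := hS.exists_pairsOf
  obtain ⟨P', hP', rfl, rfl⟩ := hS'.exists_pairsOf
  have key := LabeledDiagram.coeff_sum_mult_initialStarts_le (V := D.V) (E := D.E) (Δ := Δ) (g := g)
    hs (by omega) (2 * ((Δ.gMax : ℤ) - g - i))
  rw [← LabeledDiagram.sum_mult_pairsOf hmax P hP, ← LabeledDiagram.sum_mult_pairsOf hmax P' hP',
    LabeledDiagram.sum_mult_eq hV hE, LabeledDiagram.sum_mult_eq hV hE,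
    AddMonoidAlgebra.coeff_smul_apply, AddMonoidAlgebra.coeff_smul_apply, nsmul_eq_mul,
    nsmul_eq_mul] at key
  -- The number of labellings, |V|! |E|!, is a positive factor common to both sides.
  refine le_of_mul_le_mul_left key ?_
  exact_mod_cast Nat.mul_pos (Nat.factorial_pos _) (Nat.factorial_pos _)
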